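/- **Setting.** Let $\lambda$ be a partition of $n$, identified with its Young diagram (English notation); the box $\square$ in row $r$ and column $s$ has content $c(\square)=s-r$. The ground field is $\mathbb{Q}(q,t)$. *Tableaux.* $\mathrm{RYT}(\lambda)$ (resp. $\mathrm{RSSYT}(\lambda)$) is the set of labellings $T:\lambda\to\mathbb{Z}_{\ge 0}$ weakly decreasing along rows and weakly (resp. strictly) decreasing along columns. $\mathrm{PSYT}(\lambda)$ is the set of labellings $\tau$ of $\lambda$ by formal products $jq^b$ ($1\le j\le n$, $b\ge 0$), each $j$ occurring in exactly one box, strictly increasing along rows and columns for the order $jq^m<kq^\ell$ iff $m>\ell$, or $m=\ell$ and $j<k$. $\mathrm{SYT}(\lambda)\subset\mathrm{PSYT}(\lambda)$ consists of the $\tau$ with all exponents $0$. If $\tau(\square)=iq^b$ put $w_\tau(i)=b$, $c_\tau(i)=c(\square)$. $\mathrm{PSYT}(\lambda;T)$ is the set of $\tau$ whose tableau of exponents is $T$. If exchanging the indices $i,i+1$ in $\tau$ (keeping exponents in their boxes) gives an element of $\mathrm{PSYT}(\lambda)$, it is called $s_i(\tau)$; $\Psi(\tau)$ is obtained by replacing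 $kq^a$ by $(k-1)q^a$ for $k\ge 2$ and $1q^a$ by $nq^{a+1}$. $\mathrm{PSYT}(\lambda)$ is ordered by the covers $\Psi(\tau)>\tau$, and $s_i(\tau)>\tau$ if $w_\tau(i)<w_\tau(i+1)$, or $w_\tau(i)=w_\tau(i+1)$ and $c_\tau(i)-c_\tau(i+1)>1$. $\mathrm{Top}(T)$ is the largest element of $\mathrm{PSYT}(\lambda;T)$. $S(T)\in\mathrm{SYT}(\lambda)$ numbers the boxes by decreasing value of $T$, ties being broken by reading down the columns from left to right. For $\tau\in\mathrm{PSYT}(\lambda;T)$, $\mathrm{Inv}(\tau)$ is the set of ordered pairs $(\square_1,\square_2)$ of boxes with $S(T)(\square_1)<S(T)(\square_2)$ and $i>j$, where $\tau(\square_1)=iq^a$, $\tau(\square_2)=jq^b$. *Algebras.* $\mathcal{H}_n$ is the $\mathbb{Q}(q,t)$-algebra generated by $T_1,\dots,T_{n-1}$ with $(T_i-1)(T_i+t)=0$, $T_iT_{i+1}T_i=T_{i+1}T_iT_{i+1}$ and $T_iT_j=T_jT_i$ for $|i-j|>1$. $\mathcal{A}_n$ is generated by $\mathcal{H}_n$ and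 pairwise commuting $\theta_1,\dots,\theta_n$ with $\theta_{i+1}=tT_i^{-1}\theta_iT_i^{-1}$ and $T_i\theta_j=\theta_jT_i$ for $j\ne i,i+1$; put $\pi_n=t^{n-1}\theta_1T_1^{-1}\cdots T_{n-1}^{-1}$. $\mathcal{D}_n$ is generated by $\mathcal{A}_n$ and pairwise commuting $X_1,\dots,X_n$ with $X_{i+1}=tT_i^{-1}X_iT_i^{-1}$, $T_iX_j=X_jT_i$ for $j\neq i,i+1$, $\pi_nX_i=X_{i+1}\pi_n$ for $i<n$, and $\pi_nX_n=qX_1\pi_n$. Let $\rho_n:\mathcal{A}_n\to\mathcal{H}_n$ be the homomorphism with $T_i\mapsto T_i$ and $\theta_i\mapsto\overline\theta_i$, where $\overline\theta_1=1$ and $\overline\theta_{i+1}=tT_i^{-1}\overline\theta_iT_i^{-1}$. Let $\epsilon^{(n)}=\frac{1}{[n]_t!}\sum_{\sigma\in\mathfrak{S}_n}t^{\binom n2-\ell(\sigma)}T_\sigma$, where $[n]_t!=\prod_{i=1}^n\frac{1-t^i}{1-t}$. *Modules.* Denote again by $\lambda$ the $\mathcal{H}_n$-module spanned by $\tau\in\mathrm{SYT}(\lambda)$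 with relations $\overline\theta_i\tau=t^{c_\tau(i)}\tau$; $\big(tT_i^{-1}\overline\theta_i-\overline\theta_i\,tT_i^{-1}\big)\tau=(t^{c_\tau(i)}-t^{c_\tau(i+1)})\,s_i(\tau)$ if $s_i(\tau)>\tau$; $T_i\tau=\tau$ (resp. $T_i\tau=-t\tau$) if $i,i+1$ lie in the same row (resp. column) of $\tau$. Let $V_\lambda=\mathrm{Ind}_{\mathcal{A}_n}^{\mathcal{D}_n}\rho_n^*(\lambda)$, on which $\pi_n$ acts invertibly. The nonsymmetric vector-valued Macdonald polynomials $F_\tau\in V_\lambda$, $\tau\in\mathrm{PSYT}(\lambda)$, are determined by $F_\tau=1\otimes\tau$ for $\tau\in\mathrm{SYT}(\lambda)$; $F_{\Psi(\tau)}=q^{w_\tau(1)}X_n\pi_n^{-1}F_\tau$; and, if $s_i(\tau)>\tau$, $$F_{s_i(\tau)}=\Big(tT_i^{-1}+\frac{(t-1)q^{w_\tau(i+1)}t^{c_\tau(i+1)}}{q^{w_\tau(i)}t^{c_\tau(i)}-q^{w_\tau(i+1)}t^{c_\tau(i+1)}}\Big)F_\tau .$$ For $T\in\mathrm{RYT}(\lambda)$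 let $U_T$ be the span of the $F_\tau$ with $\tau\in\mathrm{PSYT}(\lambda;T)$. For $T\in\mathrm{RSSYT}(\lambda)$ the symmetric vector-valued Macdonald polynomial $P_T$ is the unique element of $\epsilon^{(n)}(U_T)$ of the form $F_{\mathrm{Top}(T)}+\sum_{y\in\mathrm{PSYT}(\lambda;T)\setminus\{\mathrm{Top}(T)\}}\kappa_yF_y$ with $\kappa_y\in\mathbb{Q}(q,t)$. **Proposition.** For every $T\in\mathrm{RSSYT}(\lambda)$, the element $P_T$ exists, is unique, and equals $$P_T=\sum_{\tau\in\mathrm{PSYT}(\lambda;T)}\ \prod_{(\square_1,\square_2)\in\mathrm{Inv}(\tau)}\left(\frac{q^{T(\square_1)}t^{c(\square_1)+1}-q^{T(\square_2)}t^{c(\square_2)}}{q^{T(\square_1)}t^{c(\square_1)}-q^{T(\square_2)}t^{c(\square_2)}}\right)F_\tau .$$ -/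

import Mathlib

open scoped TensorProduct

noncomputable section

namespace VVMac

/-! ## The ground field `ℚ(q,t)` -/

/-- The field `ℚ(q,t)` of rational functions in two variables. -/
abbrev QT : Type := FractionRing (MvPolynomial (Fin 2) ℚ)

/-- The variable `q`. -/
def q : QT := algebraMap (MvPolynomial (Fin 2) ℚ) QT (MvPolynomial.X 0)

/-- The variable `t`. -/
def t : QT := algebraMap (MvPolynomial (Fin 2) ℚ) QT (MvPolynomial.X 1)

theorem t_ne_zero : t ≠ 0 := by
  unfold t
  rw [Ne, FaithfulSMul.algebraMap_eq_zero_iff]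
  exact MvPolynomial.X_ne_zero 1

/-! ## Tableaux

A partition is a `YoungDiagram`; its boxes are the pairs `(row, column)`, counted from `0` and drawn
in English notation.  The labels `1, …, n` are represented by `Fin n`, that is by `0, …, n - 1`. -/

/-- The boxes of the diagram. -/
abbrev Box (μ : YoungDiagram) : Type := {x : ℕ × ℕ // x ∈ μ.cells}

variable {μ : YoungDiagram}

/-- The content of a box: column minus row. -/
def content (x : Box μ) : ℤ := (x.1.2 : ℤ) - (x.1.1 : ℤ)

/-- Two boxes `x`, `y` of the same row, `x` strictly to the left of `y`. -/
def RowLT (x y : Box μ) : Prop := x.1.1 = y.1.1 ∧ x.1.2 < y.1.2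

/-- Two boxes `x`, `y` of the same column, `x` strictly above `y`. -/
def ColLT (x y : Box μ) : Prop := x.1.2 = y.1.2 ∧ x.1.1 < y.1.1

/-- Non-negative reverse Young tableaux. -/
structure RYT (μ : YoungDiagram) where
  /-- the labelling -/
  val : Box μ → ℕ
  row_weak : ∀ x y, RowLT x y → val y ≤ val x
  col_weak : ∀ x y, ColLT x y → val y ≤ val x

/-- A reverse Young tableau is reverse semi-standard if it strictly decreases along columns. -/
def RYT.IsRSSYT (T : RYT μ) : Prop := ∀ x y, ColLT x y → T.val y < T.val x

/-- The order on the formal products `j q^m`: `j q^m < k q^l` if `m > l`, or `m = l` and `j < k`. -/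
def LabelLT {n : ℕ} (u v : Fin n × ℕ) : Prop := v.2 < u.2 ∨ (u.2 = v.2 ∧ u.1 < v.1)

/-- Non-negative periodic standard Young tableaux; the label `(j, b)` stands for `(j + 1) q^b`. -/
structure PSYT (μ : YoungDiagram) where
  /-- the labelling -/
  label : Box μ → Fin μ.card × ℕ
  bij : Function.Bijective fun x => (label x).1
  row_lt : ∀ x y, RowLT x y → LabelLT (label x) (label y)
  col_lt : ∀ x y, ColLT x y → LabelLT (label x) (label y)

/-- For `i = 1, …, n - 1` (represented by `Fin (n - 1)`), the index `i` itself. -/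
def lo {n : ℕ} (i : Fin (n - 1)) : Fin n := ⟨i.1, by omega⟩

/-- For `i = 1, …, n - 1` (represented by `Fin (n - 1)`), the index `i + 1`. -/
def hi {n : ℕ} (i : Fin (n - 1)) : Fin n := ⟨i.1 + 1, by omega⟩

/-- The adjacent transposition `s_i`. -/
def adjSwap {n : ℕ} (i : Fin (n - 1)) : Equiv.Perm (Fin n) := Equiv.swap (lo i) (hi i)

namespace PSYT

theorem ext_label {τ σ : PSYT μ} (h : τ.label = σ.label) : τ = σ := by
  cases τ; cases σ; cases h; rfl

/-- The box in which the index `i` occurs. -/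
def box (τ : PSYT μ) (i : Fin μ.card) : Box μ := (Equiv.ofBijective _ τ.bij).symm i

theorem label_box (τ : PSYT μ) (i : Fin μ.card) : (τ.label (τ.box i)).1 = i :=
  (Equiv.ofBijective _ τ.bij).apply_symm_apply i

theorem box_label (τ : PSYT μ) (x : Box μ) : τ.box (τ.label x).1 = x :=
  (Equiv.ofBijective _ τ.bij).symm_apply_apply x

/-- `w_τ(i)`: the exponent `b` such that `i q^b` occurs in `τ`. -/
def w (τ : PSYT μ) (i : Fin μ.card) : ℕ := (τ.label (τ.box i)).2

/-- `c_τ(i)`: the content of the box in which `i q^b` occurs in `τ`. -/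
def c (τ : PSYT μ) (i : Fin μ.card) : ℤ := content (τ.box i)

/-- The weight `q^{w_τ(i)} t^{c_τ(i)}`. -/
def weight (τ : PSYT μ) (i : Fin μ.card) : QT := q ^ τ.w i * t ^ τ.c i

/-- The tableau `𝔭(τ)` of exponents. -/
def exps (τ : PSYT μ) : RYT μ where
  val x := (τ.label x).2
  row_weak x y h := by
    rcases τ.row_lt x y h with h | h
    · exact h.le
    · exact h.1.ge
  col_weak x y h := by
    rcases τ.col_lt x y h with h | h
    · exact h.le
    · exact h.1.ge

/-- `IsSwap i τ τ'` says that `s_i(τ) = τ'`: exchanging the indices `i` and `i + 1` in `τ`, and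
keeping the exponents in their boxes, gives the periodic standard Young tableau `τ'`. -/
def IsSwap (i : Fin (μ.card - 1)) (τ τ' : PSYT μ) : Prop :=
  ∀ x, τ'.label x = (adjSwap i (τ.label x).1, (τ.label x).2)

/-- If `w_τ(i) ≠ w_τ(i + 1)` then `s_i(τ)` exists. -/
def swapOfNe (τ : PSYT μ) (i : Fin (μ.card - 1)) (h : τ.w (lo i) ≠ τ.w (hi i)) : PSYT μ :=
  have key : ∀ x y, LabelLT (τ.label x) (τ.label y) →
      LabelLT (adjSwap i (τ.label x).1, (τ.label x).2)
        (adjSwap i (τ.label y).1, (τ.label y).2) := by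
    intro x y hxy
    rcases hxy with hxy | ⟨he, hlt⟩
    · exact Or.inl hxy
    · refine Or.inr ⟨he, ?_⟩
      have hne : ¬ ((τ.label x).1 = lo i ∧ (τ.label y).1 = hi i) := by
        rintro ⟨h1, h2⟩
        apply h
        unfold w
        rw [← h1, ← h2, box_label, box_label]
        exact he
      revert hlt hne
      generalize (τ.label x).1 = j
      generalize (τ.label y).1 = k
      intro hlt hne
      simp only [adjSwap, Equiv.swap_apply_def, lo, hi, Fin.ext_iff, Fin.lt_def] at *
      split_ifs <;> simp_all <;> omega
  { label := fun x => (adjSwap i (τ.label x).1, (τ.label x).2)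
    bij := (adjSwap i).bijective.comp τ.bij
    row_lt := fun x y hxy => key x y (τ.row_lt x y hxy)
    col_lt := fun x y hxy => key x y (τ.col_lt x y hxy) }

theorem isSwap_swapOfNe (τ : PSYT μ) (i : Fin (μ.card - 1)) (h : τ.w (lo i) ≠ τ.w (hi i)) :
    IsSwap i τ (τ.swapOfNe i h) := fun _ => rfl

/-- The effect of `Ψ` on labels: `k q^a ↦ (k - 1) q^a` if `k ≥ 2`, and `1 q^a ↦ n q^{a + 1}`. -/
def rotate {n : ℕ} (u : Fin n × ℕ) : Fin n × ℕ :=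
  if u.1.1 = 0 then (⟨n - 1, by have := u.1.2; omega⟩, u.2 + 1)
  else (⟨u.1.1 - 1, by have := u.1.2; omega⟩, u.2)

/-- The inverse effect on labels: `k q^a ↦ (k + 1) q^a` if `k < n`, and `n q^a ↦ 1 q^{a - 1}`. -/
def unrotate {n : ℕ} (u : Fin n × ℕ) : Fin n × ℕ :=
  if h : u.1.1 + 1 < n then (⟨u.1.1 + 1, h⟩, u.2)
  else (⟨0, by have := u.1.2; omega⟩, u.2 - 1)

/-- The operation `Ψ`. -/
def Psi (τ : PSYT μ) : PSYT μ :=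
  have key : ∀ x y, LabelLT (τ.label x) (τ.label y) →
      LabelLT (rotate (τ.label x)) (rotate (τ.label y)) := by
    intro x y
    generalize τ.label x = u
    generalize τ.label y = v
    obtain ⟨⟨j, hj⟩, a⟩ := u
    obtain ⟨⟨k, hk⟩, b⟩ := v
    unfold LabelLT rotate
    simp only [Fin.lt_def]
    split_ifs <;> simp <;> omega
  { label := fun x => rotate (τ.label x)
    bij := by
      have hf : Function.Bijective fun j : Fin μ.card => (rotate (j, 0)).1 := by
        refine Finite.injective_iff_bijective.mp ?_
        rintro ⟨j, hj⟩ ⟨k, hk⟩ h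
        unfold rotate at h
        simp only [Fin.ext_iff] at *
        split_ifs at h <;> simp at h <;> omega
      convert hf.comp τ.bij using 1
      funext x
      simp only [Function.comp, rotate]
      split_ifs <;> rfl
    row_lt := fun x y hxy => key x y (τ.row_lt x y hxy)
    col_lt := fun x y hxy => key x y (τ.col_lt x y hxy) }

/-- If the label `n q^a` of `τ` has `a > 0` then `τ = Ψ(σ)` for this `σ`. -/
def PsiInv (τ : PSYT μ) (h : ∀ i : Fin μ.card, i.1 + 1 = μ.card → 0 < τ.w i) : PSYT μ :=
  have hpos : ∀ x, (τ.label x).1.1 + 1 = μ.card → 0 < (τ.label x).2 := by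
    intro x hx
    have := h _ hx
    unfold w at this
    rwa [box_label] at this
  have key : ∀ x y, LabelLT (τ.label x) (τ.label y) →
      LabelLT (unrotate (τ.label x)) (unrotate (τ.label y)) := by
    intro x y
    have hx := hpos x
    have hy := hpos y
    revert hx hy
    generalize τ.label x = u
    generalize τ.label y = v
    obtain ⟨⟨j, hj⟩, a⟩ := u
    obtain ⟨⟨k, hk⟩, b⟩ := v
    unfold LabelLT unrotate
    simp only [Fin.lt_def]
    split_ifs <;> simp <;> omega
  { label := fun x => unrotate (τ.label x)
    bij := by
      have hf : Function.Bijective fun j : Fin μ.card => (unrotate (j, 0)).1 := by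
        refine Finite.injective_iff_bijective.mp ?_
        rintro ⟨j, hj⟩ ⟨k, hk⟩ h
        unfold unrotate at h
        simp only [Fin.ext_iff] at *
        split_ifs at h <;> simp at h <;> omega
      convert hf.comp τ.bij using 1
      funext x
      simp only [Function.comp, unrotate]
      split_ifs <;> rfl
    row_lt := fun x y hxy => key x y (τ.row_lt x y hxy)
    col_lt := fun x y hxy => key x y (τ.col_lt x y hxy) }

theorem Psi_PsiInv (τ : PSYT μ) (h : ∀ i : Fin μ.card, i.1 + 1 = μ.card → 0 < τ.w i) :
    (τ.PsiInv h).Psi = τ := by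
  apply ext_label
  funext x
  change rotate (unrotate (τ.label x)) = τ.label x
  have hx := h (τ.label x).1
  unfold w at hx
  rw [box_label] at hx
  revert hx
  generalize τ.label x = u
  obtain ⟨⟨j, hj⟩, a⟩ := u
  intro hx
  simp only at hx
  unfold rotate unrotate
  by_cases hj' : j + 1 < μ.card
  · simp [hj']
  · simp [hj', Prod.ext_iff, Fin.ext_iff]
    omega

/-- The cover relations of the partial order: `Cover τ τ'` says that `τ'` covers `τ`. -/
inductive Cover : PSYT μ → PSYT μ → Prop
  | psi (τ : PSYT μ) : Cover τ τ.Psi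
  | swap_exp (i : Fin (μ.card - 1)) (τ τ' : PSYT μ) : IsSwap i τ τ' →
      τ.w (lo i) < τ.w (hi i) → Cover τ τ'
  | swap_content (i : Fin (μ.card - 1)) (τ τ' : PSYT μ) : IsSwap i τ τ' →
      τ.w (lo i) = τ.w (hi i) → 1 < τ.c (lo i) - τ.c (hi i) → Cover τ τ'

/-- The order relation `τ ≤ τ'` generated by the cover relations. -/
def le (τ τ' : PSYT μ) : Prop := Relation.ReflTransGen Cover τ τ'

/-- The strict order relation `τ < τ'` generated by the cover relations. -/
def lt (τ τ' : PSYT μ) : Prop := Relation.TransGen Cover τ τ'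

end PSYT

/-- `PSYT(λ;T)`: the periodic standard Young tableaux `τ` with `𝔭(τ) = T`. -/
abbrev PSYTOver (T : RYT μ) : Type := {τ : PSYT μ // τ.exps = T}

instance (T : RYT μ) : Finite (PSYTOver T) := by
  refine Finite.of_injective
    (fun τ : PSYTOver T => fun x : Box μ => (τ.1.label x).1) ?_
  intro τ σ h
  apply Subtype.ext
  apply PSYT.ext_label
  funext x
  refine Prod.ext (congrFun h x) ?_
  have h1 := congrArg (fun R : RYT μ => R.val x) (τ.2.trans σ.2.symm)
  exact h1

instance (T : RYT μ) : Fintype (PSYTOver T) := Fintype.ofFinite _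

instance (T : RYT μ) : DecidableEq (PSYTOver T) := Classical.decEq _

/-- `τ` is `Top(T)`: the element of `PSYT(λ;T)` above all the others. -/
def IsTop {T : RYT μ} (τ : PSYTOver T) : Prop := ∀ σ : PSYTOver T, PSYT.le σ.1 τ.1

/-- Standard Young tableaux, as the periodic ones all of whose exponents are zero. -/
abbrev SYT (μ : YoungDiagram) : Type := {τ : PSYT μ // ∀ x, (τ.label x).2 = 0}

/-- `x` comes strictly before `y` in the column-standard labelling (down the columns, from the
leftmost column to the rightmost one). -/
def ColumnBefore (x y : Box μ) : Prop := x.1.2 < y.1.2 ∨ (x.1.2 = y.1.2 ∧ x.1.1 < y.1.1)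

/-- The order of the boxes that defines `S(T)`: strictly larger values of `T` come first, boxes with
equal values are ordered by the column-standard labelling. -/
def Before (T : RYT μ) (x y : Box μ) : Prop :=
  T.val y < T.val x ∨ (T.val x = T.val y ∧ ColumnBefore x y)

open Classical in
/-- The label of `x` in the standard Young tableau `S(T)`: its position in the order `Before T`. -/
def stdLabel (T : RYT μ) (x : Box μ) : ℕ := (Finset.univ.filter fun y => Before T y x).card + 1

/-- Inversion pairs of `τ`: ordered pairs of boxes with `S(T)(x) < S(T)(y)`, where `T = 𝔭(τ)`, and
with the index of `τ` in `x` larger than the one in `y`. -/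
def IsInv (τ : PSYT μ) (p : Box μ × Box μ) : Prop :=
  stdLabel τ.exps p.1 < stdLabel τ.exps p.2 ∧ (τ.label p.2).1 < (τ.label p.1).1

open Classical in
/-- The set `Inv(τ)` of inversion pairs. -/
def Inv (τ : PSYT μ) : Finset (Box μ × Box μ) := Finset.univ.filter (IsInv τ)

/-- Labels in `S(T)` compare as the boxes do. -/
theorem stdLabel_lt_iff (T : RYT μ) (x y : Box μ) : stdLabel T x < stdLabel T y ↔ Before T x y := by
  classical
  have htrans : ∀ a b c : Box μ, Before T a b → Before T b c → Before T a c := by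
    intro a b c; unfold Before ColumnBefore; omega
  have hirr : ∀ a : Box μ, ¬ Before T a a := by
    intro a; unfold Before ColumnBefore; omega
  have hmono : ∀ a b : Box μ, Before T a b → stdLabel T a < stdLabel T b := by
    intro a b hab
    unfold stdLabel
    refine Nat.add_lt_add_right (Finset.card_lt_card ?_) 1
    rw [Finset.ssubset_iff_of_subset]
    · exact ⟨a, by simpa using hab, by simpa using hirr a⟩
    · intro c hc
      simp only [Finset.mem_filter, Finset.mem_univ, true_and] at hc ⊢
      exact htrans c a b hc hab
  refine ⟨fun h => ?_, hmono x y⟩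
  by_contra hn
  by_cases hxy : x = y
  · subst hxy; exact lt_irrefl _ h
  · have : Before T y x := by
      have h1 : ¬ (x.1.1 = y.1.1 ∧ x.1.2 = y.1.2) := fun h1 =>
        hxy (Subtype.ext (Prod.ext h1.1 h1.2))
      revert hn; unfold Before ColumnBefore; omega
    exact absurd (hmono y x this) (by omega)

/-! ## Hecke algebras -/

section Generic

variable {A : Type*} [Ring A] [Algebra QT A]

/-- The inverse of an element `x` with `(x - 1)(x + t) = 0`, namely `t⁻¹ (x + t - 1)`. -/
def heckeInv (x : A) : A := t⁻¹ • (x + algebraMap QT A (t - 1))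

theorem mul_heckeInv {x : A} (h : (x - 1) * (x + algebraMap QT A t) = 0) : x * heckeInv x = 1 := by
  have h1 : x * (x + algebraMap QT A (t - 1)) = algebraMap QT A t := by
    rw [map_sub, map_one]
    rw [sub_mul, one_mul, mul_add] at h
    rw [mul_add, mul_sub, mul_one]
    have h2 := sub_eq_zero.mp h
    rw [← sub_eq_zero]
    rw [← sub_eq_zero] at h2
    rw [← h2]
    abel
  rw [heckeInv, mul_smul_comm, h1, Algebra.smul_def, ← map_mul, inv_mul_cancel₀ t_ne_zero, map_one]

theorem heckeInv_mul {x : A} (h : (x - 1) * (x + algebraMap QT A t) = 0) : heckeInv x * x = 1 := by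
  rw [← mul_heckeInv h, heckeInv, smul_mul_assoc, mul_smul_comm, add_mul, mul_add,
    Algebra.commutes]

theorem map_heckeInv {B : Type*} [Ring B] [Algebra QT B] (f : A →ₐ[QT] B) (x : A) :
    f (heckeInv x) = heckeInv (f x) := by
  simp only [heckeInv, map_smul, map_add, AlgHom.commutes]

/-- The element `π_n = t^{n-1} θ_1 T_1⁻¹ ⋯ T_{n-1}⁻¹` (for `n ≥ 1`). -/
def piElt {n : ℕ} (T : Fin (n - 1) → A) (θ : Fin n → A) (h : 0 < n) : A :=
  t ^ (n - 1) • (θ ⟨0, h⟩ * (List.ofFn fun i => heckeInv (T i)).prod)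

end Generic

/-- The defining relations of the finite Hecke algebra on generators `T_1, …, T_{n-1}`. -/
inductive HeckeRel (n : ℕ) :
    FreeAlgebra QT (Fin (n - 1)) → FreeAlgebra QT (Fin (n - 1)) → Prop
  | quad (i : Fin (n - 1)) :
      HeckeRel n ((FreeAlgebra.ι QT i - 1) * (FreeAlgebra.ι QT i + algebraMap QT _ t)) 0
  | braid (i j : Fin (n - 1)) : i.1 + 1 = j.1 →
      HeckeRel n (FreeAlgebra.ι QT i * FreeAlgebra.ι QT j * FreeAlgebra.ι QT i)
        (FreeAlgebra.ι QT j * FreeAlgebra.ι QT i * FreeAlgebra.ι QT j)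
  | comm (i j : Fin (n - 1)) : i.1 + 1 < j.1 →
      HeckeRel n (FreeAlgebra.ι QT i * FreeAlgebra.ι QT j)
        (FreeAlgebra.ι QT j * FreeAlgebra.ι QT i)

/-- The finite Hecke algebra `H_n` over `ℚ(q,t)`. -/
def Hecke (n : ℕ) : Type := RingQuot (HeckeRel n)

instance (n : ℕ) : Ring (Hecke n) := inferInstanceAs (Ring (RingQuot (HeckeRel n)))
instance (n : ℕ) : Algebra QT (Hecke n) := inferInstanceAs (Algebra QT (RingQuot (HeckeRel n)))

/-- The quotient map onto the finite Hecke algebra. -/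
def Hecke.mk (n : ℕ) : FreeAlgebra QT (Fin (n - 1)) →ₐ[QT] Hecke n :=
  RingQuot.mkAlgHom QT (HeckeRel n)

/-- Generators `T_1, …, T_{n-1}`, `θ_1, …, θ_n` of the positive affine Hecke algebra. -/
inductive AffGen (n : ℕ) : Type
  | T (i : Fin (n - 1)) : AffGen n
  | θ (i : Fin n) : AffGen n

/-- The inclusion of the generators `T_i` of `H_n`, on free algebras. -/
def freeHA (n : ℕ) : FreeAlgebra QT (Fin (n - 1)) →ₐ[QT] FreeAlgebra QT (AffGen n) :=
  FreeAlgebra.lift QT fun i => FreeAlgebra.ι QT (AffGen.T i)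

/-- The defining relations of the positive affine Hecke algebra. -/
inductive AffRel (n : ℕ) : FreeAlgebra QT (AffGen n) → FreeAlgebra QT (AffGen n) → Prop
  | hecke {a b : FreeAlgebra QT (Fin (n - 1))} : HeckeRel n a b →
      AffRel n (freeHA n a) (freeHA n b)
  | theta_comm (i j : Fin n) :
      AffRel n (FreeAlgebra.ι QT (AffGen.θ i) * FreeAlgebra.ι QT (AffGen.θ j))
        (FreeAlgebra.ι QT (AffGen.θ j) * FreeAlgebra.ι QT (AffGen.θ i))
  | theta_succ (i : Fin (n - 1)) :
      AffRel n (FreeAlgebra.ι QT (AffGen.θ (hi i)))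
        (t • (heckeInv (FreeAlgebra.ι QT (AffGen.T i)) * FreeAlgebra.ι QT (AffGen.θ (lo i)) *
          heckeInv (FreeAlgebra.ι QT (AffGen.T i))))
  | theta_far (i : Fin (n - 1)) (j : Fin n) : j ≠ lo i → j ≠ hi i →
      AffRel n (FreeAlgebra.ι QT (AffGen.T i) * FreeAlgebra.ι QT (AffGen.θ j))
        (FreeAlgebra.ι QT (AffGen.θ j) * FreeAlgebra.ι QT (AffGen.T i))

/-- The positive affine Hecke algebra `A_n`. -/
def Aff (n : ℕ) : Type := RingQuot (AffRel n)

instance (n : ℕ) : Ring (Aff n) := inferInstanceAs (Ring (RingQuot (AffRel n)))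
instance (n : ℕ) : Algebra QT (Aff n) := inferInstanceAs (Algebra QT (RingQuot (AffRel n)))

/-- The quotient map onto the positive affine Hecke algebra. -/
def Aff.mk (n : ℕ) : FreeAlgebra QT (AffGen n) →ₐ[QT] Aff n := RingQuot.mkAlgHom QT (AffRel n)

/-- Generators `T_i`, `θ_i`, `X_i` of the positive double affine Hecke algebra. -/
inductive DahaGen (n : ℕ) : Type
  | T (i : Fin (n - 1)) : DahaGen n
  | θ (i : Fin n) : DahaGen n
  | X (i : Fin n) : DahaGen n

/-- The inclusion of the generators of `A_n`, on free algebras. -/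
def freeAD (n : ℕ) : FreeAlgebra QT (AffGen n) →ₐ[QT] FreeAlgebra QT (DahaGen n) :=
  FreeAlgebra.lift QT fun g => match g with
    | AffGen.T i => FreeAlgebra.ι QT (DahaGen.T i)
    | AffGen.θ i => FreeAlgebra.ι QT (DahaGen.θ i)

/-- The element `π_n` in the free algebra on the generators. -/
def freePi (n : ℕ) (h : 0 < n) : FreeAlgebra QT (DahaGen n) :=
  piElt (fun i => FreeAlgebra.ι QT (DahaGen.T i)) (fun i => FreeAlgebra.ι QT (DahaGen.θ i)) h

/-- The defining relations of the positive double affine Hecke algebra. -/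
inductive DahaRel (n : ℕ) : FreeAlgebra QT (DahaGen n) → FreeAlgebra QT (DahaGen n) → Prop
  | aff {a b : FreeAlgebra QT (AffGen n)} : AffRel n a b → DahaRel n (freeAD n a) (freeAD n b)
  | X_comm (i j : Fin n) :
      DahaRel n (FreeAlgebra.ι QT (DahaGen.X i) * FreeAlgebra.ι QT (DahaGen.X j))
        (FreeAlgebra.ι QT (DahaGen.X j) * FreeAlgebra.ι QT (DahaGen.X i))
  | X_succ (i : Fin (n - 1)) :
      DahaRel n (FreeAlgebra.ι QT (DahaGen.X (hi i)))
        (t • (heckeInv (FreeAlgebra.ι QT (DahaGen.T i)) * FreeAlgebra.ι QT (DahaGen.X (lo i)) *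
          heckeInv (FreeAlgebra.ι QT (DahaGen.T i))))
  | X_far (i : Fin (n - 1)) (j : Fin n) : j ≠ lo i → j ≠ hi i →
      DahaRel n (FreeAlgebra.ι QT (DahaGen.T i) * FreeAlgebra.ι QT (DahaGen.X j))
        (FreeAlgebra.ι QT (DahaGen.X j) * FreeAlgebra.ι QT (DahaGen.T i))
  | pi_X (h : 0 < n) (i : Fin (n - 1)) :
      DahaRel n (freePi n h * FreeAlgebra.ι QT (DahaGen.X (lo i)))
        (FreeAlgebra.ι QT (DahaGen.X (hi i)) * freePi n h)
  | pi_X_last (h : 0 < n) :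
      DahaRel n (freePi n h * FreeAlgebra.ι QT (DahaGen.X ⟨n - 1, by omega⟩))
        (q • (FreeAlgebra.ι QT (DahaGen.X ⟨0, h⟩) * freePi n h))

/-- The positive double affine Hecke algebra `D_n`. -/
def Daha (n : ℕ) : Type := RingQuot (DahaRel n)

instance (n : ℕ) : Ring (Daha n) := inferInstanceAs (Ring (RingQuot (DahaRel n)))
instance (n : ℕ) : Algebra QT (Daha n) := inferInstanceAs (Algebra QT (RingQuot (DahaRel n)))

/-- The quotient map onto the positive double affine Hecke algebra. -/
def Daha.mk (n : ℕ) : FreeAlgebra QT (DahaGen n) →ₐ[QT] Daha n := RingQuot.mkAlgHom QT (DahaRel n)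

/-- The generator `T_i` of `H_n`. -/
def Hecke.T {n : ℕ} (i : Fin (n - 1)) : Hecke n := Hecke.mk n (FreeAlgebra.ι QT i)

/-- The generator `T_i` of `D_n`. -/
def Daha.T {n : ℕ} (i : Fin (n - 1)) : Daha n := Daha.mk n (FreeAlgebra.ι QT (DahaGen.T i))

/-- The generator `θ_i` of `D_n`. -/
def Daha.θ {n : ℕ} (i : Fin n) : Daha n := Daha.mk n (FreeAlgebra.ι QT (DahaGen.θ i))

/-- The generator `X_i` of `D_n`. -/
def Daha.X {n : ℕ} (i : Fin n) : Daha n := Daha.mk n (FreeAlgebra.ι QT (DahaGen.X i))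

/-- The element `π_n` of `D_n`. -/
def Daha.pi {n : ℕ} (h : 0 < n) : Daha n := piElt Daha.T Daha.θ h

theorem Hecke.mk_rel {n : ℕ} {a b : FreeAlgebra QT (Fin (n - 1))} (h : HeckeRel n a b) :
    Hecke.mk n a = Hecke.mk n b := RingQuot.mkAlgHom_rel QT h

theorem Aff.mk_rel {n : ℕ} {a b : FreeAlgebra QT (AffGen n)} (h : AffRel n a b) :
    Aff.mk n a = Aff.mk n b := RingQuot.mkAlgHom_rel QT h

theorem Daha.mk_rel {n : ℕ} {a b : FreeAlgebra QT (DahaGen n)} (h : DahaRel n a b) :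
    Daha.mk n a = Daha.mk n b := RingQuot.mkAlgHom_rel QT h

/-- The canonical map `H_n → A_n`. -/
def heckeToAff (n : ℕ) : Hecke n →ₐ[QT] Aff n :=
  RingQuot.liftAlgHom QT ⟨(Aff.mk n).comp (freeHA n), fun _ _ h => Aff.mk_rel (AffRel.hecke h)⟩

/-- The canonical map `A_n → D_n`. -/
def affToDaha (n : ℕ) : Aff n →ₐ[QT] Daha n :=
  RingQuot.liftAlgHom QT ⟨(Daha.mk n).comp (freeAD n), fun _ _ h => Daha.mk_rel (DahaRel.aff h)⟩

/-- `θ̄_{k+1}`, indexed by all natural numbers `k` (with value `0` for `k ≥ n`). -/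
def thetaBarNat (n : ℕ) : ℕ → Hecke n
  | 0 => 1
  | k + 1 => if h : k < n - 1 then
      t • (heckeInv (Hecke.T ⟨k, h⟩) * thetaBarNat n k * heckeInv (Hecke.T ⟨k, h⟩)) else 0

/-- The elements `θ̄_i` of `H_n`: `θ̄_1 = 1` and `θ̄_{i+1} = t T_i⁻¹ θ̄_i T_i⁻¹`. -/
def thetaBar {n : ℕ} (i : Fin n) : Hecke n := thetaBarNat n i.1

/-- The elements `φ̄_i = (t T_i⁻¹) θ̄_i - θ̄_i (t T_i⁻¹)` of `H_n`. -/
def phiBar {n : ℕ} (i : Fin (n - 1)) : Hecke n :=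
  (t • heckeInv (Hecke.T i)) * thetaBar (lo i) - thetaBar (lo i) * (t • heckeInv (Hecke.T i))

theorem Hecke.quad {n : ℕ} (i : Fin (n - 1)) :
    (Hecke.T i - 1) * (Hecke.T i + algebraMap QT (Hecke n) t) = 0 := by
  have h := Hecke.mk_rel (HeckeRel.quad i)
  simpa [Hecke.T] using h

theorem Hecke.braid {n : ℕ} (i j : Fin (n - 1)) (hij : i.1 + 1 = j.1) :
    (Hecke.T i * Hecke.T j * Hecke.T i : Hecke n) = Hecke.T j * Hecke.T i * Hecke.T j := by
  have h := Hecke.mk_rel (HeckeRel.braid i j hij)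
  simpa [Hecke.T] using h

theorem Hecke.comm {n : ℕ} (i j : Fin (n - 1)) (hij : i.1 + 1 < j.1) :
    Commute (Hecke.T i : Hecke n) (Hecke.T j) := by
  have h := Hecke.mk_rel (HeckeRel.comm i j hij)
  simp only [map_mul] at h
  exact h

theorem commute_heckeInv {A : Type*} [Ring A] [Algebra QT A] {x y : A} (h : Commute x y) :
    Commute x (heckeInv y) :=
  (h.add_right (Algebra.commute_algebraMap_right _ _)).smul_right _

theorem Hecke.commute_thetaBarNat_of_lt {n : ℕ} (j : Fin (n - 1)) (k : ℕ) (h : k < j.1) :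
    Commute (Hecke.T j : Hecke n) (thetaBarNat n k) := by
  induction k with
  | zero => exact Commute.one_right _
  | succ k ih =>
    rw [thetaBarNat]
    split_ifs with hk
    · have h1 : Commute (Hecke.T j : Hecke n) (heckeInv (Hecke.T ⟨k, hk⟩)) :=
        commute_heckeInv (Hecke.comm (⟨k, hk⟩ : Fin (n - 1)) j h).symm
      exact ((h1.mul_right (ih (by omega))).mul_right h1).smul_right _
    · exact Commute.zero_right _

theorem Hecke.commute_thetaBarNat_of_gt {n : ℕ} (j : Fin (n - 1)) (k : ℕ) (h : j.1 + 1 < k) :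
    Commute (Hecke.T j : Hecke n) (thetaBarNat n k) := by
  induction k with
  | zero => omega
  | succ k ih =>
    rw [thetaBarNat]
    split_ifs with hk
    · rcases Nat.lt_or_ge (j.1 + 1) k with hjk | hjk
      · have h1 : Commute (Hecke.T j : Hecke n) (heckeInv (Hecke.T ⟨k, hk⟩)) :=
          commute_heckeInv (Hecke.comm j (⟨k, hk⟩ : Fin (n - 1)) hjk)
        exact ((h1.mul_right (ih hjk)).mul_right h1).smul_right _
      · obtain rfl : k = j.1 + 1 := by omega
        rw [thetaBarNat, dif_pos j.2]
        have hX := Hecke.commute_thetaBarNat_of_lt (⟨j.1 + 1, hk⟩ : Fin (n - 1)) j.1 (by simp)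
        have hbr := Hecke.braid j ⟨j.1 + 1, hk⟩ rfl
        have hx := mul_heckeInv (Hecke.quad j)
        have hx' := heckeInv_mul (Hecke.quad j)
        have hy := mul_heckeInv (Hecke.quad (⟨j.1 + 1, hk⟩ : Fin (n - 1)))
        have hy' := heckeInv_mul (Hecke.quad (⟨j.1 + 1, hk⟩ : Fin (n - 1)))
        change Commute (Hecke.T j : Hecke n) (t • (_ * (t • (heckeInv (Hecke.T j) *
          thetaBarNat n j.1 * heckeInv (Hecke.T j))) * _))
        rw [mul_smul_comm, smul_mul_assoc]
        refine (Commute.smul_right ?_ _).smul_right _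
        generalize thetaBarNat n j.1 = Z at *
        generalize heckeInv (Hecke.T j : Hecke n) = a at *
        generalize heckeInv (Hecke.T (⟨j.1 + 1, hk⟩ : Fin (n - 1)) : Hecke n) = b at *
        generalize (Hecke.T j : Hecke n) = x at *
        generalize (Hecke.T (⟨j.1 + 1, hk⟩ : Fin (n - 1)) : Hecke n) = y at *
        have e1 : x * b * a = b * a * y := by
          calc x * b * a = b * (a * x) * y * x * b * a := by rw [hx', mul_one, hy', one_mul]
            _ = b * a * (x * y * x) * b * a := by simp only [mul_assoc]
            _ = b * a * y * (x * (y * b) * a) := by rw [hbr]; simp only [mul_assoc]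
            _ = b * a * y := by rw [hy, mul_one, hx, mul_one]
        have e2 : a * b * x = y * a * b := by
          calc a * b * x = a * b * x * y * (x * a) * b := by
                rw [hx, mul_one, mul_assoc (a * b * x) y b, hy, mul_one]
            _ = a * b * (x * y * x) * a * b := by simp only [mul_assoc]
            _ = (a * (b * y) * x) * y * a * b := by rw [hbr]; simp only [mul_assoc]
            _ = y * a * b := by rw [hy', mul_one, hx', one_mul]
        change x * (b * (a * Z * a) * b) = b * (a * Z * a) * b * x
        calc x * (b * (a * Z * a) * b) = (x * b * a) * Z * a * b := by simp only [mul_assoc]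
          _ = b * a * (y * Z) * a * b := by rw [e1]; simp only [mul_assoc]
          _ = b * a * Z * (y * a * b) := by rw [hX.eq]; simp only [mul_assoc]
          _ = b * (a * Z * a) * b * x := by rw [← e2]; simp only [mul_assoc]
    · exact Commute.zero_right _

theorem commute_thetaBarNat {n : ℕ} (i k : ℕ) (h : i < k) :
    Commute (thetaBarNat n i) (thetaBarNat n k) := by
  induction i with
  | zero => exact Commute.one_left _
  | succ i ih =>
    rw [thetaBarNat]
    split_ifs with hi
    · have h1 : Commute (heckeInv (Hecke.T ⟨i, hi⟩)) (thetaBarNat n k) :=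
        (commute_heckeInv (Hecke.commute_thetaBarNat_of_gt ⟨i, hi⟩ k h).symm).symm
      exact ((h1.mul_left (ih (by omega))).mul_left h1).smul_left _
    · exact Commute.zero_left _

theorem commute_thetaBar {n : ℕ} (i k : Fin n) :
    (thetaBar i * thetaBar k : Hecke n) = thetaBar k * thetaBar i := by
  rcases lt_trichotomy i k with h | h | h
  · exact (commute_thetaBarNat _ _ h).eq
  · rw [h]
  · exact (commute_thetaBarNat _ _ h).eq.symm

theorem thetaBar_succ {n : ℕ} (i : Fin (n - 1)) : (thetaBar (hi i) : Hecke n) =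
    t • (heckeInv (Hecke.T i) * thetaBar (lo i) * heckeInv (Hecke.T i)) := by
  change thetaBarNat n (i.1 + 1) = _
  rw [thetaBarNat, dif_pos i.2]
  rfl

/-- The map `T_i ↦ T_i`, `θ_i ↦ θ̄_i` on free algebras. -/
def freeRho (n : ℕ) : FreeAlgebra QT (AffGen n) →ₐ[QT] Hecke n :=
  FreeAlgebra.lift QT fun g => match g with
    | AffGen.T i => Hecke.T i
    | AffGen.θ i => thetaBar i

theorem freeRho_rel {n : ℕ} {a b : FreeAlgebra QT (AffGen n)} (h : AffRel n a b) :
    freeRho n a = freeRho n b := by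
  have hT : ∀ i, freeRho n (FreeAlgebra.ι QT (AffGen.T i)) = Hecke.T i := fun i => by
    simp [freeRho]
  have hθ : ∀ i, freeRho n (FreeAlgebra.ι QT (AffGen.θ i)) = thetaBar i := fun i => by
    simp [freeRho]
  cases h with
  | hecke h =>
    have : (freeRho n).comp (freeHA n) = Hecke.mk n := by
      ext i
      simp [freeHA, freeRho, Hecke.T]
    have h2 := Hecke.mk_rel h
    rw [← this] at h2
    exact h2
  | theta_comm i j => simp only [map_mul, hθ]; exact commute_thetaBar i j
  | theta_succ i => simp only [map_mul, map_smul, map_heckeInv, hθ, hT]; exact thetaBar_succ i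
  | theta_far i j h1 h2 =>
    simp only [map_mul, hθ, hT]
    have h1' : j.1 ≠ i.1 := fun h => h1 (Fin.ext h)
    have h2' : j.1 ≠ i.1 + 1 := fun h => h2 (Fin.ext h)
    rcases Nat.lt_or_ge j.1 i.1 with h | h
    · exact (Hecke.commute_thetaBarNat_of_lt i j.1 h).eq
    · exact (Hecke.commute_thetaBarNat_of_gt i j.1 (by omega)).eq

/-- The algebra homomorphism `ρ_n : A_n → H_n` with `T_i ↦ T_i` and `θ_i ↦ θ̄_i`. -/
def rho (n : ℕ) : Aff n →ₐ[QT] Hecke n :=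
  RingQuot.liftAlgHom QT ⟨freeRho n, fun _ _ h => freeRho_rel h⟩

/-! ## The idempotent `ε` -/

/-- The permutation `s_{i_1} ⋯ s_{i_r}` of a word `i_1, …, i_r`. -/
def wordPerm {n : ℕ} (l : List (Fin (n - 1))) : Equiv.Perm (Fin n) := (l.map adjSwap).prod

theorem exists_word {n : ℕ} (σ : Equiv.Perm (Fin n)) : ∃ l, wordPerm l = σ := by
  match n, σ with
  | 0, σ => exact ⟨[], Subsingleton.elim _ _⟩
  | m + 1, σ =>
    have h : σ ∈ Submonoid.closure
        (Set.range fun i : Fin m => Equiv.swap i.castSucc i.succ) := by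
      rw [Equiv.Perm.mclosure_swap_castSucc_succ]; trivial
    induction h using Submonoid.closure_induction with
    | mem x hx =>
      obtain ⟨i, rfl⟩ := hx
      exact ⟨[i], by simp [wordPerm, adjSwap]; rfl⟩
    | one => exact ⟨[], rfl⟩
    | mul x y _ _ hx hy =>
      obtain ⟨l, rfl⟩ := hx
      obtain ⟨l', rfl⟩ := hy
      exact ⟨l ++ l', by simp [wordPerm]⟩

theorem exists_word_length {n : ℕ} (σ : Equiv.Perm (Fin n)) :
    ∃ r, ∃ l, wordPerm l = σ ∧ l.length = r := by
  obtain ⟨l, hl⟩ := exists_word σ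
  exact ⟨_, l, hl, rfl⟩

open Classical in
/-- The length `ℓ(σ)`: the smallest length of a word for `σ` in the `s_i`. -/
def permLength {n : ℕ} (σ : Equiv.Perm (Fin n)) : ℕ := Nat.find (exists_word_length σ)

open Classical in
/-- A reduced word exists for every permutation. -/
theorem exists_reduced {n : ℕ} (σ : Equiv.Perm (Fin n)) :
    ∃ l, wordPerm l = σ ∧ l.length = permLength σ := Nat.find_spec (exists_word_length σ)

/-- `T_σ = T_{i_1} ⋯ T_{i_r}` for a reduced expression `σ = s_{i_1} ⋯ s_{i_r}`.  By Matsumoto's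
theorem it does not matter which reduced expression is chosen. -/
def Hecke.Tperm {n : ℕ} (σ : Equiv.Perm (Fin n)) : Hecke n :=
  ((exists_reduced σ).choose.map Hecke.T).prod

/-- `[n]_t! = ∏_{i=1}^n (1 - t^i)/(1 - t)`. -/
def tFactorial (n : ℕ) : QT := ∏ i ∈ Finset.Icc 1 n, (1 - t ^ i) / (1 - t)

/-- The trivial idempotent `ε = (1/[n]_t!) ∑_σ t^{n(n-1)/2 - ℓ(σ)} T_σ` of `H_n`. -/
def epsilon (n : ℕ) : Hecke n :=
  (tFactorial n)⁻¹ •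
    ∑ σ : Equiv.Perm (Fin n), t ^ ((n.choose 2 : ℤ) - (permLength σ : ℤ)) • Hecke.Tperm σ

/-! ## The modules `λ` and `V_λ` -/

/-- The vectors that are set to zero in the `H_n`-module `λ` generated by the standard Young
tableaux; `Finsupp.single τ h` stands for `h(τ)`. -/
inductive SpechtRel (μ : YoungDiagram) : (SYT μ →₀ Hecke μ.card) → Prop
  | theta (i : Fin μ.card) (τ : SYT μ) :
      SpechtRel μ (Finsupp.single τ (thetaBar i) - t ^ τ.1.c i • Finsupp.single τ 1)
  | phi (i : Fin (μ.card - 1)) (τ τ' : SYT μ) : PSYT.IsSwap i τ.1 τ'.1 → PSYT.lt τ.1 τ'.1 →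
      SpechtRel μ (Finsupp.single τ (phiBar i) -
        (t ^ τ.1.c (lo i) - t ^ τ.1.c (hi i)) • Finsupp.single τ' 1)
  | row (i : Fin (μ.card - 1)) (τ : SYT μ) : (τ.1.box (lo i)).1.1 = (τ.1.box (hi i)).1.1 →
      SpechtRel μ (Finsupp.single τ (Hecke.T i) - Finsupp.single τ 1)
  | col (i : Fin (μ.card - 1)) (τ : SYT μ) : (τ.1.box (lo i)).1.2 = (τ.1.box (hi i)).1.2 →
      SpechtRel μ (Finsupp.single τ (Hecke.T i) - (-t) • Finsupp.single τ 1)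

/-- The `H_n`-module `λ`: spanned by the standard Young tableaux subject to the above relations. -/
def Specht (μ : YoungDiagram) : Type :=
  (SYT μ →₀ Hecke μ.card) ⧸ Submodule.span (Hecke μ.card) {r | SpechtRel μ r}

instance (μ : YoungDiagram) : AddCommGroup (Specht μ) :=
  inferInstanceAs (AddCommGroup (_ ⧸ Submodule.span (Hecke μ.card) {r | SpechtRel μ r}))
instance (μ : YoungDiagram) : Module (Hecke μ.card) (Specht μ) :=
  inferInstanceAs (Module _ (_ ⧸ Submodule.span (Hecke μ.card) {r | SpechtRel μ r}))
instance (μ : YoungDiagram) : Module QT (Specht μ) :=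
  inferInstanceAs (Module QT (_ ⧸ Submodule.span (Hecke μ.card) {r | SpechtRel μ r}))
instance (μ : YoungDiagram) : IsScalarTower QT (Hecke μ.card) (Specht μ) :=
  inferInstanceAs
    (IsScalarTower QT _ (_ ⧸ Submodule.span (Hecke μ.card) {r | SpechtRel μ r}))

/-- The vector `τ` of the module `λ`. -/
def Specht.vec (τ : SYT μ) : Specht μ := Submodule.Quotient.mk (Finsupp.single τ 1)

/-- The `A_n`-module `ρ_n^*(λ)`. -/
def RhoSpecht (μ : YoungDiagram) : Type := Specht μ

instance (μ : YoungDiagram) : AddCommGroup (RhoSpecht μ) :=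
  inferInstanceAs (AddCommGroup (Specht μ))
instance (μ : YoungDiagram) : Module QT (RhoSpecht μ) := inferInstanceAs (Module QT (Specht μ))
instance (μ : YoungDiagram) : Module (Aff μ.card) (RhoSpecht μ) :=
  Module.compHom (Specht μ) (rho μ.card).toRingHom
instance (μ : YoungDiagram) : IsScalarTower QT (Aff μ.card) (RhoSpecht μ) where
  smul_assoc c a m :=
    (congrArg (fun h : Hecke μ.card => (h • (id m : Specht μ) : Specht μ))
      (map_smul (rho μ.card) c a)).trans (smul_assoc c (rho μ.card a) (id m : Specht μ))

section Induction

variable {K A D : Type} [CommRing K] [Ring A] [Algebra K A] [Ring D] [Algebra K D]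
  (f : A →ₐ[K] D) (M : Type) [AddCommGroup M] [Module K M] [Module A M]

/-- The relations `d f(a) ⊗ m = d ⊗ a m`, as a `D`-submodule of `D ⊗_K M`. -/
def indRel : Submodule D (D ⊗[K] M) :=
  Submodule.span D {r | ∃ (d : D) (a : A) (m : M), r = (d * f a) ⊗ₜ[K] m - d ⊗ₜ[K] (a • m)}

/-- The induced module `Ind_A^D M = D ⊗_A M` along a homomorphism `f : A → D` of `K`-algebras. -/
def Ind : Type := (D ⊗[K] M) ⧸ indRel f M

instance : AddCommGroup (Ind f M) := inferInstanceAs (AddCommGroup ((D ⊗[K] M) ⧸ indRel f M))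
instance : Module D (Ind f M) := inferInstanceAs (Module D ((D ⊗[K] M) ⧸ indRel f M))
instance : Module K (Ind f M) := inferInstanceAs (Module K ((D ⊗[K] M) ⧸ indRel f M))
instance : IsScalarTower K D (Ind f M) :=
  inferInstanceAs (IsScalarTower K D ((D ⊗[K] M) ⧸ indRel f M))

/-- The element `1 ⊗ m` of the induced module. -/
def Ind.one_tmul (m : M) : Ind f M := Submodule.Quotient.mk ((1 : D) ⊗ₜ[K] m)

end Induction

/-- The `D_n`-module `V_λ`, induced from `ρ_n^*(λ)`. -/
abbrev V (μ : YoungDiagram) : Type := Ind (affToDaha μ.card) (RhoSpecht μ)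

/-- The element `1 ⊗ τ` of `V_λ`. -/
def V.vec (τ : SYT μ) : V μ := Ind.one_tmul (affToDaha μ.card) (RhoSpecht μ) (Specht.vec τ)

/-- The action of `π_n⁻¹` on `V_λ`: the inverse of the linear operator `π_n`. -/
def piInv (μ : YoungDiagram) (h : 0 < μ.card) : Module.End QT (V μ) :=
  Ring.inverse (Algebra.lsmul QT QT (V μ) (Daha.pi h))

/-! ## Macdonald polynomials -/

/-- The largest `i ∈ {1, …, n}` with `w_τ(i) > 0`, and `0` if there is none. -/
def PSYT.lastPos (τ : PSYT μ) : ℕ :=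
  (Finset.univ.filter fun i => 0 < τ.w i).sup fun i : Fin μ.card => i.1 + 1

theorem PSYT.lastPos_le (τ : PSYT μ) : τ.lastPos ≤ μ.card :=
  Finset.sup_le fun i _ => i.2

theorem PSYT.w_eq_zero (τ : PSYT μ) (i : Fin μ.card) (h : τ.lastPos ≤ i.1) : τ.w i = 0 := by
  by_contra hw
  have : i.1 + 1 ≤ τ.lastPos :=
    Finset.le_sup (f := fun i : Fin μ.card => i.1 + 1) (by simpa using Nat.pos_of_ne_zero hw)
  omega

theorem PSYT.le_lastPos (τ : PSYT μ) (i : Fin μ.card) (h : 0 < τ.w i) : i.1 + 1 ≤ τ.lastPos := by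
  by_contra hc
  have := τ.w_eq_zero i (by omega)
  omega

theorem PSYT.w_pos (τ : PSYT μ) (i : Fin μ.card) (h : i.1 + 1 = τ.lastPos) : 0 < τ.w i := by
  by_contra hw
  have hlt : τ.lastPos < i.1 + 1 := by
    refine (Finset.sup_lt_iff (by simp)).2 fun j hj => ?_
    have h1 := τ.le_lastPos j (by simpa using hj)
    have h2 : j ≠ i := by
      rintro rfl
      exact hw (by simpa using hj)
    have h3 : j.1 ≠ i.1 := fun h => h2 (Fin.ext h)
    omega
  omega

theorem PSYT.label_snd_eq_zero (τ : PSYT μ) (h : τ.lastPos = 0) (x : Box μ) :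
    (τ.label x).2 = 0 := by
  have h1 := τ.w_eq_zero (τ.label x).1 (by omega)
  unfold PSYT.w at h1
  rwa [PSYT.box_label] at h1

/-- The sum of the exponents. -/
def PSYT.degree (τ : PSYT μ) : ℕ := ∑ x, (τ.label x).2

theorem PSYT.degree_PsiInv (τ : PSYT μ) (h : ∀ i : Fin μ.card, i.1 + 1 = μ.card → 0 < τ.w i)
    (h0 : 0 < μ.card) : (τ.PsiInv h).degree < τ.degree := by
  have hle : ∀ x, ((τ.PsiInv h).label x).2 ≤ (τ.label x).2 := by
    intro x
    change (unrotate (τ.label x)).2 ≤ _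
    unfold unrotate
    split_ifs <;> simp
  refine Finset.sum_lt_sum (fun x _ => hle x) ?_
  have hl : (μ.card - 1) + 1 = μ.card := by omega
  have hp := h ⟨μ.card - 1, by omega⟩ hl
  refine ⟨τ.box ⟨μ.card - 1, by omega⟩, Finset.mem_univ _, ?_⟩
  change (unrotate (τ.label _)).2 < _
  unfold PSYT.w at hp
  unfold unrotate
  have hb := τ.label_box ⟨μ.card - 1, by omega⟩
  rw [dif_neg (by rw [hb]; simp only; omega)]
  simp only
  omega

theorem PSYT.w_swapOfNe (τ : PSYT μ) (i : Fin (μ.card - 1)) (h : τ.w (lo i) ≠ τ.w (hi i))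
    (j : Fin μ.card) : (τ.swapOfNe i h).w j = τ.w (adjSwap i j) := by
  have hb : (τ.swapOfNe i h).box j = τ.box (adjSwap i j) := by
    have h1 := (τ.swapOfNe i h).box_label (τ.box (adjSwap i j))
    rw [τ.isSwap_swapOfNe i h, τ.label_box] at h1
    rw [← h1]
    simp [adjSwap]
  unfold PSYT.w
  rw [hb, τ.isSwap_swapOfNe i h]

theorem PSYT.degree_swapOfNe (τ : PSYT μ) (i : Fin (μ.card - 1))
    (h : τ.w (lo i) ≠ τ.w (hi i)) : (τ.swapOfNe i h).degree = τ.degree := rfl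

theorem PSYT.exists_last {n k : ℕ} (h0 : k ≠ 0) (hn : k ≠ n) (hk : k ≤ n) : k - 1 < n - 1 := by
  omega

theorem PSYT.w_ne (τ : PSYT μ) (i : Fin (μ.card - 1)) (h : i.1 + 1 = τ.lastPos) :
    τ.w (lo i) ≠ τ.w (hi i) := by
  have h1 := τ.w_pos (lo i) h
  have h2 := τ.w_eq_zero (hi i) (le_of_eq h.symm)
  omega

/-- The nonsymmetric vector-valued Macdonald polynomials `F_τ ∈ V_λ`.  They are determined by
* `F_τ = 1 ⊗ τ` for standard Young tableaux `τ`;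
* `F_{Ψ(σ)} = q^{w_σ(1)} X_n π_n⁻¹ F_σ`;
* `F_{s_i(σ)} = (t T_i⁻¹ + (t - 1) b / (a - b)) F_σ` if `s_i(σ) > σ`, where `a` and `b` are the
  weights `q^{w_σ(j)} t^{c_σ(j)}` for `j = i` and `j = i + 1`.
The recursion applies the second rule if `w_τ(n) > 0`, and otherwise the third one to the largest
`i` with `w_τ(i) > 0`, where `σ = s_i(τ)` has `w_σ(i) = 0 < w_σ(i + 1)`. -/
def nonsymF (τ : PSYT μ) : V μ :=
  if h0 : τ.lastPos = 0 then V.vec ⟨τ, τ.label_snd_eq_zero h0⟩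
  else if hn : τ.lastPos = μ.card then
    have hpos : 0 < μ.card := by omega
    let σ : PSYT μ := τ.PsiInv fun i hi => τ.w_pos i (hi.trans hn.symm)
    q ^ σ.w ⟨0, hpos⟩ •
      ((Daha.X ⟨μ.card - 1, by omega⟩ : Daha μ.card) • piInv μ hpos (nonsymF σ))
  else
    let i : Fin (μ.card - 1) := ⟨τ.lastPos - 1, PSYT.exists_last h0 hn τ.lastPos_le⟩
    let σ : PSYT μ := τ.swapOfNe i (τ.w_ne i (by simp only [i]; omega))
    (t • heckeInv (Daha.T i : Daha μ.card)) • nonsymF σ +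
      ((t - 1) * σ.weight (hi i) / (σ.weight (lo i) - σ.weight (hi i))) • nonsymF σ
termination_by (τ.degree, μ.card - τ.lastPos)
decreasing_by
  · exact Prod.Lex.left _ _ (τ.degree_PsiInv _ (by omega))
  all_goals
    refine Prod.Lex.right _ ?_
    have hle := τ.lastPos_le
    have h1 : 0 < (τ.swapOfNe i (τ.w_ne i (by simp only [i]; omega))).w (hi i) := by
      rw [PSYT.w_swapOfNe, adjSwap, Equiv.swap_apply_right]
      exact τ.w_pos _ (by simp only [lo, i]; omega)
    have h2 := PSYT.le_lastPos _ _ h1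
    simp only [hi, i] at h2
    omega

/-- The subspace `U_T` of `V_λ` spanned by the `F_τ` with `𝔭(τ) = T`. -/
def U (T : RYT μ) : Submodule QT (V μ) :=
  Submodule.span QT (Set.range fun τ : PSYTOver T => nonsymF τ.1)

/-- The image `ε(U_T)` of `U_T` under the idempotent `ε`. -/
def epsU (T : RYT μ) : Submodule QT (V μ) :=
  (U T).map (Algebra.lsmul QT QT (V μ)
    (affToDaha μ.card (heckeToAff μ.card (epsilon μ.card))))

/-- The condition defining the symmetric vector-valued Macdonald polynomial `P_T`: it lies in
`ε(U_T)` and has the form `F_{Top(T)} + ∑_{y ≠ Top(T)} κ_y F_y`, `y ∈ PSYT(λ;T)`. -/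
def IsSymMacdonald (T : RYT μ) (P : V μ) : Prop :=
  P ∈ epsU T ∧ ∃ top : PSYTOver T, IsTop top ∧ ∃ κ : PSYTOver T → QT,
    P = nonsymF top.1 + ∑ y ∈ Finset.univ.erase top, κ y • nonsymF y.1

end VVMac
end

noncomputable section
namespace VVMac

/-! ## Words in the symmetric group -/

/-! The coefficients are forced by invariance under the Hecke algebra. Let σ = s_i(τ) > τ, and let
a, b be the weights q^w t^c of i, i+1 in τ. Then F_σ = φ F_τ with φ = tT_i⁻¹ + (t-1)b/(a-b). The
factor attached to the inversion (box of i+1, box of i) is (tb-a)/(b-a) = 1 - (t-1)b/(a-b). Hence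
factor · F_τ + F_σ = (tT_i⁻¹ + 1)F_τ = (T_i + t)F_τ, and T_i fixes this vector because (T_i - 1)(T_i
+ t) = 0 (`smul_add_intertwiner_smul`).

Such an exchange removes exactly one inversion (`symCoeff_eq`), so the products of factors fit all
these pairs at once. If i, i+1 cannot be exchanged, they are neighbours with equal exponents; strict
columns leave only neighbours in a row, where T_i F_τ = F_τ. So every T_i fixes the sum
(`T_smul_symSum`), ε acts on it by a nonzero scalar, and it lies in ε(U_T) (`symSum_mem`). The
tableau without inversions is Top(T) (`isTop_iff`); its coefficient is the empty product.

For uniqueness, ε F_σ = ((ta-b)/(a-b)) ε F_τ with a nonzero scalar, so ε(U_T) is spanned by ε F_Top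
(`epsU_le`). The F_τ are joint eigenvectors of the θ_j with distinct characters
(`weight_injective`), so the normalisation at F_Top picks out one element if F_Top ≠ 0; if F_Top = 0
then ε(U_T) = 0.

The main labour is the rule F_{s_i(τ)} = φ F_τ for every i, together with φ F_τ = 0 for row
neighbours, because F_τ is constructed along one particular path from a standard tableau.
`exchangeRule` obtains it by induction from the relations between paths: distant intertwiners
commute, adjacent ones satisfy Yang–Baxter, and Φ = X_n π_n⁻¹ satisfies Φ T_{i+1} = T_i Φ and Φ² T_1
= T_{n-1} Φ². This needs π_n to be invertible on V_λ (`V.isUnit_pi`), which follows from a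
filtration by finite-dimensional subspaces. The identity ε T_i = ε rests on Matsumoto's theorem. -/

theorem lo_ne_hi {n : ℕ} (i : Fin (n - 1)) : lo i ≠ hi i := by
  simp [lo, hi, Fin.ext_iff]

theorem lo_lt_hi {n : ℕ} (i : Fin (n - 1)) : lo i < hi i := by
  simp [lo, hi, Fin.lt_def]

theorem adjSwap_lo {n : ℕ} (i : Fin (n - 1)) : adjSwap i (lo i) = hi i := Equiv.swap_apply_left _ _

theorem adjSwap_hi {n : ℕ} (i : Fin (n - 1)) : adjSwap i (hi i) = lo i := Equiv.swap_apply_right _ _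

theorem adjSwap_of_ne {n : ℕ} (i : Fin (n - 1)) {j : Fin n} (h1 : j ≠ lo i) (h2 : j ≠ hi i) :
    adjSwap i j = j := Equiv.swap_apply_of_ne_of_ne h1 h2

theorem adjSwap_adjSwap {n : ℕ} (i : Fin (n - 1)) (j : Fin n) : adjSwap i (adjSwap i j) = j :=
  Equiv.swap_apply_self _ _ _

theorem adjSwap_mul_self {n : ℕ} (i : Fin (n - 1)) : adjSwap i * adjSwap i = 1 :=
  Equiv.swap_mul_self _ _

theorem adjSwap_val {n : ℕ} (i : Fin (n - 1)) (j : Fin n) : (adjSwap i j).1 =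
    if j.1 = i.1 then i.1 + 1 else if j.1 = i.1 + 1 then i.1 else j.1 := by
  simp only [adjSwap, Equiv.swap_apply_def, lo, hi, Fin.ext_iff]
  split_ifs <;> rfl

theorem adjSwap_comm {n : ℕ} (i j : Fin (n - 1)) (h : i.1 + 1 < j.1) :
    adjSwap i * adjSwap j = adjSwap j * adjSwap i := by
  ext k
  simp only [Equiv.Perm.mul_apply, adjSwap_val]
  split_ifs <;> omega

theorem adjSwap_braid {n : ℕ} (i j : Fin (n - 1)) (h : i.1 + 1 = j.1) :
    adjSwap i * adjSwap j * adjSwap i = adjSwap j * adjSwap i * adjSwap j := by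
  have e : hi i = lo j := Fin.ext h
  have n1 : lo i ≠ hi j := by simp only [lo, hi, ne_eq, Fin.ext_iff]; omega
  have n2 : hi j ≠ hi i := by rw [e]; exact (lo_ne_hi j).symm
  unfold adjSwap
  rw [← e]
  rw [Equiv.swap_mul_swap_mul_swap (lo_ne_hi i) n1, Equiv.swap_comm (lo i) (hi i),
    Equiv.swap_comm (hi i) (hi j), Equiv.swap_mul_swap_mul_swap n2 n1.symm, Equiv.swap_comm]

theorem mul_adjSwap_mul_adjSwap {n : ℕ} (p : Equiv.Perm (Fin n)) (i : Fin (n - 1)) :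
    p * adjSwap i * adjSwap i = p := by
  rw [mul_assoc, adjSwap_mul_self, mul_one]

theorem adjSwap_lt_adjSwap {n : ℕ} (i : Fin (n - 1)) {a b : Fin n} (h : a < b)
    (hne : ¬ (a = lo i ∧ b = hi i)) : adjSwap i a < adjSwap i b := by
  simp only [Fin.lt_def, adjSwap_val, lo, hi, Fin.ext_iff] at *
  split_ifs <;> omega

/-- The inversions of a permutation. -/
def invSet {n : ℕ} (p : Equiv.Perm (Fin n)) : Finset (Fin n × Fin n) :=
  Finset.univ.filter fun x => x.1 < x.2 ∧ p x.2 < p x.1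

theorem mem_invSet {n : ℕ} {p : Equiv.Perm (Fin n)} {x : Fin n × Fin n} :
    x ∈ invSet p ↔ x.1 < x.2 ∧ p x.2 < p x.1 := by simp [invSet]

/-- Applying s_i to both entries of a pair preserves their order unless the pair is (i, i+1). This
matches the inversions of p s_i other than (i, i+1) with the inversions of p. -/
theorem card_invSet_mul_adjSwap {n : ℕ} (p : Equiv.Perm (Fin n)) (i : Fin (n - 1))
    (h : p (lo i) < p (hi i)) : (invSet (p * adjSwap i)).card = (invSet p).card + 1 := by
  have hm : (lo i, hi i) ∈ invSet (p * adjSwap i) := by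
    simp [mem_invSet, lo_lt_hi, adjSwap_lo, adjSwap_hi, h]
  rw [← Finset.card_erase_add_one hm]
  congr 1
  refine Finset.card_bij' (fun x _ => (adjSwap i x.1, adjSwap i x.2))
    (fun x _ => (adjSwap i x.1, adjSwap i x.2)) ?_ ?_ ?_ ?_
  · rintro ⟨a, b⟩ hx
    simp only [Finset.mem_erase, mem_invSet, Equiv.Perm.mul_apply, ne_eq, Prod.mk.injEq] at hx ⊢
    exact ⟨adjSwap_lt_adjSwap i hx.2.1 hx.1, hx.2.2⟩
  · rintro ⟨a, b⟩ hx
    simp only [Finset.mem_erase, mem_invSet, Equiv.Perm.mul_apply, ne_eq, Prod.mk.injEq,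
      adjSwap_adjSwap] at hx ⊢
    have h1 : ¬ (a = lo i ∧ b = hi i) := by
      rintro ⟨rfl, rfl⟩
      exact absurd h hx.2.not_gt
    refine ⟨?_, adjSwap_lt_adjSwap i hx.1 h1, hx.2⟩
    rintro ⟨h2, h3⟩
    have h4 : a = hi i := by rw [← adjSwap_adjSwap i a, h2, adjSwap_lo]
    have h5 : b = lo i := by rw [← adjSwap_adjSwap i b, h3, adjSwap_hi]
    rw [h4, h5] at hx
    exact absurd hx.1 (lo_lt_hi i).not_gt
  · rintro ⟨a, b⟩ _; simp [adjSwap_adjSwap]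
  · rintro ⟨a, b⟩ _; simp [adjSwap_adjSwap]

theorem card_invSet_mul_adjSwap_of_gt {n : ℕ} (p : Equiv.Perm (Fin n)) (i : Fin (n - 1))
    (h : p (hi i) < p (lo i)) : (invSet (p * adjSwap i)).card + 1 = (invSet p).card := by
  have := card_invSet_mul_adjSwap (p * adjSwap i) i
    (by simpa [adjSwap_lo, adjSwap_hi] using h)
  rwa [mul_assoc, adjSwap_mul_self, mul_one, eq_comm] at this

theorem apply_lo_lt_or_gt {n : ℕ} (p : Equiv.Perm (Fin n)) (i : Fin (n - 1)) :
    p (lo i) < p (hi i) ∨ p (hi i) < p (lo i) :=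
  lt_or_gt_of_ne fun h => lo_ne_hi i (p.injective h)

theorem wordPerm_concat {n : ℕ} (l : List (Fin (n - 1))) (i : Fin (n - 1)) :
    wordPerm (l ++ [i]) = wordPerm l * adjSwap i := by simp [wordPerm]

theorem card_invSet_wordPerm_le {n : ℕ} (l : List (Fin (n - 1))) :
    (invSet (wordPerm l)).card ≤ l.length := by
  induction l using List.reverseRecOn with
  | nil =>
    have : invSet (wordPerm ([] : List (Fin (n - 1)))) = ∅ := by
      ext x
      simpa [mem_invSet, wordPerm] using fun h => h.le
    simp [this]
  | append_singleton l i ih =>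
    rw [wordPerm_concat, List.length_append, List.length_singleton]
    rcases apply_lo_lt_or_gt (wordPerm l) i with h | h
    · rw [card_invSet_mul_adjSwap _ _ h]; omega
    · have := card_invSet_mul_adjSwap_of_gt _ _ h; omega

theorem eq_one_of_forall_lt {n : ℕ} (p : Equiv.Perm (Fin n))
    (h : ∀ i : Fin (n - 1), p (lo i) < p (hi i)) : p = 1 := by
  have key : ∀ d : ℕ, ∀ a b : Fin n, a.1 + d + 1 = b.1 → p a < p b := by
    intro d
    induction d with
    | zero =>
      intro a b hab
      have := h ⟨a.1, by omega⟩
      have e1 : lo (⟨a.1, by omega⟩ : Fin (n - 1)) = a := rfl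
      have e2 : hi (⟨a.1, by omega⟩ : Fin (n - 1)) = b := Fin.ext (by simp [hi]; omega)
      rwa [e1, e2] at this
    | succ d ih =>
      intro a b hab
      have h1 := ih a ⟨a.1 + d + 1, by omega⟩ rfl
      have := h ⟨a.1 + d + 1, by omega⟩
      have e2 : hi (⟨a.1 + d + 1, by omega⟩ : Fin (n - 1)) = b := Fin.ext (by simp [hi]; omega)
      rw [e2] at this
      exact h1.trans this
  have hmono : StrictMono p := fun a b hab => key (b.1 - a.1 - 1) a b (by
    have := Fin.lt_def.1 hab; omega)
  -- A finite chain has only one order automorphism.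
  have : (hmono.orderIsoOfSurjective p p.surjective) = OrderIso.refl _ := Subsingleton.elim _ _
  ext a
  exact congrArg Fin.val (congrArg (fun e : Fin n ≃o Fin n => e a) this)

theorem exists_word_card_invSet {n : ℕ} (p : Equiv.Perm (Fin n)) :
    ∃ l, wordPerm l = p ∧ l.length = (invSet p).card := by
  induction hN : (invSet p).card generalizing p with
  | zero =>
    refine ⟨[], ?_, rfl⟩
    have := eq_one_of_forall_lt p fun i => by
      rcases apply_lo_lt_or_gt p i with h | h
      · exact h
      · have := card_invSet_mul_adjSwap_of_gt _ _ h; omega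
    rw [this]; rfl
  | succ N ih =>
    by_cases hp : ∃ i, p (hi i) < p (lo i)
    · obtain ⟨i, hi⟩ := hp
      have := card_invSet_mul_adjSwap_of_gt _ _ hi
      obtain ⟨l, hl, hlen⟩ := ih (p * adjSwap i) (by omega)
      exact ⟨l ++ [i], by rw [wordPerm_concat, hl, mul_assoc, adjSwap_mul_self, mul_one],
        by simp [hlen]⟩
    · have := eq_one_of_forall_lt p fun i => (apply_lo_lt_or_gt p i).resolve_right
        fun h => hp ⟨i, h⟩
      subst this
      have h0 := card_invSet_wordPerm_le ([] : List (Fin (n - 1)))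
      simp only [wordPerm, List.map_nil, List.prod_nil, List.length_nil] at h0
      omega

/-- One s_i changes the inversion number by one, which bounds word lengths from below; stripping
descents one at a time attains the bound. -/
theorem permLength_eq {n : ℕ} (p : Equiv.Perm (Fin n)) : permLength p = (invSet p).card := by
  classical
  apply le_antisymm
  · exact Nat.find_min' _ (exists_word_card_invSet p)
  · obtain ⟨l, hl, hlen⟩ := exists_reduced p
    rw [← hlen, ← hl]
    exact card_invSet_wordPerm_le l

/-- The product `T_{i_1} ⋯ T_{i_r}` of a word. -/
def Hecke.word {n : ℕ} (l : List (Fin (n - 1))) : Hecke n := (l.map Hecke.T).prod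

theorem Hecke.word_concat {n : ℕ} (l : List (Fin (n - 1))) (i : Fin (n - 1)) :
    Hecke.word (l ++ [i]) = Hecke.word l * Hecke.T i := by simp [Hecke.word]

/-- Two permutation words ending in different letters have a common reduced word after a
braid move. -/
theorem Hecke.exists_words_of_descents {n : ℕ} (p : Equiv.Perm (Fin n)) (i j : Fin (n - 1))
    (hij : i < j) (hi' : p (hi i) < p (lo i)) (hj' : p (hi j) < p (lo j)) :
    ∃ l l' : List (Fin (n - 1)), wordPerm (l ++ [i]) = p ∧ wordPerm (l' ++ [j]) = p ∧
      l.length + 1 = (invSet p).card ∧ l'.length + 1 = (invSet p).card ∧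
      Hecke.word (l ++ [i]) = Hecke.word (l' ++ [j]) := by
  have c1 := card_invSet_mul_adjSwap_of_gt _ _ hi'
  have c2 := card_invSet_mul_adjSwap_of_gt _ _ hj'
  rcases Nat.lt_or_ge (i.1 + 1) j.1 with h | h
  -- Distant descents: append s_i and s_j in either order to one reduced word for p s_i s_j.
  · have c3 := card_invSet_mul_adjSwap_of_gt (p * adjSwap i) j (by
      rw [Equiv.Perm.mul_apply, Equiv.Perm.mul_apply, adjSwap_of_ne, adjSwap_of_ne]
      · exact hj'
      all_goals simp only [lo, hi, ne_eq, Fin.ext_iff]; omega)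
    obtain ⟨m, hm, hlen⟩ := exists_word_card_invSet (p * adjSwap i * adjSwap j)
    refine ⟨m ++ [j], m ++ [i], ?_, ?_, ?_, ?_, ?_⟩
    · simp only [wordPerm_concat, hm, mul_adjSwap_mul_adjSwap]
    · rw [wordPerm_concat, wordPerm_concat, hm, mul_assoc p, adjSwap_comm i j h, ← mul_assoc,
        mul_adjSwap_mul_adjSwap, mul_adjSwap_mul_adjSwap]
    · simp; omega
    · simp; omega
    · simp only [Hecke.word_concat, mul_assoc]
      rw [(Hecke.comm i j h).eq]
  -- Adjacent descents: s_i s_j s_i can be stripped from the end of p by three successive descents,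
  -- and the two words are the two sides of the braid relation after a common prefix.
  · have hj : i.1 + 1 = j.1 := by have := Fin.lt_def.1 hij; omega
    have e : hi i = lo j := Fin.ext (by simp [lo, hi, hj])
    have n1 : lo i ≠ hi j := by simp only [lo, hi, ne_eq, Fin.ext_iff]; omega
    have c3 := card_invSet_mul_adjSwap_of_gt (p * adjSwap i) j (by
      rw [Equiv.Perm.mul_apply, Equiv.Perm.mul_apply, ← e, adjSwap_hi, adjSwap_of_ne i n1.symm
        (by rw [e]; exact (lo_ne_hi j).symm)]
      exact hj'.trans (by rwa [← e]))
    have c4 := card_invSet_mul_adjSwap_of_gt (p * adjSwap i * adjSwap j) i (by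
      simp only [Equiv.Perm.mul_apply]
      rw [adjSwap_of_ne j (by rw [← e]; exact lo_ne_hi i) n1, adjSwap_lo, e, adjSwap_lo,
        adjSwap_of_ne i n1.symm (by rw [e]; exact (lo_ne_hi j).symm)]
      exact hj')
    obtain ⟨m, hm, hlen⟩ := exists_word_card_invSet (p * adjSwap i * adjSwap j * adjSwap i)
    have b1 : p * adjSwap i * adjSwap j * adjSwap i = p * adjSwap j * adjSwap i * adjSwap j := by
      rw [mul_assoc, mul_assoc, ← mul_assoc (adjSwap i), adjSwap_braid i j hj]
      simp only [mul_assoc]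
    refine ⟨m ++ [i] ++ [j], m ++ [j] ++ [i], ?_, ?_, ?_, ?_, ?_⟩
    · simp only [wordPerm_concat, hm, mul_adjSwap_mul_adjSwap]
    · simp only [wordPerm_concat, hm, b1, mul_adjSwap_mul_adjSwap]
    · simp; omega
    · simp; omega
    · simp only [Hecke.word_concat]
      have := Hecke.braid i j hj
      simp only [mul_assoc] at this ⊢
      rw [this]

/-- Matsumoto's theorem: the product of the `T_i` over a reduced word depends only on the
permutation. -/
theorem Hecke.word_eq_of_reduced {n : ℕ} (l l' : List (Fin (n - 1)))
    (hp : wordPerm l = wordPerm l') (h : l.length = (invSet (wordPerm l)).card)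
    (h' : l'.length = (invSet (wordPerm l)).card) : Hecke.word l = Hecke.word l' := by
  induction hN : l.length generalizing l l' with
  | zero =>
    rw [List.length_eq_zero_iff.1 hN, List.length_eq_zero_iff.1 (h'.trans (h.symm.trans hN))]
  | succ N ih =>
    -- Induction on the length. Equal last letters cancel (`same`). Distinct last letters are both
    -- descents (`tail`), and `Hecke.exists_words_of_descents` inserts two words with these last
    -- letters that agree in the Hecke algebra.
    have tail : ∀ (m : List (Fin (n - 1))) (i : Fin (n - 1)),
        m.length + 1 = (invSet (wordPerm (m ++ [i]))).card →
        wordPerm (m ++ [i]) (hi i) < wordPerm (m ++ [i]) (lo i) ∧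
          m.length = (invSet (wordPerm m)).card := by
      intro m i hm
      have h1 := card_invSet_wordPerm_le m
      rw [wordPerm_concat] at hm ⊢
      rcases apply_lo_lt_or_gt (wordPerm m) i with hlt | hgt
      · have := card_invSet_mul_adjSwap _ _ hlt
        exact ⟨by simpa [adjSwap_lo, adjSwap_hi] using hlt, by omega⟩
      · have := card_invSet_mul_adjSwap_of_gt _ _ hgt
        omega
    have same : ∀ (m m' : List (Fin (n - 1))) (i : Fin (n - 1)), m.length = N →
        wordPerm (m ++ [i]) = wordPerm (m' ++ [i]) →
        m.length + 1 = (invSet (wordPerm (m ++ [i]))).card → m'.length = m.length →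
        Hecke.word (m ++ [i]) = Hecke.word (m' ++ [i]) := by
      intro m m' i hm hw hc hm'
      rw [Hecke.word_concat, Hecke.word_concat]
      have e : wordPerm m = wordPerm m' := by
        rw [wordPerm_concat, wordPerm_concat] at hw
        exact mul_right_cancel hw
      rw [ih m m' e (tail m i hc).2 (hm'.trans (tail m i hc).2) hm]
    rcases List.eq_nil_or_concat l with rfl | ⟨m, i, rfl⟩
    · simp at hN
    rcases List.eq_nil_or_concat l' with rfl | ⟨m', j, rfl⟩
    · exact absurd (h'.trans h.symm) (by simp)
    simp only [List.concat_eq_append, List.length_append, List.length_singleton] at *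
    have d1 := (tail m i h).1
    have d2 := (tail m' j (by rw [← hp]; exact h')).1
    rw [← hp] at d2
    rcases lt_trichotomy i j with hij | rfl | hij
    · obtain ⟨a, b, ha, hb, la, lb, hab⟩ := Hecke.exists_words_of_descents _ i j hij d1 d2
      rw [same m a i (by omega) ha.symm h (by omega), hab,
        same b m' j (by omega) (hb.trans hp) (by rw [hb]; exact lb) (by omega)]
    · exact same m m' i (by omega) hp h (by omega)
    · obtain ⟨a, b, ha, hb, la, lb, hab⟩ := Hecke.exists_words_of_descents _ j i hij d2 d1
      rw [same m b i (by omega) hb.symm h (by omega), ← hab,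
        same a m' j (by omega) (ha.trans hp) (by rw [ha]; exact la) (by omega)]

theorem Hecke.Tperm_wordPerm {n : ℕ} (l : List (Fin (n - 1)))
    (h : l.length = (invSet (wordPerm l)).card) : Hecke.Tperm (wordPerm l) = Hecke.word l := by
  have hs := (exists_reduced (wordPerm l)).choose_spec
  have hs2 := hs.2.trans (permLength_eq _)
  exact Hecke.word_eq_of_reduced _ _ hs.1 (by rw [hs.1, hs2]) (by rw [hs.1, h])

theorem Hecke.Tperm_mul_T {n : ℕ} (p : Equiv.Perm (Fin n)) (i : Fin (n - 1))
    (h : p (lo i) < p (hi i)) : Hecke.Tperm p * Hecke.T i = Hecke.Tperm (p * adjSwap i) := by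
  obtain ⟨l, rfl, hl⟩ := exists_word_card_invSet p
  rw [Hecke.Tperm_wordPerm l hl, ← wordPerm_concat, Hecke.Tperm_wordPerm, Hecke.word_concat]
  rw [wordPerm_concat, card_invSet_mul_adjSwap _ _ h, ← hl]
  simp

/-! ### The identity ε T_i = ε. -/

theorem mul_self_of_quadratic {K A : Type*} [Field K] [Ring A] [Algebra K A] {t : K} {x : A}
    (h : (x - 1) * (x + algebraMap K A t) = 0) : x * x = (1 - t) • x + t • (1 : A) := by
  rw [sub_mul, one_mul, mul_add, ← Algebra.commutes, ← Algebra.smul_def,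
    Algebra.algebraMap_eq_smul_one] at h
  rw [← sub_eq_zero, ← h]
  module

/-- The left side is u P (x + t)(x - 1). -/
theorem sum_pair_mul_of_quadratic {K A : Type*} [Field K] [Ring A] [Algebra K A] {t : K} {x : A}
    (h : (x - 1) * (x + algebraMap K A t) = 0) (u : K) (P : A) :
    (t * u) • P * x - (t * u) • P + (u • (P * x) * x - u • (P * x)) = 0 := by
  simp only [smul_mul_assoc]
  rw [mul_assoc, mul_self_of_quadratic h, mul_add, mul_smul_comm, mul_smul_comm, mul_one]
  module

theorem epsilon_mul_T {n : ℕ} (i : Fin (n - 1)) : epsilon n * Hecke.T i = epsilon n := by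
  rw [epsilon, smul_mul_assoc]
  congr 1
  rw [← sub_eq_zero, Finset.sum_mul, ← Finset.sum_sub_distrib]
  -- Pair p with p s_i. The shorter element carries an extra factor t, so the pair contributes a
  -- multiple of T_p (T_i + t)(T_i - 1) = 0.
  refine Finset.sum_involution (fun p _ => p * adjSwap i) ?_ ?_ (fun _ _ => Finset.mem_univ _) ?_
  · have key : ∀ p : Equiv.Perm (Fin n), p (lo i) < p (hi i) →
        t ^ ((n.choose 2 : ℤ) - permLength p) • Hecke.Tperm p * Hecke.T i -
          t ^ ((n.choose 2 : ℤ) - permLength p) • Hecke.Tperm p +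
        (t ^ ((n.choose 2 : ℤ) - permLength (p * adjSwap i)) • Hecke.Tperm (p * adjSwap i) *
            Hecke.T i -
          t ^ ((n.choose 2 : ℤ) - permLength (p * adjSwap i)) • Hecke.Tperm (p * adjSwap i)) =
          0 := by
      intro p hp
      rw [permLength_eq, permLength_eq, card_invSet_mul_adjSwap p i hp, ← Hecke.Tperm_mul_T p i hp]
      have : t ^ ((n.choose 2 : ℤ) - (invSet p).card) =
          t * t ^ ((n.choose 2 : ℤ) - ((invSet p).card + 1 : ℕ)) := by
        rw [← zpow_one_add₀ t_ne_zero]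
        congr 1
        push_cast
        ring
      rw [this]
      exact sum_pair_mul_of_quadratic (Hecke.quad i) _ _
    intro p _
    rcases apply_lo_lt_or_gt p i with h | h
    · exact key p h
    · have := key (p * adjSwap i) (by simpa [adjSwap_lo, adjSwap_hi] using h)
      rw [mul_assoc p, adjSwap_mul_self, mul_one, add_comm] at this
      exact this
  · intro p _ _ h
    have := mul_left_cancel (h.trans (mul_one p).symm)
    have h2 := congrArg (fun e => e (lo i)) this
    simp only [adjSwap_lo, Equiv.Perm.one_apply] at h2
    exact lo_ne_hi i h2.symm
  · intro p _
    rw [mul_assoc, adjSwap_mul_self, mul_one]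

end VVMac
end

noncomputable section
namespace VVMac

/-! ## Evaluations in the ground field -/

theorem algebraMap_ne_zero_of_eval {p : MvPolynomial (Fin 2) ℚ} (x : Fin 2 → ℚ)
    (h : MvPolynomial.eval x p ≠ 0) : algebraMap (MvPolynomial (Fin 2) ℚ) QT p ≠ 0 := by
  rw [Ne, FaithfulSMul.algebraMap_eq_zero_iff]
  rintro rfl
  simp at h

theorem q_ne_zero : q ≠ 0 := by
  unfold q
  rw [Ne, FaithfulSMul.algebraMap_eq_zero_iff]
  exact MvPolynomial.X_ne_zero 0

theorem tFactorial_ne_zero (n : ℕ) : tFactorial n ≠ 0 := by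
  have key : ∀ i : ℕ, 1 ≤ i → (1 - t ^ i : QT) ≠ 0 := by
    intro i hi
    -- Evaluation at q = t = 2.
    have := algebraMap_ne_zero_of_eval (p := 1 - MvPolynomial.X 1 ^ i) (fun _ => 2) (by
      simp only [map_sub, map_one, map_pow, MvPolynomial.eval_X]
      have : (1 : ℚ) < 2 ^ i := one_lt_pow₀ (by norm_num) (by omega)
      linarith)
    simpa [t] using this
  refine Finset.prod_ne_zero_iff.2 fun i hi => ?_
  refine div_ne_zero (key i (Finset.mem_Icc.1 hi).1) ?_
  simpa using key 1 le_rfl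

/-- Clearing denominators by a power of t leaves a polynomial whose value at t = 1 is the number of
terms. -/
theorem sum_zpow_t_ne_zero {ι : Type*} (s : Finset ι) (hs : s.Nonempty) (k : ι → ℤ) :
    ∑ i ∈ s, t ^ k i ≠ 0 := by
  obtain ⟨N, hN⟩ : ∃ N : ℕ, ∀ i ∈ s, 0 ≤ (N : ℤ) + k i := by
    refine ⟨∑ i ∈ s, (k i).natAbs, fun i hi => ?_⟩
    have := Finset.single_le_sum (f := fun i => (k i).natAbs) (fun _ _ => Nat.zero_le _) hi
    omega
  have h1 : t ^ (N : ℤ) * ∑ i ∈ s, t ^ k i = algebraMap (MvPolynomial (Fin 2) ℚ) QT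
      (∑ i ∈ s, MvPolynomial.X 1 ^ ((N : ℤ) + k i).toNat) := by
    rw [map_sum, Finset.mul_sum]
    refine Finset.sum_congr rfl fun i hi => ?_
    rw [← zpow_add₀ t_ne_zero, map_pow, ← zpow_natCast, Int.toNat_of_nonneg (hN i hi)]
    rfl
  intro h0
  rw [h0, mul_zero] at h1
  refine algebraMap_ne_zero_of_eval (fun _ => 1) ?_ h1.symm
  simp [hs.ne_empty]

/-- A power of t turns both sides into monomials of the polynomial ring. The separation of
eigenvalues and the nonvanishing of denominators rest on this. -/
theorem qt_monomial_injective {a a' : ℕ} {c c' : ℤ} (h : q ^ a * t ^ c = q ^ a' * t ^ c') :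
    a = a' ∧ c = c' := by
  obtain ⟨N, h1, h2⟩ : ∃ N : ℕ, 0 ≤ (N : ℤ) + c ∧ 0 ≤ (N : ℤ) + c' :=
    ⟨c.natAbs + c'.natAbs, by omega, by omega⟩
  have key : ∀ (a : ℕ) (c : ℤ), 0 ≤ (N : ℤ) + c → q ^ a * t ^ c * t ^ (N : ℤ) =
      algebraMap (MvPolynomial (Fin 2) ℚ) QT (MvPolynomial.monomial
        (Finsupp.single 0 a + Finsupp.single 1 ((N : ℤ) + c).toNat) 1) := by
    intro a c hc
    rw [mul_assoc, ← zpow_add₀ t_ne_zero, add_comm c, ← mul_one (1 : ℚ),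
      ← MvPolynomial.monomial_mul, map_mul, ← MvPolynomial.X_pow_eq_monomial,
      ← MvPolynomial.X_pow_eq_monomial, map_pow, map_pow]
    rw [← Int.toNat_of_nonneg hc, zpow_natCast]
    rfl
  have e := key a c h1
  rw [h, key a' c' h2] at e
  have e2 := MvPolynomial.monomial_left_injective one_ne_zero
    (IsFractionRing.injective (MvPolynomial (Fin 2) ℚ) QT e)
  have e3 := DFunLike.congr_fun e2 0
  have e4 := DFunLike.congr_fun e2 1
  simp at e3 e4
  exact ⟨e3.symm, by omega⟩

/-! ## Consequences of the relations of the double affine Hecke algebra -/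

section BraidProducts

variable {A : Type*} [Monoid A]

/-- `a_0 a_1 ⋯ a_{k-1}`. -/
def prefixProd (a : ℕ → A) (k : ℕ) : A := ((List.range k).map a).prod

theorem prefixProd_succ (a : ℕ → A) (k : ℕ) : prefixProd a (k + 1) = prefixProd a k * a k := by
  simp [prefixProd, List.range_succ]

theorem prefixProd_one (a : ℕ → A) : prefixProd a 1 = a 0 := by
  simp [prefixProd, List.range_succ]

theorem commute_prefixProd {x : A} {a : ℕ → A} {k : ℕ} (h : ∀ i < k, Commute x (a i)) :
    Commute x (prefixProd a k) := by
  induction k with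
  | zero => exact Commute.one_right _
  | succ k ih =>
    rw [prefixProd_succ]
    exact (ih fun i hi => h i (by omega)).mul_right (h k (by omega))

/-- The letter a_{i+1} commutes past a_0 ⋯ a_{i-1}, becomes a_i by the braid relation with a_i
a_{i+1}, and commutes with the remaining letters. -/
theorem mul_prefixProd {a : ℕ → A} {m : ℕ}
    (hb : ∀ i, i + 1 < m → a i * a (i + 1) * a i = a (i + 1) * a i * a (i + 1))
    (hc : ∀ i j, i + 1 < j → j < m → Commute (a i) (a j))
    (i k : ℕ) (hi : i + 1 < k) (hk : k ≤ m) :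
    a (i + 1) * prefixProd a k = prefixProd a k * a i := by
  induction k with
  | zero => omega
  | succ k ih =>
    rcases Nat.lt_or_ge (i + 1) k with h | h
    · rw [prefixProd_succ, ← mul_assoc, ih h (by omega), mul_assoc, mul_assoc,
        (hc i k h (by omega)).eq]
    · obtain rfl : k = i + 1 := by omega
      have h1 : Commute (a (i + 1)) (prefixProd a i) :=
        commute_prefixProd fun j hj => (hc j (i + 1) (by omega) (by omega)).symm
      rw [prefixProd_succ, prefixProd_succ, mul_assoc (prefixProd a i), ← mul_assoc, h1.eq,
        mul_assoc, ← mul_assoc (a (i + 1)), ← hb i (by omega)]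
      simp only [mul_assoc]

/-- The letters a_1, …, a_j of the first factor slide through the second, each with its index
lowered by one. This is the source of T_1 π² = π² T_{n-1}. -/
theorem prefixProd_mul_prefixProd {a : ℕ → A} {m : ℕ}
    (hb : ∀ i, i + 1 < m → a i * a (i + 1) * a i = a (i + 1) * a i * a (i + 1))
    (hc : ∀ i j, i + 1 < j → j < m → Commute (a i) (a j))
    (k j : ℕ) (hj : j + 1 ≤ k) (hk : k ≤ m) :
    prefixProd a (j + 1) * prefixProd a k = a 0 * prefixProd a k * prefixProd a j := by
  induction j with
  | zero => rw [prefixProd_one]; simp [prefixProd]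
  | succ j ih =>
    rw [prefixProd_succ a (j + 1), mul_assoc, mul_prefixProd hb hc j k (by omega) hk, ← mul_assoc,
      ih (by omega), mul_assoc, ← prefixProd_succ]

end BraidProducts

/-- Elements of a ring that satisfy the relations of the double affine Hecke algebra; `T'` are
the inverses of the elements `T`. -/
structure IsDahaFamily {K A : Type*} [Field K] [Ring A] [Algebra K A] {n : ℕ} (q t : K)
    (T T' : Fin (n - 1) → A) (θ X : Fin n → A) (p : A) : Prop where
  t_ne : t ≠ 0
  mul_inv : ∀ i, T i * T' i = 1
  inv_mul : ∀ i, T' i * T i = 1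
  smul_inv : ∀ i, t • T' i = T i + (t - 1) • (1 : A)
  braid : ∀ i j : Fin (n - 1), i.1 + 1 = j.1 → T i * T j * T i = T j * T i * T j
  comm : ∀ i j : Fin (n - 1), i.1 + 1 < j.1 → Commute (T i) (T j)
  theta_comm : ∀ i j, Commute (θ i) (θ j)
  theta_succ : ∀ i, θ (hi i) = t • (T' i * θ (lo i) * T' i)
  theta_far : ∀ i j, j ≠ lo i → j ≠ hi i → Commute (T i) (θ j)
  X_comm : ∀ i j, Commute (X i) (X j)
  X_succ : ∀ i, X (hi i) = t • (T' i * X (lo i) * T' i)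
  X_far : ∀ i j, j ≠ lo i → j ≠ hi i → Commute (T i) (X j)
  pi_eq : ∀ h : 0 < n, p = t ^ (n - 1) • (θ ⟨0, h⟩ * (List.ofFn T').prod)
  pi_X : ∀ i : Fin (n - 1), p * X (lo i) = X (hi i) * p
  pi_X_last : ∀ h : 0 < n, p * X ⟨n - 1, by omega⟩ = q • (X ⟨0, h⟩ * p)

namespace IsDahaFamily

variable {K A : Type*} [Field K] [Ring A] [Algebra K A] {n : ℕ} {q t : K}
    {T T' : Fin (n - 1) → A} {θ X : Fin n → A} {p : A}

theorem commute_inv (D : IsDahaFamily q t T T' θ X p) {i : Fin (n - 1)} {x : A}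
    (h : Commute (T i) x) : Commute (T' i) x := by
  change _ * _ = _ * _
  calc T' i * x = T' i * x * (T i * T' i) := by rw [D.mul_inv, mul_one]
    _ = T' i * (x * T i) * T' i := by simp only [mul_assoc]
    _ = (T' i * T i) * x * T' i := by rw [← h.eq]; simp only [mul_assoc]
    _ = x * T' i := by rw [D.inv_mul, one_mul]

theorem braid_inv (D : IsDahaFamily q t T T' θ X p) (i j : Fin (n - 1)) (h : i.1 + 1 = j.1) :
    T' i * T' j * T' i = T' j * T' i * T' j := by
  refine left_inv_eq_right_inv (a := T i * T j * T i) ?_ ?_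
  · rw [mul_assoc (T' i * T' j), mul_assoc (T i), ← mul_assoc (T' i) (T i), D.inv_mul, one_mul,
      mul_assoc, ← mul_assoc (T' j), D.inv_mul, one_mul, D.inv_mul]
  · rw [D.braid i j h, mul_assoc (T j * T i), mul_assoc (T' j), ← mul_assoc (T j) (T' j),
      D.mul_inv, one_mul, mul_assoc, ← mul_assoc (T i), D.mul_inv, one_mul, D.mul_inv]

/-- The inverses `T'`, indexed by all natural numbers. -/
def natInv (T' : Fin (n - 1) → A) (k : ℕ) : A := if h : k < n - 1 then T' ⟨k, h⟩ else 1

theorem natInv_val (T' : Fin (n - 1) → A) (i : Fin (n - 1)) : natInv T' i.1 = T' i := by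
  simp [natInv]

theorem prod_ofFn (T' : Fin (n - 1) → A) :
    (List.ofFn T').prod = prefixProd (natInv T') (n - 1) := by
  unfold prefixProd
  congr 1
  refine List.ext_getElem (by simp) fun k h1 h2 => ?_
  simp only [List.length_ofFn] at h1
  simp [natInv, h1]

theorem natInv_braid (D : IsDahaFamily q t T T' θ X p) (i : ℕ) (h : i + 1 < n - 1) :
    natInv T' i * natInv T' (i + 1) * natInv T' i =
      natInv T' (i + 1) * natInv T' i * natInv T' (i + 1) := by
  have h' : i < n - 1 := by omega
  simp only [natInv, h, h', dif_pos]
  exact D.braid_inv _ _ rfl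

theorem natInv_comm (D : IsDahaFamily q t T T' θ X p) (i j : ℕ) (h : i + 1 < j) (hj : j < n - 1) :
    Commute (natInv T' i) (natInv T' j) := by
  have h' : i < n - 1 := by omega
  simp only [natInv, hj, h', dif_pos]
  exact D.commute_inv (D.commute_inv (D.comm ⟨i, h'⟩ ⟨j, hj⟩ h).symm).symm

theorem T_mul_prod (D : IsDahaFamily q t T T' θ X p) (i j : Fin (n - 1)) (h : i.1 + 1 = j.1) :
    T j * (List.ofFn T').prod = (List.ofFn T').prod * T i := by
  have h1 := mul_prefixProd D.natInv_braid D.natInv_comm i.1 (n - 1) (by omega) le_rfl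
  rw [h, natInv_val, natInv_val, ← prod_ofFn] at h1
  calc T j * (List.ofFn T').prod = T j * ((List.ofFn T').prod * T' i) * T i := by
        rw [mul_assoc, mul_assoc, D.inv_mul, mul_one]
    _ = (T j * T' j) * (List.ofFn T').prod * T i := by rw [← h1]; simp only [mul_assoc]
    _ = _ := by rw [D.mul_inv, one_mul]

/-- Here T_j with j > 1 commutes with θ_1 and slides through T_1⁻¹ ⋯ T_{n-1}⁻¹ with its index
lowered by one. -/
theorem T_mul_pi (D : IsDahaFamily q t T T' θ X p) (i j : Fin (n - 1)) (h : i.1 + 1 = j.1) :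
    T j * p = p * T i := by
  have hn : 0 < n := by omega
  have h1 : Commute (T j) (θ ⟨0, hn⟩) := D.theta_far _ _
    (by simp only [lo, ne_eq, Fin.ext_iff]; omega) (by simp only [hi, ne_eq, Fin.ext_iff]; omega)
  rw [D.pi_eq hn, mul_smul_comm, smul_mul_assoc, ← mul_assoc, h1.eq, mul_assoc, D.T_mul_prod i j h,
    mul_assoc]

/-- Let U = T_1⁻¹ ⋯ T_{n-1}⁻¹, so that π² is a multiple of θ_1 U θ_1 U. Three facts combine: T_1 U²
= U² T_{n-1}; T_1 U = T_2⁻¹ ⋯ T_{n-1}⁻¹ commutes with θ_1; and T_1 commutes with θ_1 T_1⁻¹ θ_1,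
which is a form of θ_1 θ_2 = θ_2 θ_1. -/
theorem T_mul_pi_sq (D : IsDahaFamily q t T T' θ X p) (i j : Fin (n - 1)) (hi' : i.1 = 0)
    (hj : j.1 + 1 = n - 1) : T i * (p * p) = p * p * T j := by
  have hn : 0 < n := by omega
  have hlo : lo i = ⟨0, hn⟩ := Fin.ext hi'
  have eU : (List.ofFn T').prod = prefixProd (natInv T') (j.1 + 1) := by rw [prod_ofFn, hj]
  have h1 : T i * ((List.ofFn T').prod * (List.ofFn T').prod) =
      (List.ofFn T').prod * (List.ofFn T').prod * T j := by
    have e := prefixProd_mul_prefixProd D.natInv_braid D.natInv_comm (j.1 + 1) j.1 le_rfl hj.le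
    have e2 := natInv_val T' i
    rw [hi'] at e2
    have e3 : prefixProd (natInv T') j.1 = prefixProd (natInv T') (j.1 + 1) * T j := by
      rw [prefixProd_succ, natInv_val, mul_assoc, D.inv_mul, mul_one]
    rw [e2, e3, ← eU] at e
    calc _ = T i * (T' i * (List.ofFn T').prod * ((List.ofFn T').prod * T j)) := by rw [← e]
      _ = (T i * T' i) * ((List.ofFn T').prod * (List.ofFn T').prod * T j) := by
          simp only [mul_assoc]
      _ = _ := by rw [D.mul_inv, one_mul]
  have h2 : ∀ k, k ≤ n - 1 → 0 < k →
      Commute (T i * prefixProd (natInv T') k) (θ ⟨0, hn⟩) := by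
    intro k hk hk0
    induction k with
    | zero => omega
    | succ k ih =>
      rcases Nat.eq_zero_or_pos k with rfl | hk1
      · have e2 := natInv_val T' i
        rw [hi'] at e2
        rw [prefixProd_one, e2, D.mul_inv]
        exact Commute.one_left _
      · rw [prefixProd_succ, ← mul_assoc]
        refine (ih (by omega) hk1).mul_left ?_
        have := natInv_val T' ⟨k, by omega⟩
        simp only at this
        rw [this]
        exact D.commute_inv (D.theta_far _ _
          (by simp only [lo, ne_eq, Fin.ext_iff]; omega)
          (by simp only [hi, ne_eq, Fin.ext_iff]; omega))
  have h3 := h2 (n - 1) le_rfl (by omega)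
  rw [← prod_ofFn] at h3
  have h4 : T i * (θ ⟨0, hn⟩ * T' i * θ ⟨0, hn⟩) = θ ⟨0, hn⟩ * T' i * θ ⟨0, hn⟩ * T i := by
    have e := (D.theta_comm (hi i) (lo i)).eq
    rw [D.theta_succ, hlo, smul_mul_assoc, mul_smul_comm] at e
    have e := smul_right_injective A D.t_ne e
    calc _ = T i * (θ ⟨0, hn⟩ * (T' i * θ ⟨0, hn⟩ * T' i)) * T i := by
          simp only [mul_assoc, D.inv_mul, mul_one]
      _ = (T i * T' i) * θ ⟨0, hn⟩ * T' i * θ ⟨0, hn⟩ * T i := by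
          rw [← e]; simp only [mul_assoc]
      _ = _ := by rw [D.mul_inv, one_mul]
  rw [D.pi_eq hn]
  generalize (List.ofFn T').prod = U at *
  simp only [mul_smul_comm, smul_mul_assoc]
  congr 2
  have h5 : θ ⟨0, hn⟩ * U * (θ ⟨0, hn⟩ * U) =
      (θ ⟨0, hn⟩ * T' i * θ ⟨0, hn⟩) * (T i * (U * U)) := by
    calc _ = θ ⟨0, hn⟩ * ((T' i * T i) * U) * (θ ⟨0, hn⟩ * U) := by rw [D.inv_mul, one_mul]
      _ = θ ⟨0, hn⟩ * T' i * (T i * U * θ ⟨0, hn⟩) * U := by simp only [mul_assoc]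
      _ = _ := by rw [h3.eq]; simp only [mul_assoc]
  have h6 := congrArg (T i * ·) h1
  simp only [mul_assoc] at h6
  rw [h5, ← mul_assoc (T i), h4]
  simp only [mul_assoc]
  rw [h6]

theorem theta_mul_T (D : IsDahaFamily q t T T' θ X p) (i : Fin (n - 1)) :
    θ (hi i) * T i = t • (T' i * θ (lo i)) := by
  rw [D.theta_succ, smul_mul_assoc, mul_assoc, D.inv_mul, mul_one]

theorem T_mul_theta (D : IsDahaFamily q t T T' θ X p) (i : Fin (n - 1)) :
    T i * θ (hi i) = t • (θ (lo i) * T' i) := by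
  rw [D.theta_succ, mul_smul_comm, mul_assoc, ← mul_assoc, D.mul_inv, one_mul]

theorem X_mul_T (D : IsDahaFamily q t T T' θ X p) (i : Fin (n - 1)) :
    X (hi i) * T i = t • (T' i * X (lo i)) := by
  rw [D.X_succ, smul_mul_assoc, mul_assoc, D.inv_mul, mul_one]

theorem T_mul_X (D : IsDahaFamily q t T T' θ X p) (i : Fin (n - 1)) :
    T i * X (hi i) = t • (X (lo i) * T' i) := by
  rw [D.X_succ, mul_smul_comm, mul_assoc, ← mul_assoc, D.mul_inv, one_mul]

/-- `T_i` commutes with `X_i X_{i+1}`. -/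
theorem commute_T_X_mul_X (D : IsDahaFamily q t T T' θ X p) (i : Fin (n - 1)) :
    Commute (T i) (X (lo i) * X (hi i)) := by
  have h1 : T i * (X (hi i) * X (lo i)) = t • (X (lo i) * T' i * X (lo i)) := by
    rw [← mul_assoc, D.T_mul_X, smul_mul_assoc]
  have h2 : X (lo i) * X (hi i) * T i = t • (X (lo i) * T' i * X (lo i)) := by
    rw [mul_assoc, D.X_mul_T, mul_smul_comm, mul_assoc]
  change _ * _ = _ * _
  rw [h2, (D.X_comm _ _).eq, h1]

/-! ### Commutation rules for Φ = X_n π_n⁻¹, with r the inverse of π_n. -/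

section Inverse

variable {r : A}

theorem inv_mul_T' (D : IsDahaFamily q t T T' θ X p) (hr : p * r = 1) (hl : r * p = 1)
    (i j : Fin (n - 1)) (h : i.1 + 1 = j.1) : r * T j = T i * r := by
  calc r * T j = r * (T j * p) * r := by rw [mul_assoc, mul_assoc, hr, mul_one]
    _ = (r * p) * T i * r := by rw [D.T_mul_pi i j h]; simp only [mul_assoc]
    _ = T i * r := by rw [hl, one_mul]

theorem inv_mul_X (D : IsDahaFamily q t T T' θ X p) (hr : p * r = 1) (hl : r * p = 1)
    (i : Fin (n - 1)) : r * X (hi i) = X (lo i) * r := by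
  calc r * X (hi i) = r * (X (hi i) * p) * r := by rw [mul_assoc, mul_assoc, hr, mul_one]
    _ = (r * p) * X (lo i) * r := by rw [← D.pi_X i]; simp only [mul_assoc]
    _ = X (lo i) * r := by rw [hl, one_mul]

theorem Phi_mul_T (D : IsDahaFamily q t T T' θ X p) (hr : p * r = 1) (hl : r * p = 1)
    (i j : Fin (n - 1)) (h : i.1 + 1 = j.1) (k : Fin n) (hk : k.1 + 1 = n) :
    X k * r * T j = T i * (X k * r) := by
  have h1 : Commute (T i) (X k) := D.X_far _ _
    (by simp only [lo, ne_eq, Fin.ext_iff]; omega) (by simp only [hi, ne_eq, Fin.ext_iff]; omega)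
  rw [mul_assoc, D.inv_mul_T' hr hl i j h, ← mul_assoc, ← h1.eq, mul_assoc]

/-- Φ² = X_{n-1} X_n π⁻², where π⁻² turns T_1 into T_{n-1}, which commutes with X_{n-1} X_n. -/
theorem Phi_sq_mul_T (D : IsDahaFamily q t T T' θ X p) (hr : p * r = 1) (hl : r * p = 1)
    (i j : Fin (n - 1)) (hi' : i.1 = 0) (hj : j.1 + 1 = n - 1) :
    X (hi j) * r * (X (hi j) * r) * T i = T j * (X (hi j) * r * (X (hi j) * r)) := by
  have h1 : r * r * T i = T j * (r * r) := by
    have e : r * r * (p * p) = 1 := by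
      rw [mul_assoc, ← mul_assoc r p, hl, one_mul, hl]
    have e' : p * p * (r * r) = 1 := by
      rw [mul_assoc, ← mul_assoc p r, hr, one_mul, hr]
    calc r * r * T i = r * r * (T i * (p * p)) * (r * r) := by
          rw [mul_assoc (r * r), mul_assoc (T i), e', mul_one]
      _ = (r * r * (p * p)) * T j * (r * r) := by
          rw [D.T_mul_pi_sq i j hi' hj]; simp only [mul_assoc]
      _ = _ := by rw [e, one_mul]
  have h2 : X (hi j) * r * (X (hi j) * r) = X (lo j) * X (hi j) * (r * r) := by
    rw [mul_assoc, ← mul_assoc r, D.inv_mul_X hr hl, (D.X_comm (lo j) (hi j)).eq]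
    simp only [mul_assoc]
  rw [h2, mul_assoc, h1, ← mul_assoc, ← (D.commute_T_X_mul_X j).eq, mul_assoc]

/-- `a_{k-1} ⋯ a_1 a_0`. -/
def revProd (a : ℕ → A) : ℕ → A
  | 0 => 1
  | k + 1 => a k * revProd a k

theorem eq_revProd_mul (y : Fin n → A)
    (hy : ∀ i, y (hi i) = t • (T' i * y (lo i) * T' i)) (h : 0 < n) (k : ℕ) (hk : k < n) :
    y ⟨k, hk⟩ = t ^ k • (revProd (natInv T') k * y ⟨0, h⟩ * prefixProd (natInv T') k) := by
  induction k with
  | zero => simp [prefixProd, revProd]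
  | succ k ih =>
    have h1 := hy ⟨k, by omega⟩
    have h2 := natInv_val T' ⟨k, by omega⟩
    change y ⟨k + 1, hk⟩ = t • (_ * y ⟨k, _⟩ * _) at h1
    change natInv T' k = _ at h2
    rw [h1, ih (by omega), prefixProd_succ, revProd, h2, pow_succ', mul_smul]
    simp only [mul_smul_comm, smul_mul_assoc, mul_assoc]

theorem theta_last_eq (D : IsDahaFamily q t T T' θ X p) (h : 0 < n) :
    θ ⟨n - 1, by omega⟩ = revProd (natInv T') (n - 1) * p := by
  rw [eq_revProd_mul θ D.theta_succ h, D.pi_eq h, mul_smul_comm, mul_assoc, prod_ofFn]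

theorem isUnit_prod (D : IsDahaFamily q t T T' θ X p) : IsUnit (List.ofFn T').prod := by
  have : ∀ l : List (Fin (n - 1)), IsUnit (l.map T').prod := by
    intro l
    induction l with
    | nil => simp
    | cons i l ih =>
      rw [List.map_cons, List.prod_cons]
      exact IsUnit.mul ⟨⟨T' i, T i, D.inv_mul i, D.mul_inv i⟩, rfl⟩ ih
  rw [List.ofFn_eq_map]
  exact this _

/-- With R = T_{n-1}⁻¹ ⋯ T_1⁻¹ both sides equal q R X_1: on the left by θ_n = R π and π X_n = q X_1
π, on the right by X_n π⁻¹ θ_1 = R X_1. -/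
theorem theta_last_mul_Phi (D : IsDahaFamily q t T T' θ X p) (hr : p * r = 1) (hl : r * p = 1)
    (h : 0 < n) : θ ⟨n - 1, by omega⟩ * (X ⟨n - 1, by omega⟩ * r) =
      q • (X ⟨n - 1, by omega⟩ * r * θ ⟨0, h⟩) := by
  -- In the opposite order the product is 1 by π⁻¹ π = 1; the product of the T_i⁻¹ is a unit, so the
  -- order does not matter.
  have h1 : (List.ofFn T').prod * (t ^ (n - 1) • (r * θ ⟨0, h⟩)) = 1 := by
    obtain ⟨u, hu⟩ := D.isUnit_prod
    have e : (t ^ (n - 1) • (r * θ ⟨0, h⟩)) * u = 1 := by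
      rw [hu, smul_mul_assoc, mul_assoc, ← mul_smul_comm, ← D.pi_eq h, hl]
    rw [← hu, Units.mul_eq_one_iff_eq_inv.1 e, Units.mul_inv]
  have h2 : X ⟨n - 1, by omega⟩ * r * θ ⟨0, h⟩ = revProd (natInv T') (n - 1) * X ⟨0, h⟩ := by
    rw [eq_revProd_mul X D.X_succ h, ← prod_ofFn]
    rw [smul_mul_assoc, smul_mul_assoc, mul_assoc, mul_assoc _ _ (r * _), ← mul_smul_comm,
      ← mul_smul_comm, h1, mul_one]
  rw [h2, D.theta_last_eq h, mul_assoc, ← mul_assoc p, D.pi_X_last h, smul_mul_assoc,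
    mul_assoc (X _), hr, mul_one, mul_smul_comm]

/-- Moving π to the right raises every index by one and gives T_{k+1}⁻¹ ⋯ T_2⁻¹ π; the factor T_1 on
the right cancels the surplus T_1⁻¹. -/
theorem pi_mul_revProd (D : IsDahaFamily q t T T' θ X p) (i : Fin (n - 1)) (hi' : i.1 = 0) (k : ℕ)
    (hk : k + 1 ≤ n - 1) :
    p * revProd (natInv T') k = revProd (natInv T') (k + 1) * T i * p := by
  have e2 := natInv_val T' i
  rw [hi'] at e2
  induction k with
  | zero => simp [revProd, e2, D.inv_mul]
  | succ k ih =>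
    have a1 := natInv_val T' ⟨k, by omega⟩
    have a2 := natInv_val T' ⟨k + 1, by omega⟩
    change natInv T' k = _ at a1
    change natInv T' (k + 1) = _ at a2
    have a3 : p * T' ⟨k, by omega⟩ = T' ⟨k + 1, by omega⟩ * p := by
      have := D.T_mul_pi ⟨k, by omega⟩ ⟨k + 1, by omega⟩ rfl
      calc p * T' ⟨k, by omega⟩ = T' ⟨k + 1, by omega⟩ * T ⟨k + 1, by omega⟩ * p *
            T' ⟨k, by omega⟩ := by rw [D.inv_mul, one_mul]
        _ = T' ⟨k + 1, by omega⟩ * p * (T ⟨k, by omega⟩ * T' ⟨k, by omega⟩) := by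
            rw [mul_assoc (T' _), this]; simp only [mul_assoc]
        _ = _ := by rw [D.mul_inv, mul_one]
    rw [revProd, revProd, a1, a2, ← mul_assoc, a3, mul_assoc, ih (by omega)]
    simp only [mul_assoc]

/-- Insert t θ_{n-1} = T_{n-1} θ_n T_{n-1} and θ_n = T_{n-1}⁻¹ ⋯ T_1⁻¹ π. Once X_n has moved to the
left, the identity comes down to T_1 π² = π² T_{n-1} (`e2`). -/
theorem theta_mul_Phi_last (D : IsDahaFamily q t T T' θ X p) (hr : p * r = 1) (hl : r * p = 1)
    (i : Fin (n - 1)) (h : i.1 + 1 = n - 1) :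
    θ (lo i) * (X (hi i) * r) = X (hi i) * r * θ (hi i) := by
  have hn : 0 < n := by omega
  have hlast : hi i = ⟨n - 1, by omega⟩ := Fin.ext h
  have e0 : T i * revProd (natInv T') (n - 1) = revProd (natInv T') i.1 := by
    have : revProd (natInv T') (n - 1) = revProd (natInv T') (i.1 + 1) := congrArg _ h.symm
    rw [this, revProd, natInv_val, ← mul_assoc, D.mul_inv, one_mul]
  have e1 : ∀ k ≤ i.1, Commute (revProd (natInv T') k) (X (hi i)) := by
    intro k hk
    induction k with
    | zero => exact Commute.one_left _
    | succ k ih =>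
      have a1 := natInv_val T' ⟨k, by omega⟩
      change natInv T' k = _ at a1
      rw [revProd, a1]
      refine Commute.mul_left (D.commute_inv (D.X_far _ _ ?_ ?_)) (ih (by omega))
      · simp only [lo, hi, ne_eq, Fin.ext_iff]; omega
      · simp only [hi, ne_eq, Fin.ext_iff]; omega
  have e2 : revProd (natInv T') i.1 * p * T' i = r * (revProd (natInv T') (n - 1) * p) * p := by
    have i0 : 0 < n - 1 := by omega
    have f1 := D.pi_mul_revProd ⟨0, i0⟩ rfl i.1 (by omega)
    rw [h] at f1
    have f2 := D.T_mul_pi_sq ⟨0, i0⟩ i rfl h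
    calc _ = r * (p * revProd (natInv T') i.1) * p * T' i := by
          rw [← mul_assoc, hl, one_mul]
      _ = r * revProd (natInv T') (n - 1) * (T ⟨0, i0⟩ * (p * p)) * T' i := by
          rw [f1]; simp only [mul_assoc]
      _ = r * revProd (natInv T') (n - 1) * (p * p) * (T i * T' i) := by
          rw [f2]; simp only [mul_assoc]
      _ = _ := by rw [D.mul_inv, mul_one]; simp only [mul_assoc]
  have e3 : t • θ (lo i) = T i * θ (hi i) * T i := by
    rw [D.T_mul_theta, smul_mul_assoc, mul_assoc, D.inv_mul, mul_one]
  have e4 := D.theta_last_eq hn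
  rw [← hlast] at e4
  apply smul_right_injective A D.t_ne
  simp only
  calc t • (θ (lo i) * (X (hi i) * r)) = T i * θ (hi i) * (T i * X (hi i)) * r := by
        rw [← smul_mul_assoc, e3]; simp only [mul_assoc]
    _ = t • ((T i * revProd (natInv T') (n - 1)) * (p * X (lo i)) * T' i * r) := by
        rw [D.T_mul_X, e4]; simp only [mul_smul_comm, smul_mul_assoc, mul_assoc]
    _ = t • (X (hi i) * (revProd (natInv T') i.1 * p * T' i) * r) := by
        rw [e0, D.pi_X, ← mul_assoc, (e1 i.1 le_rfl).eq]; simp only [mul_assoc]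
    _ = _ := by
        rw [e2, mul_assoc (X _), mul_assoc (r * _), hr, mul_one, e4]; simp only [mul_assoc]

/-- Descending induction on i: t θ_i = T_i θ_{i+1} T_i and T_i Φ = Φ T_{i+1} reduce the rule at i to
the rule at i+1. -/
theorem theta_mul_Phi (D : IsDahaFamily q t T T' θ X p) (hr : p * r = 1) (hl : r * p = 1)
    (i : Fin (n - 1)) (k : Fin n) (hk : k.1 + 1 = n) :
    θ (lo i) * (X k * r) = X k * r * θ (hi i) := by
  induction hd : n - 2 - i.1 generalizing i with
  | zero =>
    have : k = hi i := Fin.ext (by simp only [hi]; omega)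
    rw [this]
    exact D.theta_mul_Phi_last hr hl i (by omega)
  | succ d ih =>
    have ih' := ih ⟨i.1 + 1, by omega⟩ (by simp only; omega)
    have e3 : ∀ i, t • θ (lo i) = T i * θ (hi i) * T i := fun i => by
      rw [D.T_mul_theta, smul_mul_assoc, mul_assoc, D.inv_mul, mul_one]
    have e4 := D.Phi_mul_T hr hl i ⟨i.1 + 1, by omega⟩ rfl k hk
    have e5 := e3 ⟨i.1 + 1, by omega⟩
    have e6 : lo (⟨i.1 + 1, by omega⟩ : Fin (n - 1)) = hi i := rfl
    generalize (⟨i.1 + 1, by omega⟩ : Fin (n - 1)) = j at *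
    apply smul_right_injective A D.t_ne
    simp only
    rw [← e6]
    calc t • (θ (lo i) * (X k * r)) = T i * θ (hi i) * (T i * (X k * r)) := by
          rw [← smul_mul_assoc, e3]; simp only [mul_assoc]
      _ = T i * (θ (lo j) * (X k * r)) * T j := by rw [← e4, e6]; simp only [mul_assoc]
      _ = (T i * (X k * r)) * θ (hi j) * T j := by rw [ih']; simp only [mul_assoc]
      _ = X k * r * (T j * θ (hi j) * T j) := by rw [← e4]; simp only [mul_assoc]
      _ = _ := by rw [← e5, mul_smul_comm]

end Inverse

end IsDahaFamily

end VVMac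
end

noncomputable section
namespace VVMac

/-! ## Intertwiners -/

section Intertwiner

variable {K A : Type*} [Field K] [Ring A] [Algebra K A]

/-- The operator `t T⁻¹ + (t - 1) b / (a - b)`, where `y = T⁻¹`. -/
def intertwiner (t : K) (y : A) (a b : K) : A := t • y + ((t - 1) * b / (a - b)) • (1 : A)

theorem intertwiner_scale (t : K) (y : A) (a b r : K) (hr : r ≠ 0) :
    intertwiner t y (r * a) (r * b) = intertwiner t y a b := by
  unfold intertwiner
  congr 2
  rw [← mul_sub, mul_left_comm, mul_div_mul_left _ _ hr]

theorem commute_intertwiner {t : K} {x y : A} (h : Commute x y) (a b : K) :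
    Commute x (intertwiner t y a b) :=
  (h.smul_right _).add_right ((Commute.one_right _).smul_right _)

theorem mul_self_of_smul_inv {t : K} {x y : A} (h : t • y = x + (t - 1) • (1 : A))
    (hxy : x * y = 1) : (t • y) * (t • y) = (t - 1) • (t • y) + t • (1 : A) := by
  nth_rewrite 1 [h]
  rw [add_mul, mul_smul_comm, hxy, smul_mul_assoc, one_mul, add_comm]

/-- The Yang–Baxter equation for intertwiners. -/
theorem intertwiner_yang_baxter {t a b c : K} {y z : A} (hab : a ≠ b) (hac : a ≠ c) (hbc : b ≠ c)
    (hy : (t • y) * (t • y) = (t - 1) • (t • y) + t • (1 : A))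
    (hz : (t • z) * (t • z) = (t - 1) • (t • z) + t • (1 : A))
    (h : y * z * y = z * y * z) :
    intertwiner t y b c * intertwiner t z a c * intertwiner t y a b =
      intertwiner t z a b * intertwiner t y a c * intertwiner t z b c := by
  have h' : (t • y) * (t • z) * (t • y) = (t • z) * (t • y) * (t • z) := by
    simp only [smul_mul_assoc, mul_smul_comm, h]
  unfold intertwiner
  generalize t • y = Y at *
  generalize t • z = Z at *
  -- The braid relation cancels the cubic terms. What remains of the two sides differs by a multiple
  -- of Y - Z whose coefficient vanishes by this identity.
  have hf : (t - 1) * c / (a - c) * (t - 1 + (t - 1) * b / (a - b) + (t - 1) * c / (b - c)) =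
      (t - 1) * b / (a - b) * ((t - 1) * c / (b - c)) := by
    have h1 := sub_ne_zero.2 hab
    have h2 := sub_ne_zero.2 hac
    have h3 := sub_ne_zero.2 hbc
    field_simp
    ring
  generalize (t - 1) * b / (a - b) = f at *
  generalize (t - 1) * c / (a - c) = g at *
  generalize (t - 1) * c / (b - c) = k at *
  simp only [add_mul, mul_add, smul_mul_assoc, mul_smul_comm, mul_one, one_mul, hy, hz, h',
    smul_add, smul_smul]
  linear_combination (norm := module) hf • Y - hf • Z

variable {M : Type*} [AddCommGroup M] [Module K M] [Module A M] [IsScalarTower K A M]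

theorem intertwiner_smul (t : K) (y : A) (a b : K) (v : M) :
    intertwiner t y a b • v = t • y • v + ((t - 1) * b / (a - b)) • v := by
  rw [intertwiner, add_smul, smul_assoc, smul_assoc, one_smul]

/-- For b = ta the scalar term is -t, so the equation says y v = v. -/
theorem intertwiner_smul_eq_zero_iff_row {t a : K} {x y : A} (ht : t ≠ 0) (ht1 : t ≠ 1)
    (ha : a ≠ 0) (hxy : x * y = 1) (hyx : y * x = 1) (v : M) :
    intertwiner t y a (t * a) • v = 0 ↔ x • v = v := by
  have e : (t - 1) * (t * a) / (a - t * a) = -t := by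
    have h1 : a - t * a ≠ 0 := by
      rw [← one_sub_mul]; exact mul_ne_zero (sub_ne_zero.2 ht1.symm) ha
    rw [div_eq_iff h1]; ring
  rw [intertwiner_smul, e, neg_smul, ← sub_eq_add_neg, sub_eq_zero,
    (smul_right_injective M ht).eq_iff]
  constructor
  · intro h
    nth_rewrite 1 [← h]
    rw [smul_smul, hxy, one_smul]
  · intro h
    nth_rewrite 1 [← h]
    rw [smul_smul, hyx, one_smul]

/-- For a = tb the scalar term is 1, and it cancels t y v = -v. -/
theorem intertwiner_smul_eq_zero_of_col {t b : K} {x y : A} (ht1 : t ≠ 1)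
    (hb : b ≠ 0) (hyx : y * x = 1) (v : M) (h : x • v = (-t) • v) :
    intertwiner t y (t * b) b • v = 0 := by
  have e : (t - 1) * b / (t * b - b) = 1 := by
    rw [← sub_one_mul, div_self]
    exact mul_ne_zero (sub_ne_zero.2 ht1) hb
  have h2 : y • x • v = v := by rw [smul_smul, hyx, one_smul]
  rw [intertwiner_smul, e, one_smul]
  have h3 : y • x • v = (-t) • y • v := by
    rw [h, ← algebraMap_smul A (-t) v, smul_smul, ← Algebra.commutes, mul_smul, algebraMap_smul]
  rw [h2] at h3
  nth_rewrite 2 [h3]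
  generalize y • v = w
  module

/-- Since (tb-a)/(b-a) = 1 - (t-1)b/(a-b), the scalar part of the intertwiner cancels. The vector is
k(1 + t y)v = k(x + t)v, which x fixes by the quadratic relation. This is the origin of the factors
in the formula for P_T. -/
theorem smul_add_intertwiner_smul {t a b : K} {x y : A} (hab : a ≠ b)
    (h : t • y = x + (t - 1) • (1 : A)) (hxy : x * y = 1) (v : M) (k : K) :
    x • ((k * ((t * b - a) / (b - a))) • v + k • intertwiner t y a b • v) =
      (k * ((t * b - a) / (b - a))) • v + k • intertwiner t y a b • v := by
  have hx : ∀ w : M, x • w = t • y • w - (t - 1) • w := by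
    intro w
    have := congrArg (· • w) h
    simp only [add_smul, smul_assoc, one_smul] at this
    rw [this]; abel
  have hyy : ∀ w : M, t • y • (t • y • w) = (t - 1) • (t • y • w) + t • w := by
    intro w
    have := congrArg (· • w) (mul_self_of_smul_inv h hxy)
    simp only [add_smul, smul_assoc, one_smul, mul_smul] at this
    exact this
  have hc : ∀ (s : K) (w : M), y • s • w = s • y • w := fun s w => by
    rw [← algebraMap_smul A s w, smul_smul, ← Algebra.commutes, mul_smul, algebraMap_smul]
  have hyy' : ∀ w : M, t • t • y • y • w = (t - 1) • (t • y • w) + t • w := by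
    intro w
    rw [← hyy, hc]
  rw [hx, intertwiner_smul]
  have hab' : b - a ≠ 0 := sub_ne_zero.2 hab.symm
  have hab'' : a - b ≠ 0 := sub_ne_zero.2 hab
  simp only [smul_add, hc]
  have e := hyy' v
  have e1 : (t * b - a) / (b - a) = 1 - (t - 1) * b / (a - b) := by
    field_simp
    ring
  rw [e1]
  generalize (t - 1) * b / (a - b) = f at *
  generalize y • y • v = w at *
  generalize y • v = w' at *
  linear_combination (norm := module) k • e

end Intertwiner

/-! ### Intertwiners acting on joint eigenvectors of the θ_i. -/

namespace IsDahaFamily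

variable {K A : Type*} [Field K] [Ring A] [Algebra K A] {n : ℕ} {q t : K}
    {T T' : Fin (n - 1) → A} {θ X : Fin n → A} {p : A}

theorem theta_hi_mul (D : IsDahaFamily q t T T' θ X p) (i : Fin (n - 1)) :
    θ (hi i) * (t • T' i) = t • T' i * θ (lo i) + (t - 1) • θ (hi i) := by
  rw [D.smul_inv, mul_add, D.theta_mul_T, ← smul_mul_assoc, D.smul_inv, mul_smul_comm, mul_one]

theorem theta_lo_mul (D : IsDahaFamily q t T T' θ X p) (i : Fin (n - 1)) :
    θ (lo i) * (t • T' i) = t • T' i * θ (hi i) - (t - 1) • θ (hi i) := by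
  rw [mul_smul_comm, ← D.T_mul_theta, D.smul_inv, add_mul, smul_mul_assoc, one_mul,
    add_sub_cancel_right]

variable {M : Type*} [AddCommGroup M] [Module K M] [Module A M] [IsScalarTower K A M]

/-- Moving θ_i or θ_{i+1} past tT_i⁻¹ produces an extra term ∓(t-1)b v; the scalar (t-1)b/(a-b) is
the one that absorbs it. -/
theorem theta_intertwiner (D : IsDahaFamily q t T T' θ X p) (i : Fin (n - 1)) {a b : K}
    (hab : a ≠ b) {v : M} (ha : θ (lo i) • v = a • v) (hb : θ (hi i) • v = b • v) :
    θ (lo i) • intertwiner t (T' i) a b • v = b • intertwiner t (T' i) a b • v ∧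
      θ (hi i) • intertwiner t (T' i) a b • v = a • intertwiner t (T' i) a b • v := by
  have hc : ∀ (x : A) (s : K) (w : M), x • s • w = s • x • w := fun x s w => by
    rw [← algebraMap_smul A s w, smul_smul, ← Algebra.commutes, mul_smul, algebraMap_smul]
  have h1 := congrArg (· • v) (D.theta_hi_mul i)
  have h2 := congrArg (· • v) (D.theta_lo_mul i)
  simp only [add_smul, sub_smul, mul_smul, smul_assoc, ha, hb, hc, one_smul] at h1 h2
  have e : (t - 1) * b / (a - b) * (a - b) = (t - 1) * b := div_mul_cancel₀ _ (sub_ne_zero.2 hab)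
  rw [intertwiner_smul]
  simp only [smul_add, hc, ha, hb]
  generalize (t - 1) * b / (a - b) = f at *
  generalize θ (hi i) • T' i • v = v₁ at *
  generalize θ (lo i) • T' i • v = v₂ at *
  generalize T' i • v = v₃ at *
  constructor
  · linear_combination (norm := module) h2 + e • v
  · linear_combination (norm := module) h1 - e • v

theorem intertwiner_comm (D : IsDahaFamily q t T T' θ X p) (i j : Fin (n - 1))
    (h : i.1 + 1 < j.1) (a b c d : K) :
    Commute (intertwiner t (T' i) a b) (intertwiner t (T' j) c d) := by
  refine commute_intertwiner (Commute.symm (commute_intertwiner ?_ _ _)) _ _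
  exact D.commute_inv (D.commute_inv (D.comm i j h)).symm

theorem yang_baxter (D : IsDahaFamily q t T T' θ X p) (i j : Fin (n - 1)) (h : i.1 + 1 = j.1)
    {a b c : K} (hab : a ≠ b) (hac : a ≠ c) (hbc : b ≠ c) :
    intertwiner t (T' i) b c * intertwiner t (T' j) a c * intertwiner t (T' i) a b =
      intertwiner t (T' j) a b * intertwiner t (T' i) a c * intertwiner t (T' j) b c :=
  intertwiner_yang_baxter hab hac hbc (mul_self_of_smul_inv (D.smul_inv i) (D.mul_inv i))
    (mul_self_of_smul_inv (D.smul_inv j) (D.mul_inv j)) (D.braid_inv i j h)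

/-- Used to pass from D_n to the endomorphisms of V_λ, among which π_n has an inverse. -/
theorem map {B : Type*} [Ring B] [Algebra K B] (D : IsDahaFamily q t T T' θ X p) (f : A →ₐ[K] B) :
    IsDahaFamily q t (fun i => f (T i)) (fun i => f (T' i)) (fun i => f (θ i)) (fun i => f (X i))
      (f p) where
  t_ne := D.t_ne
  mul_inv i := by rw [← map_mul, D.mul_inv, map_one]
  inv_mul i := by rw [← map_mul, D.inv_mul, map_one]
  smul_inv i := by rw [← map_smul, D.smul_inv, map_add, map_smul, map_one]
  braid i j h := by simp only [← map_mul, D.braid i j h]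
  comm i j h := (D.comm i j h).map f
  theta_comm i j := (D.theta_comm i j).map f
  theta_succ i := by rw [D.theta_succ]; simp
  theta_far i j h1 h2 := (D.theta_far i j h1 h2).map f
  X_comm i j := (D.X_comm i j).map f
  X_succ i := by rw [D.X_succ]; simp
  X_far i j h1 h2 := (D.X_far i j h1 h2).map f
  pi_eq h := by rw [D.pi_eq h, map_smul, map_mul, map_list_prod, List.map_ofFn]; rfl
  pi_X i := by rw [← map_mul, D.pi_X, map_mul]
  pi_X_last h := by rw [← map_mul, D.pi_X_last h, map_smul, map_mul]

end IsDahaFamily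

/-! ## The double affine Hecke algebra and the module `V_λ` -/

theorem smul_heckeInv {A : Type*} [Ring A] [Algebra QT A] (x : A) :
    t • heckeInv x = x + (t - 1) • (1 : A) := by
  rw [heckeInv, smul_smul, mul_inv_cancel₀ t_ne_zero, one_smul, Algebra.algebraMap_eq_smul_one]

theorem Aff.mk_hecke {n : ℕ} (a : FreeAlgebra QT (Fin (n - 1))) :
    Aff.mk n (freeHA n a) = heckeToAff n (Hecke.mk n a) :=
  (RingQuot.liftAlgHom_mkAlgHom_apply QT (s := HeckeRel n) ((Aff.mk n).comp (freeHA n))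
    (fun _ _ h => Aff.mk_rel (AffRel.hecke h)) a).symm

theorem Daha.mk_aff {n : ℕ} (a : FreeAlgebra QT (AffGen n)) :
    Daha.mk n (freeAD n a) = affToDaha n (Aff.mk n a) :=
  (RingQuot.liftAlgHom_mkAlgHom_apply QT (s := AffRel n) ((Daha.mk n).comp (freeAD n))
    (fun _ _ h => Daha.mk_rel (DahaRel.aff h)) a).symm

theorem rho_mk {n : ℕ} (a : FreeAlgebra QT (AffGen n)) : rho n (Aff.mk n a) = freeRho n a := by
  exact RingQuot.liftAlgHom_mkAlgHom_apply QT _ _ a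

/-- The generator `T_i` of the affine Hecke algebra. -/
def Aff.T {n : ℕ} (i : Fin (n - 1)) : Aff n := Aff.mk n (FreeAlgebra.ι QT (AffGen.T i))

/-- The generator `θ_i` of the affine Hecke algebra. -/
def Aff.θ {n : ℕ} (i : Fin n) : Aff n := Aff.mk n (FreeAlgebra.ι QT (AffGen.θ i))

theorem affToDaha_T {n : ℕ} (i : Fin (n - 1)) : affToDaha n (Aff.T i) = Daha.T i := by
  rw [Aff.T, ← Daha.mk_aff]; simp [freeAD, Daha.T]

theorem affToDaha_θ {n : ℕ} (i : Fin n) : affToDaha n (Aff.θ i) = Daha.θ i := by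
  rw [Aff.θ, ← Daha.mk_aff]; simp [freeAD, Daha.θ]

theorem heckeToAff_T {n : ℕ} (i : Fin (n - 1)) : heckeToAff n (Hecke.T i) = Aff.T i := by
  rw [Hecke.T, ← Aff.mk_hecke]; simp [freeHA, Aff.T]

theorem rho_T {n : ℕ} (i : Fin (n - 1)) : rho n (Aff.T i) = Hecke.T i := by
  rw [Aff.T, rho_mk]; simp [freeRho]

theorem rho_θ {n : ℕ} (i : Fin n) : rho n (Aff.θ i) = thetaBar i := by
  rw [Aff.θ, rho_mk]; simp [freeRho]

theorem Daha.mk_piElt {n : ℕ} (h : 0 < n) : Daha.mk n (freePi n h) = Daha.pi h := by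
  unfold freePi Daha.pi piElt
  rw [map_smul, map_mul, map_list_prod, List.map_ofFn]
  congr 3
  congr 1
  funext i
  exact map_heckeInv _ _

theorem Daha.isDahaFamily {n : ℕ} (h : 0 < n) : IsDahaFamily q t (Daha.T (n := n))
    (fun i => heckeInv (Daha.T i)) Daha.θ Daha.X (Daha.pi h) where
  t_ne := t_ne_zero
  mul_inv i := by
    have := congrArg (fun x => affToDaha n (heckeToAff n x)) (mul_heckeInv (Hecke.quad i))
    simpa only [map_mul, map_heckeInv, heckeToAff_T, affToDaha_T, map_one] using this
  inv_mul i := by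
    have := congrArg (fun x => affToDaha n (heckeToAff n x)) (heckeInv_mul (Hecke.quad i))
    simpa only [map_mul, map_heckeInv, heckeToAff_T, affToDaha_T, map_one] using this
  smul_inv i := smul_heckeInv _
  braid i j h := by
    have := congrArg (fun x => affToDaha n (heckeToAff n x)) (Hecke.braid i j h)
    simpa only [map_mul, heckeToAff_T, affToDaha_T] using this
  comm i j h := by
    have := ((Hecke.comm i j h).map (heckeToAff n)).map (affToDaha n)
    simpa only [heckeToAff_T, affToDaha_T] using this
  theta_comm i j := by
    have := Daha.mk_rel (DahaRel.aff (AffRel.theta_comm i j))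
    simp [freeAD] at this
    exact this
  theta_succ i := by
    have := Daha.mk_rel (DahaRel.aff (AffRel.theta_succ i))
    simp [freeAD, map_heckeInv] at this
    exact this
  theta_far i j h1 h2 := by
    have := Daha.mk_rel (DahaRel.aff (AffRel.theta_far i j h1 h2))
    simp [freeAD] at this
    exact this
  X_comm i j := by
    have := Daha.mk_rel (DahaRel.X_comm i j)
    rw [map_mul, map_mul] at this
    exact this
  X_succ i := by
    have := Daha.mk_rel (DahaRel.X_succ i)
    simp [map_heckeInv] at this
    exact this
  X_far i j h1 h2 := by
    have := Daha.mk_rel (DahaRel.X_far i j h1 h2)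
    rw [map_mul, map_mul] at this
    exact this
  pi_eq _ := rfl
  pi_X i := by
    have := Daha.mk_rel (DahaRel.pi_X h i)
    rwa [map_mul, map_mul, Daha.mk_piElt] at this
  pi_X_last _ := by
    have := Daha.mk_rel (DahaRel.pi_X_last h)
    rwa [map_mul, map_smul, map_mul, Daha.mk_piElt] at this

end VVMac
end

noncomputable section
namespace VVMac
variable {μ : YoungDiagram}

/-! ## Combinatorics of periodic standard Young tableaux -/

theorem LabelLT.trans {n : ℕ} {u v w : Fin n × ℕ} (h1 : LabelLT u v) (h2 : LabelLT v w) :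
    LabelLT u w := by
  unfold LabelLT at *
  simp only [Fin.lt_def] at *
  omega

namespace PSYT

theorem label_box_eq (τ : PSYT μ) (j : Fin μ.card) : τ.label (τ.box j) = (j, τ.w j) :=
  Prod.ext (τ.label_box j) rfl

theorem w_label (τ : PSYT μ) (x : Box μ) : τ.w (τ.label x).1 = (τ.label x).2 := by
  rw [w, box_label]

theorem box_injective (τ : PSYT μ) : Function.Injective τ.box :=
  (Equiv.ofBijective _ τ.bij).symm.injective

theorem box_eq_iff {τ : PSYT μ} {j : Fin μ.card} {x : Box μ} :
    τ.box j = x ↔ (τ.label x).1 = j :=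
  ⟨fun h => by rw [← h, label_box], fun h => by rw [← h, box_label]⟩

theorem ext_box {τ σ : PSYT μ} (h1 : τ.box = σ.box) (h2 : τ.w = σ.w) : τ = σ := by
  apply ext_label
  funext x
  have e : (τ.label x).1 = (σ.label x).1 := by
    rw [← box_eq_iff, h1, box_label]
  exact Prod.ext e (by rw [← w_label, ← w_label, e, h2])

/-- Go along the row of x to the column of y, then down that column; the corner box belongs to the
diagram. -/
theorem labelLT_of_le (τ : PSYT μ) {x y : Box μ} (h1 : x.1.1 ≤ y.1.1) (h2 : x.1.2 ≤ y.1.2)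
    (hne : x ≠ y) : LabelLT (τ.label x) (τ.label y) := by
  have hz : (x.1.1, y.1.2) ∈ μ.cells := μ.isLowerSet (show (x.1.1, y.1.2) ≤ y.1 from ⟨h1, le_rfl⟩) y.2
  rcases h1.lt_or_eq with h1' | h1'
  · have hc : LabelLT (τ.label ⟨_, hz⟩) (τ.label y) := τ.col_lt _ _ ⟨rfl, h1'⟩
    rcases h2.lt_or_eq with h2' | h2'
    · exact (τ.row_lt x ⟨_, hz⟩ ⟨rfl, h2'⟩).trans hc
    · exact τ.col_lt _ _ ⟨h2', h1'⟩
  · rcases h2.lt_or_eq with h2' | h2'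
    · exact τ.row_lt _ _ ⟨h1', h2'⟩
    · exact absurd (Subtype.ext (Prod.ext h1' h2')) hne

/-- No label lies strictly between i q^b and (i+1) q^b, while every other box weakly north-west of
the box of i+1 has a smaller label than it. -/
theorem eq_of_between (τ : PSYT μ) (i : Fin (μ.card - 1)) (hw : τ.w (lo i) = τ.w (hi i))
    (z : Box μ) (h1 : LabelLT (τ.label (τ.box (lo i))) (τ.label z)) (h2 : z.1.1 ≤ (τ.box (hi i)).1.1)
    (h3 : z.1.2 ≤ (τ.box (hi i)).1.2) : z = τ.box (hi i) := by
  by_contra hne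
  have h4 := τ.labelLT_of_le h2 h3 hne
  rw [label_box_eq] at h1 h4
  unfold LabelLT at h1 h4
  simp only [lo, hi, Fin.lt_def] at *
  omega

/-- If the box of i is weakly north-west of the box of i+1, then so is its right or lower neighbour,
which by `eq_of_between` is the box of i+1. The opposite position contradicts the growth of labels.
-/
theorem adjacent_or_incomparable (τ : PSYT μ) (i : Fin (μ.card - 1))
    (hw : τ.w (lo i) = τ.w (hi i)) :
    ((τ.box (lo i)).1.1 = (τ.box (hi i)).1.1 ∧ (τ.box (hi i)).1.2 = (τ.box (lo i)).1.2 + 1) ∨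
    ((τ.box (lo i)).1.2 = (τ.box (hi i)).1.2 ∧ (τ.box (hi i)).1.1 = (τ.box (lo i)).1.1 + 1) ∨
    ((τ.box (lo i)).1.1 < (τ.box (hi i)).1.1 ∧ (τ.box (hi i)).1.2 < (τ.box (lo i)).1.2) ∨
    ((τ.box (hi i)).1.1 < (τ.box (lo i)).1.1 ∧ (τ.box (lo i)).1.2 < (τ.box (hi i)).1.2) := by
  have hb := τ.eq_of_between i hw
  have hne : τ.box (lo i) ≠ τ.box (hi i) := fun h => lo_ne_hi i (τ.box_injective h)
  have hcoord : ¬ ((τ.box (lo i)).1.1 = (τ.box (hi i)).1.1 ∧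
      (τ.box (lo i)).1.2 = (τ.box (hi i)).1.2) := fun h => hne (Subtype.ext (Prod.ext h.1 h.2))
  have hrev : ¬ ((τ.box (hi i)).1.1 ≤ (τ.box (lo i)).1.1 ∧
      (τ.box (hi i)).1.2 ≤ (τ.box (lo i)).1.2) := by
    intro h
    have := τ.labelLT_of_le h.1 h.2 hne.symm
    rw [label_box_eq, label_box_eq] at this
    unfold LabelLT at this
    simp only [lo, hi, Fin.lt_def] at *
    omega
  by_cases hle : (τ.box (lo i)).1.1 ≤ (τ.box (hi i)).1.1 ∧
      (τ.box (lo i)).1.2 ≤ (τ.box (hi i)).1.2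
  · rcases hle.2.lt_or_eq with h | h
    · left
      have hz : ((τ.box (lo i)).1.1, (τ.box (lo i)).1.2 + 1) ∈ μ.cells :=
        μ.isLowerSet (show (_, _) ≤ (τ.box (hi i)).1 from ⟨hle.1, h⟩) (τ.box (hi i)).2
      have := hb ⟨_, hz⟩ (τ.row_lt _ _ ⟨rfl, Nat.lt_succ_self _⟩) hle.1 h
      rw [← this]
      exact ⟨rfl, rfl⟩
    · right; left
      have h' : (τ.box (lo i)).1.1 < (τ.box (hi i)).1.1 := by omega
      have hz : ((τ.box (lo i)).1.1 + 1, (τ.box (lo i)).1.2) ∈ μ.cells :=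
        μ.isLowerSet (show (_, _) ≤ (τ.box (hi i)).1 from ⟨h', h.le⟩) (τ.box (hi i)).2
      have := hb ⟨_, hz⟩ (τ.col_lt _ _ ⟨rfl, Nat.lt_succ_self _⟩) h' h.le
      rw [← this]
      exact ⟨rfl, rfl⟩
  · omega

/-- Exchanging `i` and `i + 1` in `τ` if their boxes do not lie in order in one row or column. -/
def swapOf (τ : PSYT μ) (i : Fin (μ.card - 1)) (hr : ¬ RowLT (τ.box (lo i)) (τ.box (hi i)))
    (hc : ¬ ColLT (τ.box (lo i)) (τ.box (hi i))) : PSYT μ :=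
  have key : ∀ x y, ¬ (x = τ.box (lo i) ∧ y = τ.box (hi i)) → LabelLT (τ.label x) (τ.label y) →
      LabelLT (adjSwap i (τ.label x).1, (τ.label x).2)
        (adjSwap i (τ.label y).1, (τ.label y).2) := by
    intro x y hne hxy
    rcases hxy with hxy | ⟨he, hlt⟩
    · exact Or.inl hxy
    · refine Or.inr ⟨he, adjSwap_lt_adjSwap i hlt fun h => hne ?_⟩
      exact ⟨(box_eq_iff.2 h.1).symm, (box_eq_iff.2 h.2).symm⟩
  { label := fun x => (adjSwap i (τ.label x).1, (τ.label x).2)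
    bij := (adjSwap i).bijective.comp τ.bij
    row_lt := fun x y hxy => key x y (fun h => hr (by rwa [h.1, h.2] at hxy)) (τ.row_lt x y hxy)
    col_lt := fun x y hxy => key x y (fun h => hc (by rwa [h.1, h.2] at hxy)) (τ.col_lt x y hxy) }

theorem isSwap_swapOf (τ : PSYT μ) (i : Fin (μ.card - 1))
    (hr : ¬ RowLT (τ.box (lo i)) (τ.box (hi i))) (hc : ¬ ColLT (τ.box (lo i)) (τ.box (hi i))) :
    IsSwap i τ (τ.swapOf i hr hc) := fun _ => rfl

section IsSwap

variable {i : Fin (μ.card - 1)} {τ τ' : PSYT μ}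

theorem IsSwap.box_eq (h : IsSwap i τ τ') (j : Fin μ.card) : τ'.box j = τ.box (adjSwap i j) := by
  rw [box_eq_iff, h, label_box, adjSwap_adjSwap]

theorem IsSwap.w_eq (h : IsSwap i τ τ') (j : Fin μ.card) : τ'.w j = τ.w (adjSwap i j) := by
  rw [w, w, h.box_eq, h]

theorem IsSwap.c_eq (h : IsSwap i τ τ') (j : Fin μ.card) : τ'.c j = τ.c (adjSwap i j) := by
  rw [c, c, h.box_eq]

theorem IsSwap.symm (h : IsSwap i τ τ') : IsSwap i τ' τ := by
  intro x
  rw [h, adjSwap_adjSwap]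

theorem IsSwap.unique {τ'' : PSYT μ} (h : IsSwap i τ τ') (h' : IsSwap i τ τ'') : τ' = τ'' :=
  ext_label (funext fun x => (h x).trans (h' x).symm)

theorem IsSwap.exps_eq (h : IsSwap i τ τ') : τ'.exps = τ.exps := by
  have : ∀ x, τ'.exps.val x = τ.exps.val x := fun x =>
    (congrArg Prod.snd (h x) :)
  cases h1 : τ'.exps
  cases h2 : τ.exps
  simp only [h1, h2] at this
  congr
  exact funext this

theorem IsSwap.ne (h : IsSwap i τ τ') : τ' ≠ τ := by
  rintro rfl
  have := h (τ'.box (lo i))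
  rw [label_box_eq, adjSwap_lo] at this
  exact lo_ne_hi i (congrArg Prod.fst this)

/-- If `i` and `i + 1` can be exchanged and have the same exponents, their contents differ by at
least two. -/
theorem IsSwap.one_lt_abs (h : IsSwap i τ τ') (hw : τ.w (lo i) = τ.w (hi i)) :
    1 < τ.c (lo i) - τ.c (hi i) ∨ 1 < τ.c (hi i) - τ.c (lo i) := by
  have hw' : τ'.w (lo i) = τ'.w (hi i) := by
    rw [h.w_eq, h.w_eq, adjSwap_lo, adjSwap_hi, hw]
  -- The two boxes exchange roles in τ', so neighbours in τ would be neighbours in the wrong order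
  -- in τ'. Only incomparable positions survive.
  have h1 := τ.adjacent_or_incomparable i hw
  have h2 := τ'.adjacent_or_incomparable i hw'
  rw [h.box_eq, h.box_eq, adjSwap_lo, adjSwap_hi] at h2
  unfold c content
  omega

end IsSwap

theorem exists_swap_or_adjacent (τ : PSYT μ) (i : Fin (μ.card - 1)) :
    (∃ τ', IsSwap i τ τ') ∨ (τ.w (lo i) = τ.w (hi i) ∧
      (((τ.box (lo i)).1.1 = (τ.box (hi i)).1.1 ∧ τ.c (hi i) = τ.c (lo i) + 1) ∨
      ((τ.box (lo i)).1.2 = (τ.box (hi i)).1.2 ∧ τ.c (lo i) = τ.c (hi i) + 1))) := by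
  by_cases hw : τ.w (lo i) = τ.w (hi i)
  · rcases τ.adjacent_or_incomparable i hw with h | h | h
    · exact Or.inr ⟨hw, Or.inl ⟨h.1, by unfold c content; omega⟩⟩
    · exact Or.inr ⟨hw, Or.inr ⟨h.1, by unfold c content; omega⟩⟩
    · exact Or.inl ⟨_, τ.isSwap_swapOf i (by unfold RowLT; omega) (by unfold ColLT; omega)⟩
  · exact Or.inl ⟨_, τ.isSwap_swapOfNe i hw⟩

/-- Equal weights mean equal exponents and equal contents, but consecutive indices with equal
exponents have different contents. So the intertwiner at a tableau has a nonzero denominator. -/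
theorem weight_lo_ne_hi (τ : PSYT μ) (i : Fin (μ.card - 1)) : τ.weight (lo i) ≠ τ.weight (hi i) := by
  intro h
  obtain ⟨hw, hc⟩ := qt_monomial_injective h
  rcases τ.exists_swap_or_adjacent i with ⟨τ', h'⟩ | ⟨_, h'⟩
  · rcases h'.one_lt_abs hw with h'' | h'' <;> omega
  · omega

end PSYT

instance : Finite (SYT μ) := by
  refine Finite.of_injective (fun τ : SYT μ => fun x : Box μ => (τ.1.label x).1) ?_
  intro τ σ h
  refine Subtype.ext (PSYT.ext_label (funext fun x => Prod.ext (congrFun h x) ?_))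
  rw [τ.2, σ.2]

/-! ## The basic vectors of `V_λ` -/

theorem t_ne_one : t ≠ 1 := by
  intro h
  have := qt_monomial_injective (a := 0) (a' := 0) (c := 1) (c' := 0) (by simp [h])
  omega

theorem Ind.smul_one_tmul {K A D : Type} [CommRing K] [Ring A] [Algebra K A] [Ring D] [Algebra K D]
    (f : A →ₐ[K] D) (M : Type) [AddCommGroup M] [Module K M] [Module A M] (a : A) (m : M) :
    f a • Ind.one_tmul f M m = Ind.one_tmul f M (a • m) := by
  refine (Submodule.Quotient.mk_smul (indRel f M) (r := f a) (x := (1 : D) ⊗ₜ[K] m)).symm.trans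
    ((Submodule.Quotient.eq _).2 (Submodule.subset_span ⟨1, a, m, ?_⟩))
  rw [one_mul, TensorProduct.smul_tmul', smul_eq_mul, mul_one]

theorem Ind.one_tmul_smul {K A D : Type} [CommRing K] [Ring A] [Algebra K A] [Ring D] [Algebra K D]
    (f : A →ₐ[K] D) (M : Type) [AddCommGroup M] [Module K M] [Module A M] (k : K) (m : M) :
    Ind.one_tmul f M (k • m) = k • Ind.one_tmul f M m := by
  change Submodule.Quotient.mk _ = k • Submodule.Quotient.mk _
  rw [TensorProduct.tmul_smul]
  rfl

theorem Ind.one_tmul_add {K A D : Type} [CommRing K] [Ring A] [Algebra K A] [Ring D] [Algebra K D]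
    (f : A →ₐ[K] D) (M : Type) [AddCommGroup M] [Module K M] [Module A M] (m m' : M) :
    Ind.one_tmul f M (m + m') = Ind.one_tmul f M m + Ind.one_tmul f M m' := by
  change Submodule.Quotient.mk _ = Submodule.Quotient.mk _ + Submodule.Quotient.mk _
  rw [TensorProduct.tmul_add]
  rfl

theorem Specht.smul_vec (h : Hecke μ.card) (τ : SYT μ) :
    h • Specht.vec τ = Submodule.Quotient.mk (Finsupp.single τ h) := by
  refine (Submodule.Quotient.mk_smul (Submodule.span (Hecke μ.card) {r | SpechtRel μ r})
    (r := h) (x := Finsupp.single τ 1)).symm.trans ?_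
  rw [Finsupp.smul_single, smul_eq_mul, mul_one]

theorem Specht.smul_vec_eq {h : Hecke μ.card} {k : QT} {τ τ' : SYT μ}
    (hr : SpechtRel μ (Finsupp.single τ h - k • Finsupp.single τ' 1)) :
    h • Specht.vec τ = k • Specht.vec τ' := by
  rw [Specht.smul_vec]
  exact (Submodule.Quotient.eq _).2 (Submodule.subset_span hr)

theorem V.smul_vec (a : Aff μ.card) (τ : SYT μ) : affToDaha μ.card a • V.vec τ =
    Ind.one_tmul (affToDaha μ.card) (RhoSpecht μ) (rho μ.card a • Specht.vec τ) :=
  Ind.smul_one_tmul _ _ _ _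

theorem V.smul_vec_eq {a : Aff μ.card} {k : QT} {τ τ' : SYT μ}
    (hr : SpechtRel μ (Finsupp.single τ (rho μ.card a) - k • Finsupp.single τ' 1)) :
    affToDaha μ.card a • V.vec τ = k • V.vec τ' := by
  rw [V.smul_vec, Specht.smul_vec_eq hr]
  exact Ind.one_tmul_smul (affToDaha μ.card) (RhoSpecht μ) _ _

theorem V.theta_smul_vec (i : Fin μ.card) (τ : SYT μ) :
    (Daha.θ i : Daha μ.card) • V.vec τ = t ^ τ.1.c i • V.vec τ := by
  rw [← affToDaha_θ]
  exact V.smul_vec_eq (by rw [rho_θ]; exact SpechtRel.theta i τ)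

theorem V.theta_zero_smul_vec (h : 0 < μ.card) (τ : SYT μ) :
    (Daha.θ ⟨0, h⟩ : Daha μ.card) • V.vec τ = V.vec τ := by
  rw [← affToDaha_θ, V.smul_vec, rho_θ]
  exact congrArg (Ind.one_tmul (affToDaha μ.card) (RhoSpecht μ))
    (one_smul (Hecke μ.card) (Specht.vec τ))

theorem V.T_smul_vec_row (i : Fin (μ.card - 1)) (τ : SYT μ)
    (h : (τ.1.box (lo i)).1.1 = (τ.1.box (hi i)).1.1) :
    (Daha.T i : Daha μ.card) • V.vec τ = V.vec τ := by
  have := V.smul_vec_eq (a := Aff.T i) (k := 1) (τ := τ) (τ' := τ) (by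
    rw [rho_T, one_smul]
    exact SpechtRel.row i τ h)
  rwa [affToDaha_T, one_smul] at this

theorem V.T_smul_vec_col (i : Fin (μ.card - 1)) (τ : SYT μ)
    (h : (τ.1.box (lo i)).1.2 = (τ.1.box (hi i)).1.2) :
    (Daha.T i : Daha μ.card) • V.vec τ = (-t) • V.vec τ := by
  rw [← affToDaha_T]
  exact V.smul_vec_eq (by rw [rho_T]; exact SpechtRel.col i τ h)

/-- With a, b the eigenvalues of θ_i, θ_{i+1} on τ, the commutation rule of θ_i with tT_i⁻¹ lets
φ̄_i act as (a-b)tT_i⁻¹ + (t-1)b, which is a-b times the intertwiner. -/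
theorem V.intertwiner_smul_vec (i : Fin (μ.card - 1)) (τ τ' : SYT μ)
    (h : PSYT.IsSwap i τ.1 τ'.1) (hc : 1 < τ.1.c (lo i) - τ.1.c (hi i)) :
    intertwiner t (heckeInv (Daha.T i : Daha μ.card)) (t ^ τ.1.c (lo i)) (t ^ τ.1.c (hi i)) •
      V.vec τ = V.vec τ' := by
  have hn : 0 < μ.card := by have := i.2; omega
  have hw : ∀ j, τ.1.w j = 0 := fun j => τ.2 _
  have hlt : PSYT.lt τ.1 τ'.1 := Relation.TransGen.single
    (PSYT.Cover.swap_content i _ _ h (by rw [hw, hw]) hc)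
  have h1 := V.smul_vec_eq (a := (t • heckeInv (Aff.T i)) * Aff.θ (lo i) -
      Aff.θ (lo i) * (t • heckeInv (Aff.T i))) (k := t ^ τ.1.c (lo i) - t ^ τ.1.c (hi i))
    (τ := τ) (τ' := τ') (by
      rw [map_sub, map_mul, map_mul, map_smul, map_heckeInv, rho_T, rho_θ]
      exact SpechtRel.phi i τ τ' h hlt)
  rw [map_sub, map_mul, map_mul, map_smul, map_heckeInv, affToDaha_T, affToDaha_θ,
    (Daha.isDahaFamily hn).theta_lo_mul i] at h1
  have hab : t ^ τ.1.c (lo i) ≠ t ^ τ.1.c (hi i) := by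
    intro e
    have := qt_monomial_injective (a := 0) (a' := 0) (c := τ.1.c (lo i)) (c' := τ.1.c (hi i))
      (by rw [pow_zero, one_mul, one_mul]; exact e)
    omega
  have h2 := V.theta_smul_vec (lo i) τ
  have h3 := V.theta_smul_vec (hi i) τ
  have gen : ∀ {K A M : Type} [Field K] [Ring A] [Algebra K A] [AddCommGroup M] [Module K M]
      [Module A M] [IsScalarTower K A M] (t a b : K) (y θ₁ θ₂ : A) (v v' : M), a ≠ b →
      θ₁ • v = a • v → θ₂ • v = b • v →
      ((t • y) * θ₁ - ((t • y) * θ₂ - (t - 1) • θ₂)) • v = (a - b) • v' →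
      intertwiner t y a b • v = v' := by
    intro K A M _ _ _ _ _ _ _ t a b y θ₁ θ₂ v v' hab h1 h2 h
    have hc : ∀ (s : K) (w : M), y • s • w = s • y • w := fun s w => by
      rw [← algebraMap_smul A s w, smul_smul, ← Algebra.commutes, mul_smul, algebraMap_smul]
    simp only [sub_smul, mul_smul, h1, h2, smul_assoc, hc] at h
    have hab' := sub_ne_zero.2 hab
    apply smul_right_injective M hab'
    simp only [intertwiner_smul]
    have e : (t - 1) * b / (a - b) * (a - b) = (t - 1) * b := div_mul_cancel₀ _ hab'
    generalize (t - 1) * b / (a - b) = f at *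
    generalize y • v = w at *
    linear_combination (norm := module) h + e • v
  exact gen _ _ _ _ _ _ _ _ hab h2 h3 h1

end VVMac
end

noncomputable section
namespace VVMac
variable {μ : YoungDiagram}

/-! ## Invertibility of `π_n` -/

section DegreeFiltration

variable {K A M : Type*} [Field K] [Ring A] [Algebra K A] [AddCommGroup M] [Module K M]
  [Module A M] [IsScalarTower K A M] {n : ℕ} {q t : K} {T T' : Fin (n - 1) → A}
  {θ X : Fin n → A} {p : A}

theorem smul_smul_comm_of_tower (x : A) (s : K) (w : M) : x • s • w = s • x • w := by
  rw [← algebraMap_smul A s w, smul_smul, ← Algebra.commutes, mul_smul, algebraMap_smul]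

/-- The span of the `X_{i_1} ⋯ X_{i_r} v` with `r ≤ d` and `v ∈ W`. -/
def degreeFiltration (X : Fin n → A) (W : Submodule K M) : ℕ → Submodule K M
  | 0 => W
  | d + 1 => degreeFiltration X W d ⊔
      ⨆ j, (degreeFiltration X W d).map (Algebra.lsmul K K M (X j))

theorem degreeFiltration_le_succ (X : Fin n → A) (W : Submodule K M) (d : ℕ) :
    degreeFiltration X W d ≤ degreeFiltration X W (d + 1) := le_sup_left

theorem degreeFiltration_mono (X : Fin n → A) (W : Submodule K M) :
    Monotone (degreeFiltration X W) := monotone_nat_of_le_succ (degreeFiltration_le_succ X W)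

theorem X_smul_mem_degreeFiltration {X : Fin n → A} {W : Submodule K M} {d : ℕ} (j : Fin n) {v : M}
    (hv : v ∈ degreeFiltration X W d) : X j • v ∈ degreeFiltration X W (d + 1) :=
  le_sup_right (a := degreeFiltration X W d)
    (Submodule.mem_iSup_of_mem j (Submodule.mem_map.2 ⟨v, hv, rfl⟩))

theorem degreeFiltration_succ_le {X : Fin n → A} {W S : Submodule K M} {d : ℕ}
    (h1 : ∀ v ∈ degreeFiltration X W d, v ∈ S)
    (h2 : ∀ j, ∀ v ∈ degreeFiltration X W d, X j • v ∈ S) :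
    ∀ v ∈ degreeFiltration X W (d + 1), v ∈ S := by
  change degreeFiltration X W (d + 1) ≤ S
  refine sup_le (show degreeFiltration X W d ≤ S from h1) (iSup_le fun j => ?_)
  rintro _ ⟨v, hv, rfl⟩
  exact h2 j v hv

theorem finite_degreeFiltration (X : Fin n → A) (W : Submodule K M) [Module.Finite K W] (d : ℕ) :
    Module.Finite K (degreeFiltration X W d) := by
  induction d with
  | zero => assumption
  | succ d ih =>
    have : ∀ j, Module.Finite K ((degreeFiltration X W d).map (Algebra.lsmul K K M (X j))) :=
      fun j => inferInstance
    rw [degreeFiltration]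
    infer_instance

namespace IsDahaFamily

theorem inv_smul_mem (D : IsDahaFamily q t T T' θ X p) {W : Submodule K M}
    {i : Fin (n - 1)} {v : M} (hv : v ∈ W) (h : T i • v ∈ W) : T' i • v ∈ W := by
  have : t • T' i • v = T i • v + (t - 1) • v := by
    rw [← smul_assoc, D.smul_inv, add_smul, smul_assoc, one_smul]
  rw [← inv_smul_smul₀ D.t_ne (T' i • v), this]
  exact W.smul_mem _ (W.add_mem h (W.smul_mem _ hv))

theorem exists_prod_smul_eq (D : IsDahaFamily q t T T' θ X p) {W : Submodule K M}
    (hT : ∀ i, ∀ v ∈ W, T i • v ∈ W) {v : M} (hv : v ∈ W) :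
    ∃ w ∈ W, (List.ofFn T').prod • w = v := by
  have : ∀ l : List (Fin (n - 1)), ∀ v ∈ W, ∃ w ∈ W, (l.map T').prod • w = v := by
    intro l
    induction l with
    | nil => exact fun v hv => ⟨v, hv, by simp⟩
    | cons i l ih =>
      intro v hv
      obtain ⟨w, hw, h⟩ := ih _ (hT i v hv)
      refine ⟨w, hw, ?_⟩
      rw [List.map_cons, List.prod_cons, mul_smul, h, smul_smul, D.inv_mul, one_smul]
  rw [List.ofFn_eq_map]
  exact this _ v hv

variable {W : Submodule K M}

theorem T_smul_mem (D : IsDahaFamily q t T T' θ X p) (hT : ∀ i, ∀ v ∈ W, T i • v ∈ W) (d : ℕ)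
    (i : Fin (n - 1)) (v : M) (hv : v ∈ degreeFiltration X W d) :
    T i • v ∈ degreeFiltration X W d := by
  induction d generalizing i v with
  | zero => exact hT i v hv
  | succ d ih =>
    have key := degreeFiltration_succ_le (X := X) (W := W) (d := d)
      (S := (degreeFiltration X W (d + 1)).comap (Algebra.lsmul K K M (T i)))
    refine key (fun v hv => ?_) (fun j v hv => ?_) v hv
    · exact degreeFiltration_le_succ X W d (ih i v hv)
    · change T i • X j • v ∈ degreeFiltration X W (d + 1)
      rw [smul_smul]
      by_cases h1 : j = lo i
      · subst h1
        have e : T i * X (lo i) = X (hi i) * T i - (t - 1) • X (lo i) := by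
          rw [D.X_mul_T, ← smul_mul_assoc, D.smul_inv, add_mul, smul_mul_assoc, one_mul,
            add_sub_cancel_right]
        rw [e, sub_smul, mul_smul, smul_assoc]
        exact Submodule.sub_mem _ (X_smul_mem_degreeFiltration _ (ih i v hv))
          (Submodule.smul_mem _ _ (X_smul_mem_degreeFiltration _ hv))
      · by_cases h2 : j = hi i
        · subst h2
          rw [D.T_mul_X, smul_assoc, mul_smul]
          exact Submodule.smul_mem _ _ (X_smul_mem_degreeFiltration _
            (D.inv_smul_mem hv (ih i v hv)))
        · rw [(D.X_far i j h1 h2).eq, mul_smul]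
          exact X_smul_mem_degreeFiltration _ (ih i v hv)

/-- The relations π X_i = X_{i+1} π and π X_n = q X_1 π lift preimages under π from one degree to
the next. On W, θ_1 is the identity and π is a scalar times a product of the T_i⁻¹, under whose
inverses W is stable. -/
theorem exists_pi_smul_eq (D : IsDahaFamily q t T T' θ X p) (hq : q ≠ 0) (hn : 0 < n)
    (hT : ∀ i, ∀ v ∈ W, T i • v ∈ W) (hθ : ∀ v ∈ W, θ ⟨0, hn⟩ • v = v) (d : ℕ)
    (v : M) (hv : v ∈ degreeFiltration X W d) : ∃ w ∈ degreeFiltration X W d, p • w = v := by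
  induction d generalizing v with
  | zero =>
    obtain ⟨w, hw, h⟩ := D.exists_prod_smul_eq hT hv
    refine ⟨(t ^ (n - 1))⁻¹ • w, Submodule.smul_mem _ _ hw, ?_⟩
    rw [D.pi_eq hn, smul_assoc, smul_smul_comm_of_tower, smul_inv_smul₀ (pow_ne_zero _ D.t_ne),
      mul_smul, h, hθ v hv]
  | succ d ih =>
    have key := degreeFiltration_succ_le (X := X) (W := W) (d := d)
      (S := (degreeFiltration X W (d + 1)).map (Algebra.lsmul K K M p))
    refine key (fun v hv => ?_) (fun j v hv => ?_) v hv
    · obtain ⟨w, hw, h⟩ := ih v hv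
      exact ⟨w, degreeFiltration_le_succ X W d hw, h⟩
    · obtain ⟨w, hw, rfl⟩ := ih v hv
      by_cases hj : j.1 = 0
      · obtain rfl : j = ⟨0, hn⟩ := Fin.ext hj
        refine ⟨q⁻¹ • X ⟨n - 1, by omega⟩ • w,
          Submodule.smul_mem _ _ (X_smul_mem_degreeFiltration _ hw), ?_⟩
        change p • (q⁻¹ • X ⟨n - 1, by omega⟩ • w) = _
        rw [smul_smul_comm_of_tower, smul_smul p, D.pi_X_last hn, smul_assoc, inv_smul_smul₀ hq,
          mul_smul]
      · have e : j = hi ⟨j.1 - 1, by omega⟩ := Fin.ext (by simp only [hi]; omega)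
        rw [e]
        refine ⟨X (lo ⟨j.1 - 1, by omega⟩) • w, X_smul_mem_degreeFiltration _ hw, ?_⟩
        change p • (X (lo ⟨j.1 - 1, by omega⟩) • w) = _
        rw [smul_smul, D.pi_X, mul_smul]

variable [Module.Finite K W]

/-- The piece lies in its image under π, whose dimension is no larger. Stability under π is thus a
consequence of surjectivity. -/
theorem map_pi_degreeFiltration (D : IsDahaFamily q t T T' θ X p) (hq : q ≠ 0) (hn : 0 < n)
    (hT : ∀ i, ∀ v ∈ W, T i • v ∈ W) (hθ : ∀ v ∈ W, θ ⟨0, hn⟩ • v = v) (d : ℕ) :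
    (degreeFiltration X W d).map (Algebra.lsmul K K M p) = degreeFiltration X W d := by
  have := finite_degreeFiltration X W d
  exact (Submodule.eq_of_le_of_finrank_le
    (fun v hv => D.exists_pi_smul_eq hq hn hT hθ d v hv) (Submodule.finrank_map_le _ _)).symm

theorem pi_smul_mem (D : IsDahaFamily q t T T' θ X p) (hq : q ≠ 0) (hn : 0 < n)
    (hT : ∀ i, ∀ v ∈ W, T i • v ∈ W) (hθ : ∀ v ∈ W, θ ⟨0, hn⟩ • v = v) (d : ℕ)
    (v : M) (hv : v ∈ degreeFiltration X W d) : p • v ∈ degreeFiltration X W d := by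
  rw [← D.map_pi_degreeFiltration hq hn hT hθ d]
  exact ⟨v, hv, rfl⟩

/-- Up to a scalar θ_1 is π T_{n-1} ⋯ T_1, and the other θ_j come from θ_1 through the T_i⁻¹. -/
theorem theta_smul_mem (D : IsDahaFamily q t T T' θ X p) (hq : q ≠ 0) (hn : 0 < n)
    (hT : ∀ i, ∀ v ∈ W, T i • v ∈ W) (hθ : ∀ v ∈ W, θ ⟨0, hn⟩ • v = v) (d : ℕ) (j : Fin n)
    (v : M) (hv : v ∈ degreeFiltration X W d) : θ j • v ∈ degreeFiltration X W d := by
  obtain ⟨k, hk⟩ := j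
  have hT' := D.T_smul_mem hT d
  induction k generalizing v with
  | zero =>
    obtain ⟨w, hw, rfl⟩ := D.exists_prod_smul_eq hT' hv
    have h1 := D.pi_smul_mem hq hn hT hθ d w hw
    rw [D.pi_eq hn, smul_assoc, mul_smul] at h1
    have h2 := Submodule.smul_mem _ (t ^ (n - 1))⁻¹ h1
    rwa [inv_smul_smul₀ (pow_ne_zero _ D.t_ne)] at h2
  | succ k ih =>
    have hk' : k < n - 1 := by omega
    have e : (⟨k + 1, hk⟩ : Fin n) = hi ⟨k, hk'⟩ := rfl
    rw [e, D.theta_succ, smul_assoc, mul_smul, mul_smul]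
    have hi' : ∀ v ∈ degreeFiltration X W d, T' ⟨k, hk'⟩ • v ∈ degreeFiltration X W d :=
      fun v hv => D.inv_smul_mem hv (hT' _ v hv)
    exact Submodule.smul_mem _ _ (hi' _ (ih _ (hi' v hv) (by omega)))

/-- On each finite-dimensional piece π is surjective, hence injective, and the pieces exhaust the
module. -/
theorem isUnit_pi (D : IsDahaFamily q t T T' θ X p) (hq : q ≠ 0) (hn : 0 < n)
    (hT : ∀ i, ∀ v ∈ W, T i • v ∈ W) (hθ : ∀ v ∈ W, θ ⟨0, hn⟩ • v = v)
    (htop : ∀ v : M, ∃ d, v ∈ degreeFiltration X W d) : IsUnit (Algebra.lsmul K K M p) := by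
  rw [Module.End.isUnit_iff]
  constructor
  · rw [← LinearMap.ker_eq_bot, LinearMap.ker_eq_bot']
    intro v hv
    obtain ⟨d, hd⟩ := htop v
    have := finite_degreeFiltration X W d
    let f : degreeFiltration X W d →ₗ[K] degreeFiltration X W d :=
      (Algebra.lsmul K K M p).restrict fun v hv => D.pi_smul_mem hq hn hT hθ d v hv
    have hf : Function.Surjective f := by
      rintro ⟨v, hv⟩
      obtain ⟨w, hw, h⟩ := D.exists_pi_smul_eq hq hn hT hθ d v hv
      exact ⟨⟨w, hw⟩, Subtype.ext h⟩
    have hinj := LinearMap.injective_iff_surjective.2 hf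
    have h0 : f ⟨v, hd⟩ = f 0 := by
      rw [map_zero]
      exact Subtype.ext hv
    exact congrArg Subtype.val (hinj h0)
  · intro v
    obtain ⟨d, hd⟩ := htop v
    obtain ⟨w, _, h⟩ := D.exists_pi_smul_eq hq hn hT hθ d v hd
    exact ⟨w, h⟩

end IsDahaFamily

end DegreeFiltration

/-- The span of the vectors `1 ⊗ τ`. -/
def V.base (μ : YoungDiagram) : Submodule QT (V μ) := Submodule.span QT (Set.range V.vec)

instance : Module.Finite QT (V.base μ) := Module.Finite.span_of_finite QT (Set.finite_range _)

theorem smul_mem_of_intertwiner_smul {K A M : Type*} [Field K] [Ring A] [Algebra K A] [AddCommGroup M]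
    [Module K M] [Module A M] [IsScalarTower K A M] {W : Submodule K M} {t a b : K} {x y : A}
    (h : t • y = x + (t - 1) • (1 : A)) {v v' : M} (hv : v ∈ W) (hv' : v' ∈ W)
    (he : intertwiner t y a b • v = v') : x • v ∈ W := by
  have h1 := congrArg (· • v) h
  simp only [add_smul, smul_assoc, one_smul] at h1
  rw [intertwiner_smul, h1] at he
  have : x • v = v' - ((t - 1) * b / (a - b)) • v - (t - 1) • v := by
    rw [← he]; abel
  rw [this]
  exact W.sub_mem (W.sub_mem hv' (W.smul_mem _ hv)) (W.smul_mem _ hv)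

/-- If s_i(τ) > τ, the intertwiner expresses T_i τ through τ and s_i(τ), and the T_i-invariant
combination of the two then yields T_i s_i(τ). -/
theorem V.T_smul_mem_base (i : Fin (μ.card - 1)) (v : V μ) (hv : v ∈ V.base μ) :
    (Daha.T i : Daha μ.card) • v ∈ V.base μ := by
  have hn : 0 < μ.card := by have := i.2; omega
  have D := Daha.isDahaFamily hn
  have hvec : ∀ τ : SYT μ, V.vec τ ∈ V.base μ := fun τ => Submodule.subset_span ⟨τ, rfl⟩
  have hup : ∀ τ τ' : SYT μ, PSYT.IsSwap i τ.1 τ'.1 → 1 < τ.1.c (lo i) - τ.1.c (hi i) →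
      (Daha.T i : Daha μ.card) • V.vec τ ∈ V.base μ ∧
        (Daha.T i : Daha μ.card) • V.vec τ' ∈ V.base μ := by
    intro τ τ' hs hc
    have e := V.intertwiner_smul_vec i τ τ' hs hc
    have h1 := smul_mem_of_intertwiner_smul (smul_heckeInv _) (hvec τ) (hvec τ') e
    refine ⟨h1, ?_⟩
    have hab : t ^ τ.1.c (lo i) ≠ t ^ τ.1.c (hi i) := by
      intro e
      have := qt_monomial_injective (a := 0) (a' := 0) (c := τ.1.c (lo i)) (c' := τ.1.c (hi i))
        (by rw [pow_zero, one_mul, one_mul]; exact e)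
      omega
    have h2 := smul_add_intertwiner_smul hab (D.smul_inv i) (D.mul_inv i) (V.vec τ) 1
    rw [e, smul_add, smul_smul_comm_of_tower, one_smul] at h2
    rw [eq_sub_of_add_eq' h2]
    exact Submodule.sub_mem _ (Submodule.add_mem _ (Submodule.smul_mem _ _ (hvec τ)) (hvec τ'))
      (Submodule.smul_mem _ _ h1)
  have key : V.base μ ≤ (V.base μ).comap (Algebra.lsmul QT QT (V μ) (Daha.T i)) := by
    refine Submodule.span_le.2 ?_
    rintro _ ⟨τ, rfl⟩
    change (Daha.T i : Daha μ.card) • V.vec τ ∈ V.base μ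
    rcases τ.1.exists_swap_or_adjacent i with ⟨σ, h⟩ | ⟨_, h | h⟩
    · have hσ : ∀ x, (σ.label x).2 = 0 := fun x => by rw [h]; exact τ.2 x
      have hw : ∀ j, τ.1.w j = 0 := fun j => τ.2 _
      rcases h.one_lt_abs (by rw [hw, hw]) with hc | hc
      · exact (hup τ ⟨σ, hσ⟩ h hc).1
      · refine (hup ⟨σ, hσ⟩ τ h.symm ?_).2
        simp only
        rwa [h.c_eq, h.c_eq, adjSwap_lo, adjSwap_hi]
    · rw [V.T_smul_vec_row i τ h.1]
      exact hvec τ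
    · rw [V.T_smul_vec_col i τ h.1]
      exact Submodule.smul_mem _ _ (hvec τ)
  exact key hv

theorem Daha.induction {n : ℕ} {P : Daha n → Prop} (hK : ∀ k, P (algebraMap QT _ k))
    (hT : ∀ i, P (Daha.T i)) (hθ : ∀ i, P (Daha.θ i)) (hX : ∀ i, P (Daha.X i))
    (hmul : ∀ x y, P x → P y → P (x * y)) (hadd : ∀ x y, P x → P y → P (x + y)) (x : Daha n) :
    P x := by
  obtain ⟨a, rfl⟩ : ∃ a, Daha.mk n a = x := RingQuot.mkAlgHom_surjective QT (DahaRel n) x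
  induction a using FreeAlgebra.induction with
  | grade0 r => rw [AlgHom.commutes]; exact hK r
  | grade1 g =>
    cases g with
    | T i => exact hT i
    | θ i => exact hθ i
    | X i => exact hX i
  | mul a b ha hb => rw [map_mul]; exact hmul _ _ ha hb
  | add a b ha hb => rw [map_add]; exact hadd _ _ ha hb

theorem rho_heckeToAff {n : ℕ} (h : Hecke n) : rho n (heckeToAff n h) = h := by
  obtain ⟨a, rfl⟩ : ∃ a, Hecke.mk n a = h := RingQuot.mkAlgHom_surjective QT (HeckeRel n) h
  rw [← Aff.mk_hecke, rho_mk]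
  induction a using FreeAlgebra.induction with
  | grade0 r => rw [AlgHom.commutes, AlgHom.commutes, AlgHom.commutes]
  | grade1 g => simp [freeHA, freeRho, Hecke.T]
  | mul a b ha hb => rw [map_mul, map_mul, map_mul, ha, hb]
  | add a b ha hb => rw [map_add, map_add, map_add, ha, hb]

/-- A subset of `V_λ` closed under addition and the action of `D_n` that contains the `1 ⊗ τ` is
everything. -/
theorem V.induction {P : V μ → Prop} (h0 : P 0) (hadd : ∀ v w, P v → P w → P (v + w))
    (hsmul : ∀ (x : Daha μ.card) v, P v → P (x • v)) (hvec : ∀ τ, P (V.vec τ)) (v : V μ) : P v := by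
  obtain ⟨z, rfl⟩ := Submodule.Quotient.mk_surjective (indRel (affToDaha μ.card) (RhoSpecht μ)) v
  have h1 : ∀ m : RhoSpecht μ, P (Ind.one_tmul (affToDaha μ.card) (RhoSpecht μ) m) := by
    intro m
    obtain ⟨f, rfl⟩ := Submodule.Quotient.mk_surjective
      (Submodule.span (Hecke μ.card) {r | SpechtRel μ r}) m
    induction f using Finsupp.induction_linear with
    | zero =>
      have := Ind.one_tmul_smul (affToDaha μ.card) (RhoSpecht μ) 0 0
      rw [zero_smul, zero_smul] at this
      rw [← this] at h0
      exact h0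
    | add f g hf hg =>
      exact (congrArg P (Ind.one_tmul_add (affToDaha μ.card) (RhoSpecht μ) _ _)).mpr
        (hadd _ _ hf hg)
    | single τ h =>
      have := hsmul (affToDaha μ.card (heckeToAff μ.card h)) _ (hvec τ)
      rw [V.smul_vec] at this
      have e := rho_heckeToAff h
      rw [e, Specht.smul_vec] at this
      exact this
  induction z using TensorProduct.induction_on with
  | zero => exact h0
  | add a b ha hb => exact hadd _ _ ha hb
  | tmul d m =>
    have e : d • Ind.one_tmul (affToDaha μ.card) (RhoSpecht μ) m =
        Submodule.Quotient.mk (d ⊗ₜ[QT] m) := by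
      refine (Submodule.Quotient.mk_smul (indRel (affToDaha μ.card) (RhoSpecht μ))
        (r := d) (x := (1 : Daha μ.card) ⊗ₜ[QT] m)).symm.trans ?_
      rw [TensorProduct.smul_tmul', smul_eq_mul, mul_one]
    exact (congrArg P e).mp (hsmul d _ (h1 m))

/-- The union of the filtration contains the vectors 1 ⊗ τ and is stable under all generators of
D_n; no basis of V_λ is needed. -/
theorem V.exists_mem_degreeFiltration (hn : 0 < μ.card) (v : V μ) :
    ∃ d, v ∈ degreeFiltration (Daha.X : Fin μ.card → Daha μ.card) (V.base μ) d := by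
  have D := Daha.isDahaFamily hn
  have hT := V.T_smul_mem_base (μ := μ)
  have hθ : ∀ v ∈ V.base μ, (Daha.θ ⟨0, hn⟩ : Daha μ.card) • v = v := by
    intro v hv
    induction hv using Submodule.span_induction with
    | mem v hv => obtain ⟨τ, rfl⟩ := hv; exact V.theta_zero_smul_vec hn τ
    | zero => rw [smul_zero]
    | add v w _ _ h1 h2 => rw [smul_add, h1, h2]
    | smul k v _ h => rw [smul_smul_comm_of_tower, h]
  have hmono := degreeFiltration_mono (Daha.X : Fin μ.card → Daha μ.card) (V.base μ)
  refine V.induction (P := fun v => ∃ d, v ∈ degreeFiltration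
    (Daha.X : Fin μ.card → Daha μ.card) (V.base μ) d) ⟨0, Submodule.zero_mem _⟩ ?_ ?_ (fun τ => ⟨0, Submodule.subset_span ⟨τ, rfl⟩⟩) v
  · rintro v w ⟨d, hd⟩ ⟨e, he⟩
    exact ⟨max d e, Submodule.add_mem _ (hmono (le_max_left d e) hd) (hmono (le_max_right d e) he)⟩
  · intro x
    refine Daha.induction (P := fun x : Daha μ.card => ∀ v : V μ,
      (∃ d, v ∈ degreeFiltration (Daha.X : Fin μ.card → Daha μ.card) (V.base μ) d) →
      ∃ d, x • v ∈ degreeFiltration (Daha.X : Fin μ.card → Daha μ.card) (V.base μ) d)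
      ?_ ?_ ?_ ?_ ?_ ?_ x
    · rintro k v ⟨d, hd⟩
      exact ⟨d, by rw [algebraMap_smul]; exact Submodule.smul_mem _ _ hd⟩
    · rintro i v ⟨d, hd⟩
      exact ⟨d, D.T_smul_mem hT d i v hd⟩
    · rintro i v ⟨d, hd⟩
      exact ⟨d, D.theta_smul_mem q_ne_zero hn hT hθ d i v hd⟩
    · rintro i v ⟨d, hd⟩
      exact ⟨d + 1, X_smul_mem_degreeFiltration i hd⟩
    · intro x y hx hy v hv
      rw [mul_smul]
      exact hx _ (hy v hv)
    · intro x y hx hy v hv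
      obtain ⟨d, hd⟩ := hx v hv
      obtain ⟨e, he⟩ := hy v hv
      refine ⟨max d e, ?_⟩
      rw [add_smul]
      exact Submodule.add_mem _ (hmono (le_max_left d e) hd) (hmono (le_max_right d e) he)

/-- `π_n` acts invertibly on `V_λ`. -/
theorem V.isUnit_pi (hn : 0 < μ.card) :
    IsUnit (Algebra.lsmul QT QT (V μ) (Daha.pi hn : Daha μ.card)) := by
  have hθ : ∀ v ∈ V.base μ, (Daha.θ ⟨0, hn⟩ : Daha μ.card) • v = v := by
    intro v hv
    induction hv using Submodule.span_induction with
    | mem v hv => obtain ⟨τ, rfl⟩ := hv; exact V.theta_zero_smul_vec hn τ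
    | zero => rw [smul_zero]
    | add v w _ _ h1 h2 => rw [smul_add, h1, h2]
    | smul k v _ h => rw [smul_smul_comm_of_tower, h]
  exact (Daha.isDahaFamily hn).isUnit_pi (W := V.base μ) q_ne_zero hn V.T_smul_mem_base hθ
    (V.exists_mem_degreeFiltration hn)

end VVMac
end

noncomputable section
namespace VVMac
variable {μ : YoungDiagram}

/-! ## The operator `X_n π_n⁻¹` -/

/-- The operator `X_n π_n⁻¹` on `V_λ`. -/
def V.Phi (hn : 0 < μ.card) : Module.End QT (V μ) :=
  Algebra.lsmul QT QT (V μ) (Daha.X ⟨μ.card - 1, by omega⟩ : Daha μ.card) * piInv μ hn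

theorem V.isDahaFamily (hn : 0 < μ.card) : IsDahaFamily q t
    (fun i => Algebra.lsmul QT QT (V μ) (Daha.T i : Daha μ.card))
    (fun i => Algebra.lsmul QT QT (V μ) (heckeInv (Daha.T i) : Daha μ.card))
    (fun i => Algebra.lsmul QT QT (V μ) (Daha.θ i : Daha μ.card))
    (fun i => Algebra.lsmul QT QT (V μ) (Daha.X i : Daha μ.card))
    (Algebra.lsmul QT QT (V μ) (Daha.pi hn : Daha μ.card)) :=
  (Daha.isDahaFamily hn).map (Algebra.lsmul QT QT (V μ))

theorem V.pi_mul_piInv (hn : 0 < μ.card) :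
    Algebra.lsmul QT QT (V μ) (Daha.pi hn : Daha μ.card) * piInv μ hn = 1 :=
  Ring.mul_inverse_cancel _ (V.isUnit_pi hn)

theorem V.piInv_mul_pi (hn : 0 < μ.card) :
    piInv μ hn * Algebra.lsmul QT QT (V μ) (Daha.pi hn : Daha μ.card) = 1 :=
  Ring.inverse_mul_cancel _ (V.isUnit_pi hn)

theorem V.Phi_T (hn : 0 < μ.card) (i j : Fin (μ.card - 1)) (h : i.1 + 1 = j.1) (v : V μ) :
    V.Phi hn ((Daha.T j : Daha μ.card) • v) = (Daha.T i : Daha μ.card) • V.Phi hn v :=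
  LinearMap.congr_fun ((V.isDahaFamily hn).Phi_mul_T (V.pi_mul_piInv hn) (V.piInv_mul_pi hn) i j h
    ⟨μ.card - 1, by omega⟩ (by simp only; omega)) v

theorem V.Phi_Phi_T (hn : 0 < μ.card) (i j : Fin (μ.card - 1)) (h : i.1 = 0)
    (h' : j.1 + 1 = μ.card - 1) (v : V μ) : V.Phi hn (V.Phi hn ((Daha.T i : Daha μ.card) • v)) =
      (Daha.T j : Daha μ.card) • V.Phi hn (V.Phi hn v) := by
  have e := (V.isDahaFamily hn).Phi_sq_mul_T (V.pi_mul_piInv hn) (V.piInv_mul_pi hn) i j h h'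
  have e2 : hi j = ⟨μ.card - 1, by omega⟩ := Fin.ext h'
  rw [e2] at e
  exact LinearMap.congr_fun e v

theorem V.theta_Phi (hn : 0 < μ.card) (i : Fin (μ.card - 1)) (v : V μ) :
    (Daha.θ (lo i) : Daha μ.card) • V.Phi hn v = V.Phi hn ((Daha.θ (hi i) : Daha μ.card) • v) :=
  LinearMap.congr_fun ((V.isDahaFamily hn).theta_mul_Phi (V.pi_mul_piInv hn) (V.piInv_mul_pi hn) i
    ⟨μ.card - 1, by omega⟩ (by simp only; omega)) v

theorem V.theta_last_Phi (hn : 0 < μ.card) (v : V μ) :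
    (Daha.θ ⟨μ.card - 1, by omega⟩ : Daha μ.card) • V.Phi hn v =
      q • V.Phi hn ((Daha.θ ⟨0, hn⟩ : Daha μ.card) • v) :=
  LinearMap.congr_fun ((V.isDahaFamily hn).theta_last_mul_Phi (V.pi_mul_piInv hn)
    (V.piInv_mul_pi hn) hn) v

/-- The intertwiner `t T_i⁻¹ + (t - 1) b / (a - b)` in `D_n`. -/
def Daha.phi {n : ℕ} (i : Fin (n - 1)) (a b : QT) : Daha n :=
  intertwiner t (heckeInv (Daha.T i)) a b

theorem Daha.phi_smul (i : Fin (μ.card - 1)) (a b : QT) (v : V μ) :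
    (Daha.phi i a b : Daha μ.card) • v =
      (Daha.T i : Daha μ.card) • v + ((t - 1) + (t - 1) * b / (a - b)) • v := by
  rw [Daha.phi, intertwiner, smul_heckeInv, add_smul, add_smul, smul_assoc, smul_assoc, one_smul,
    add_assoc, ← add_smul]

theorem V.Phi_phi (hn : 0 < μ.card) (i j : Fin (μ.card - 1)) (h : i.1 + 1 = j.1) (a b : QT)
    (v : V μ) : V.Phi hn ((Daha.phi j a b : Daha μ.card) • v) =
      (Daha.phi i a b : Daha μ.card) • V.Phi hn v := by
  rw [Daha.phi_smul, Daha.phi_smul, map_add, V.Phi_T hn i j h, map_smul]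

theorem V.Phi_Phi_phi (hn : 0 < μ.card) (i j : Fin (μ.card - 1)) (h : i.1 = 0)
    (h' : j.1 + 1 = μ.card - 1) (a b : QT) (v : V μ) :
    V.Phi hn (V.Phi hn ((Daha.phi i a b : Daha μ.card) • v)) =
      (Daha.phi j a b : Daha μ.card) • V.Phi hn (V.Phi hn v) := by
  rw [Daha.phi_smul, Daha.phi_smul, map_add, map_add, V.Phi_Phi_T hn i j h h', map_smul, map_smul]

/-! ## The recursion for `F_τ` -/

theorem nonsymF_of_lastPos_eq_zero (τ : PSYT μ) (h : τ.lastPos = 0) :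
    nonsymF τ = V.vec ⟨τ, τ.label_snd_eq_zero h⟩ := by
  rw [nonsymF, dif_pos h]

theorem nonsymF_of_lastPos_eq_card (τ : PSYT μ) (hn : 0 < μ.card) (h : τ.lastPos = μ.card) :
    nonsymF τ = q ^ (τ.PsiInv fun i hi => τ.w_pos i (hi.trans h.symm)).w ⟨0, hn⟩ •
      V.Phi hn (nonsymF (τ.PsiInv fun i hi => τ.w_pos i (hi.trans h.symm))) := by
  rw [nonsymF, dif_neg (by omega), dif_pos h]
  rfl

theorem nonsymF_of_lastPos (τ : PSYT μ) (i : Fin (μ.card - 1)) (h : i.1 + 1 = τ.lastPos) :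
    nonsymF τ = (Daha.phi i ((τ.swapOfNe i (τ.w_ne i h)).weight (lo i))
      ((τ.swapOfNe i (τ.w_ne i h)).weight (hi i)) : Daha μ.card) •
        nonsymF (τ.swapOfNe i (τ.w_ne i h)) := by
  have e : ∀ (j : Fin (μ.card - 1)) (hj : j.1 + 1 = τ.lastPos), j = i := fun j hj =>
    Fin.ext (by omega)
  rw [nonsymF, dif_neg (by omega), dif_neg (by have := i.2; omega)]
  have key : ∀ (j : Fin (μ.card - 1)) (hj : j.1 + 1 = τ.lastPos),
      (t • heckeInv (Daha.T j : Daha μ.card)) • nonsymF (τ.swapOfNe j (τ.w_ne j hj)) +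
        ((t - 1) * (τ.swapOfNe j (τ.w_ne j hj)).weight (hi j) /
          ((τ.swapOfNe j (τ.w_ne j hj)).weight (lo j) -
            (τ.swapOfNe j (τ.w_ne j hj)).weight (hi j))) • nonsymF (τ.swapOfNe j (τ.w_ne j hj)) =
      (Daha.phi i ((τ.swapOfNe i (τ.w_ne i h)).weight (lo i))
        ((τ.swapOfNe i (τ.w_ne i h)).weight (hi i)) : Daha μ.card) •
          nonsymF (τ.swapOfNe i (τ.w_ne i h)) := by
    intro j hj
    obtain rfl := e j hj
    rw [Daha.phi, intertwiner_smul, smul_assoc]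
  exact key ⟨τ.lastPos - 1, _⟩ (by simp only; omega)

/-- `F_τ` as a function of the boxes and the exponents of the indices, extended by zero. -/
def Fhat (f : Fin μ.card → Box μ) (w : Fin μ.card → ℕ) : V μ :=
  open Classical in if h : ∃ τ : PSYT μ, τ.box = f ∧ τ.w = w then nonsymF h.choose else 0

/-- The functions `f`, `w` come from a periodic standard Young tableau. -/
def Valid (f : Fin μ.card → Box μ) (w : Fin μ.card → ℕ) : Prop :=
  ∃ τ : PSYT μ, τ.box = f ∧ τ.w = w

theorem Fhat_eq {f : Fin μ.card → Box μ} {w : Fin μ.card → ℕ} (τ : PSYT μ) (hf : τ.box = f)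
    (hw : τ.w = w) : Fhat f w = nonsymF τ := by
  have h : ∃ τ : PSYT μ, τ.box = f ∧ τ.w = w := ⟨τ, hf, hw⟩
  rw [Fhat, dif_pos h]
  congr 1
  exact PSYT.ext_box (h.choose_spec.1.trans hf.symm) (h.choose_spec.2.trans hw.symm)

theorem Fhat_eq_zero {f : Fin μ.card → Box μ} {w : Fin μ.card → ℕ} (h : ¬ Valid f w) :
    Fhat f w = 0 := dif_neg h

/-- The weight of the index `j`. -/
def wt (f : Fin μ.card → Box μ) (w : Fin μ.card → ℕ) (j : Fin μ.card) : QT :=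
  q ^ w j * t ^ content (f j)

theorem comp_adjSwap_comp_adjSwap {n : ℕ} {α : Type*} (f : Fin n → α) (i : Fin (n - 1)) :
    (f ∘ adjSwap i) ∘ adjSwap i = f := by
  funext j
  simp [adjSwap_adjSwap]

/-- The exchange affects only the comparison of i with i+1, and labels with different exponents are
compared by exponents alone. -/
theorem Valid.swap {f : Fin μ.card → Box μ} {w : Fin μ.card → ℕ} (h : Valid f w)
    (i : Fin (μ.card - 1)) (hw : w (lo i) ≠ w (hi i)) : Valid (f ∘ adjSwap i) (w ∘ adjSwap i) := by
  obtain ⟨τ, rfl, rfl⟩ := h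
  have hs := τ.isSwap_swapOfNe i hw
  exact ⟨_, funext hs.box_eq, funext hs.w_eq⟩

theorem valid_swap_iff {f : Fin μ.card → Box μ} {w : Fin μ.card → ℕ}
    (i : Fin (μ.card - 1)) (hw : w (lo i) ≠ w (hi i)) :
    Valid (f ∘ adjSwap i) (w ∘ adjSwap i) ↔ Valid f w := by
  refine ⟨fun h => ?_, fun h => h.swap i hw⟩
  have := h.swap i (by simpa [adjSwap_lo, adjSwap_hi] using hw.symm)
  rwa [comp_adjSwap_comp_adjSwap, comp_adjSwap_comp_adjSwap] at this

/-- If the last positive exponent moves one step to the right, `F` changes by an intertwiner. -/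
theorem Fhat_swap_last (f : Fin μ.card → Box μ) (w : Fin μ.card → ℕ) (i : Fin (μ.card - 1))
    (h0 : w (lo i) = 0) (h1 : 0 < w (hi i)) (h2 : ∀ j, hi i < j → w j = 0) :
    Fhat (f ∘ adjSwap i) (w ∘ adjSwap i) =
      (Daha.phi i (wt f w (lo i)) (wt f w (hi i)) : Daha μ.card) • Fhat f w := by
  have hw : w (lo i) ≠ w (hi i) := by omega
  by_cases hv : Valid f w
  · obtain ⟨τ, h3, h4⟩ := hv.swap i hw
    -- After the exchange i is the last index with positive exponent, so this very exchange is the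
    -- one in the recursion for `nonsymF τ`.
    have e1 : i.1 + 1 = τ.lastPos := by
      apply le_antisymm
      · refine τ.le_lastPos (lo i) ?_
        rw [h4, Function.comp, adjSwap_lo]
        exact h1
      · refine Finset.sup_le fun j hj => ?_
        by_contra hlt
        simp only [Finset.mem_filter, Finset.mem_univ, true_and, h4, Function.comp] at hj
        by_cases h5 : j = hi i
        · rw [h5, adjSwap_hi, h0] at hj
          exact absurd hj (lt_irrefl 0)
        · have h6 : i.1 + 1 < j.1 := by
            have : j.1 ≠ i.1 + 1 := fun h => h5 (Fin.ext h)
            omega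
          rw [adjSwap_of_ne i (fun h => by rw [h] at h6; simp only [lo] at h6; omega) h5,
            h2 j h6] at hj
          exact absurd hj (lt_irrefl 0)
    have hs := τ.isSwap_swapOfNe i (τ.w_ne i e1)
    have e2 : (τ.swapOfNe i (τ.w_ne i e1)).box = f := by
      funext j
      rw [hs.box_eq, h3, Function.comp, adjSwap_adjSwap]
    have e3 : (τ.swapOfNe i (τ.w_ne i e1)).w = w := by
      funext j
      rw [hs.w_eq, h4, Function.comp, adjSwap_adjSwap]
    rw [Fhat_eq τ h3 h4, Fhat_eq _ e2 e3, nonsymF_of_lastPos τ i e1]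
    unfold PSYT.weight PSYT.c wt
    rw [e2, e3]
  · rw [Fhat_eq_zero hv, Fhat_eq_zero (mt (valid_swap_iff i hw).1 hv), smul_zero]

/-- The cyclic successor of an index. -/
def next {n : ℕ} (j : Fin n) : Fin n :=
  if h : j.1 + 1 < n then ⟨j.1 + 1, h⟩ else ⟨0, by have := j.2; omega⟩

theorem next_val {n : ℕ} (j : Fin n) : (next j).1 = if j.1 + 1 < n then j.1 + 1 else 0 := by
  unfold next
  split_ifs <;> rfl

theorem next_injective {n : ℕ} : Function.Injective (next (n := n)) := by
  intro a b h
  have := congrArg Fin.val h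
  simp only [next_val] at this
  apply Fin.ext
  split_ifs at this <;> omega

theorem next_bijective {n : ℕ} : Function.Bijective (next (n := n)) :=
  Finite.injective_iff_bijective.1 next_injective

/-- The exponents of `Ψ(τ)`. -/
def rotw {n : ℕ} (w : Fin n → ℕ) (j : Fin n) : ℕ :=
  if j.1 + 1 < n then w (next j) else w (next j) + 1

theorem Psi_box (τ : PSYT μ) : τ.Psi.box = τ.box ∘ next := by
  funext j
  rw [PSYT.box_eq_iff]
  change (PSYT.rotate (τ.label (τ.box (next j)))).1 = j
  rw [PSYT.label_box_eq]
  have := next_val j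
  unfold PSYT.rotate
  apply Fin.ext
  simp only
  split_ifs at this ⊢ <;> simp <;> omega

theorem Psi_w (τ : PSYT μ) : τ.Psi.w = rotw τ.w := by
  funext j
  rw [PSYT.w, Psi_box]
  change (PSYT.rotate (τ.label (τ.box (next j)))).2 = _
  rw [PSYT.label_box_eq]
  have := next_val j
  unfold PSYT.rotate rotw
  simp only
  split_ifs at this ⊢ <;> first | rfl | omega

theorem rotw_injective {n : ℕ} : Function.Injective (rotw (n := n)) := by
  intro w w' h
  funext j
  obtain ⟨k, rfl⟩ := next_bijective.2 j
  have := congrFun h k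
  unfold rotw at this
  split_ifs at this <;> omega

theorem Valid.of_rot {f : Fin μ.card → Box μ} {w : Fin μ.card → ℕ}
    (h : Valid (f ∘ next) (rotw w)) : Valid f w := by
  obtain ⟨τ, h1, h2⟩ := h
  have hp : ∀ i : Fin μ.card, i.1 + 1 = μ.card → 0 < τ.w i := by
    intro i hi
    rw [h2, rotw, if_neg (by omega)]
    exact Nat.succ_pos _
  have e := τ.Psi_PsiInv hp
  refine ⟨τ.PsiInv hp, ?_, ?_⟩
  · rw [← e, Psi_box] at h1
    exact next_bijective.2.injective_comp_right h1
  · rw [← e, Psi_w] at h2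
    exact rotw_injective h2

/-- For a tableau this is the defining rule for Ψ; otherwise both sides vanish, since a rotated
tableau can be rotated back. -/
theorem Fhat_rot (hn : 0 < μ.card) (f : Fin μ.card → Box μ) (w : Fin μ.card → ℕ) :
    Fhat (f ∘ next) (rotw w) = q ^ w ⟨0, hn⟩ • V.Phi hn (Fhat f w) := by
  by_cases hv : Valid f w
  · obtain ⟨τ, rfl, rfl⟩ := hv
    rw [Fhat_eq τ.Psi (Psi_box τ) (Psi_w τ), Fhat_eq τ rfl rfl]
    have hlast : 0 < τ.Psi.w ⟨μ.card - 1, by omega⟩ := by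
      rw [Psi_w, rotw, if_neg (by simp only; omega)]
      exact Nat.succ_pos _
    have h1 : τ.Psi.lastPos = μ.card := by
      apply le_antisymm τ.Psi.lastPos_le
      have := τ.Psi.le_lastPos _ hlast
      simp only at this
      omega
    rw [nonsymF_of_lastPos_eq_card _ hn h1]
    have e : (τ.Psi.PsiInv fun i hi => τ.Psi.w_pos i (hi.trans h1.symm)) = τ := by
      have e := τ.Psi.Psi_PsiInv fun i hi => τ.Psi.w_pos i (hi.trans h1.symm)
      have e1 := congrArg PSYT.box e
      have e2 := congrArg PSYT.w e
      rw [Psi_box, Psi_box] at e1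
      rw [Psi_w, Psi_w] at e2
      exact PSYT.ext_box (next_bijective.2.injective_comp_right e1) (rotw_injective e2)
    rw [e]
  · rw [Fhat_eq_zero hv, Fhat_eq_zero (mt Valid.of_rot hv), map_zero, smul_zero]

end VVMac
end

noncomputable section
namespace VVMac
variable {μ : YoungDiagram}

/-! ## The exchange rule for `F_τ` -/

/-- The lexicographic measure for inductions over exponents: the degree, and then the positions of
the positive exponents. -/
def expMeasure {n : ℕ} (w : Fin n → ℕ) : ℕ ×ₗ ℕ := toLex (∑ j, w j, ∑ j, w j * (n - j.1))

/-- The factors n - j at the places i and i+1 differ by one. The additive form avoids subtraction in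
ℕ. -/
theorem expMeasure_snd_swap {n : ℕ} (w : Fin n → ℕ) (i : Fin (n - 1)) :
    (∑ j, (w ∘ adjSwap i) j * (n - j.1) : ℕ) + w (lo i) = ∑ j, w j * (n - j.1) + w (hi i) := by
  have key : ∑ j, ((w j * (n - j.1) : ℕ) - (((w ∘ adjSwap i) j * (n - j.1) : ℕ) : ℤ)) =
      (w (lo i) : ℤ) - w (hi i) := by
    rw [← Finset.sum_subset (Finset.subset_univ {lo i, hi i}), Finset.sum_pair (lo_ne_hi i)]
    · have h1 : (n : ℤ) - ((lo i : Fin n).1 : ℕ) = (n - (lo i : Fin n).1 : ℕ) := by omega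
      have h2 : n - (hi i : Fin n).1 + 1 = n - (lo i : Fin n).1 := by
        have := i.2; simp only [lo, hi]; omega
      simp only [Function.comp, adjSwap_lo, adjSwap_hi]
      rw [← h2]
      push_cast
      ring
    · intro j _ hj
      simp only [Finset.mem_insert, Finset.mem_singleton, not_or] at hj
      rw [Function.comp, adjSwap_of_ne i hj.1 hj.2, sub_self]
  rw [Finset.sum_sub_distrib, ← Nat.cast_sum, ← Nat.cast_sum] at key
  omega

theorem expMeasure_lt_of_snd_lt {n : ℕ} {w w' : Fin n → ℕ} (h : ∑ j, w' j = ∑ j, w j)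
    (h' : ∑ j, w' j * (n - j.1) < ∑ j, w j * (n - j.1)) : expMeasure w' < expMeasure w :=
  Prod.Lex.toLex_lt_toLex.2 (Or.inr ⟨h, h'⟩)

theorem expMeasure_swap_lt {n : ℕ} (w : Fin n → ℕ) (i : Fin (n - 1)) (h : w (hi i) < w (lo i)) :
    expMeasure (w ∘ adjSwap i) < expMeasure w := by
  have := expMeasure_snd_swap w i
  exact expMeasure_lt_of_snd_lt (Equiv.sum_comp (adjSwap i) w) (by omega)

theorem expMeasure_rotw {n : ℕ} (hn : 0 < n) (w : Fin n → ℕ) : expMeasure w < expMeasure (rotw w) := by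
  refine Prod.Lex.toLex_lt_toLex.2 (Or.inl ?_)
  simp only
  rw [← next_bijective.sum_comp w]
  refine Finset.sum_lt_sum (fun j _ => ?_) ⟨⟨n - 1, by omega⟩, Finset.mem_univ _, ?_⟩
  · unfold rotw; split_ifs <;> omega
  · rw [rotw, if_neg (by simp only; omega)]; omega

/-- Undoing the rotation. -/
theorem exists_rot {n : ℕ} {α : Type*} (hn : 0 < n) (f : Fin n → α) (w : Fin n → ℕ)
    (h : 0 < w ⟨n - 1, by omega⟩) : ∃ (f' : Fin n → α) (w' : Fin n → ℕ),
      f' ∘ next = f ∧ rotw w' = w := by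
  let e := Equiv.ofBijective _ (next_bijective (n := n))
  refine ⟨f ∘ e.symm, fun j => if (e.symm j).1 + 1 < n then w (e.symm j) else w (e.symm j) - 1,
    ?_, ?_⟩
  · funext j
    exact congrArg f (e.symm_apply_apply j)
  · funext j
    have : e.symm (next j) = j := e.symm_apply_apply j
    simp only [rotw, this]
    by_cases hj : j.1 + 1 < n
    · rw [if_pos hj, if_pos hj]
    · have e2 : j = ⟨n - 1, by omega⟩ := Fin.ext (by simp only; omega)
      rw [if_neg hj, if_neg hj]
      rw [← e2] at h
      omega

/-- The exchange rule at `i` for the boxes `f` and exponents `w`. -/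
def ExchangeRule (f : Fin μ.card → Box μ) (w : Fin μ.card → ℕ) (i : Fin (μ.card - 1)) : Prop :=
  (w (lo i) < w (hi i) ∨ (w (lo i) = w (hi i) ∧ Valid f w ∧
    -1 ≤ content (f (lo i)) - content (f (hi i)))) →
  Fhat (f ∘ adjSwap i) (w ∘ adjSwap i) =
    (Daha.phi i (wt f w (lo i)) (wt f w (hi i)) : Daha μ.card) • Fhat f w

theorem not_valid_swap_of_adjacent (τ : PSYT μ) (i : Fin (μ.card - 1))
    (hw : τ.w (lo i) = τ.w (hi i))
    (h : RowLT (τ.box (lo i)) (τ.box (hi i)) ∨ ColLT (τ.box (lo i)) (τ.box (hi i))) :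
    ¬ Valid (τ.box ∘ adjSwap i) (τ.w ∘ adjSwap i) := by
  rintro ⟨σ, h1, h2⟩
  have e1 : σ.box (hi i) = τ.box (lo i) := by rw [h1, Function.comp, adjSwap_hi]
  have e2 : σ.box (lo i) = τ.box (hi i) := by rw [h1, Function.comp, adjSwap_lo]
  have h3 : LabelLT (σ.label (σ.box (hi i))) (σ.label (σ.box (lo i))) := by
    rw [e1, e2]
    exact h.elim (σ.row_lt _ _) (σ.col_lt _ _)
  rw [PSYT.label_box_eq, PSYT.label_box_eq, h2] at h3
  unfold LabelLT at h3
  simp only [Function.comp, adjSwap_lo, adjSwap_hi, hw] at h3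
  exact h3.elim (lt_irrefl _) fun h4 => absurd h4.2 (lo_lt_hi i).not_gt

/-- The bound -1 in the rule also admits neighbours in a row or a column. There the left side is
zero by the convention for `Fhat`, and the rule says that the intertwiner kills τ, which is T_i τ =
τ or T_i τ = -tτ. -/
theorem exchangeRule_of_eq_zero (f : Fin μ.card → Box μ) (w : Fin μ.card → ℕ)
    (i : Fin (μ.card - 1)) (hw : ∀ j, w j = 0) : ExchangeRule f w i := by
  intro h
  rw [hw, hw] at h
  obtain ⟨_, ⟨τ, hf, hw'⟩, hc⟩ := h.resolve_left (lt_irrefl 0)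
  have hn : 0 < μ.card := by have := i.2; omega
  have D := Daha.isDahaFamily hn
  subst hf hw'
  have hz : τ.lastPos = 0 := by
    refine Nat.eq_zero_of_not_pos fun h => ?_
    have h1 : τ.lastPos - 1 < μ.card := by have := τ.lastPos_le; omega
    have := τ.w_pos ⟨τ.lastPos - 1, h1⟩ (by simp only; omega)
    rw [hw] at this
    exact lt_irrefl _ this
  have e0 : ∀ j, wt τ.box τ.w j = t ^ τ.c j := fun j => by
    rw [wt, hw, pow_zero, one_mul, PSYT.c]
  rw [Fhat_eq τ rfl rfl, nonsymF_of_lastPos_eq_zero τ hz, e0, e0]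
  have hlohi : τ.w (lo i) = τ.w (hi i) := by rw [hw, hw]
  rcases τ.exists_swap_or_adjacent i with ⟨σ, hs⟩ | ⟨_, ⟨h1, h2⟩ | ⟨h1, h2⟩⟩
  · have hσ : ∀ x, (σ.label x).2 = 0 := fun x => by
      rw [hs]; exact τ.label_snd_eq_zero hz x
    have hz' : σ.lastPos = 0 := by
      refine Nat.eq_zero_of_not_pos fun h => ?_
      have h1 : σ.lastPos - 1 < μ.card := by have := σ.lastPos_le; omega
      have := σ.w_pos ⟨σ.lastPos - 1, h1⟩ (by simp only; omega)
      rw [hs.w_eq, hw] at this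
      exact lt_irrefl _ this
    have e1 : σ.box = τ.box ∘ adjSwap i := funext hs.box_eq
    have e2 : σ.w = τ.w ∘ adjSwap i := funext hs.w_eq
    rw [Fhat_eq σ e1 e2, nonsymF_of_lastPos_eq_zero σ hz']
    refine (V.intertwiner_smul_vec i ⟨τ, _⟩ ⟨σ, _⟩ hs ?_).symm
    rcases hs.one_lt_abs hlohi with h' | h'
    · exact h'
    · change -1 ≤ τ.c (lo i) - τ.c (hi i) at hc
      omega
  · rw [Fhat_eq_zero (not_valid_swap_of_adjacent τ i hlohi
      (Or.inl ⟨h1, by unfold PSYT.c content at h2; omega⟩)), h2, zpow_add_one₀ t_ne_zero, mul_comm]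
    exact ((intertwiner_smul_eq_zero_iff_row t_ne_zero t_ne_one (zpow_ne_zero _ t_ne_zero)
      (D.mul_inv i) (D.inv_mul i) _).2 (V.T_smul_vec_row i ⟨τ, _⟩ h1)).symm
  · rw [Fhat_eq_zero (not_valid_swap_of_adjacent τ i hlohi
      (Or.inr ⟨h1, by unfold PSYT.c content at h2; omega⟩)), h2, zpow_add_one₀ t_ne_zero, mul_comm]
    exact (intertwiner_smul_eq_zero_of_col t_ne_one (zpow_ne_zero _ t_ne_zero)
      (D.inv_mul i) _ (V.T_smul_vec_col i ⟨τ, _⟩ h1)).symm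

theorem Daha.phi_scale {n : ℕ} (i : Fin (n - 1)) (a b : QT) :
    Daha.phi i (q * a) (q * b) = Daha.phi i a b := intertwiner_scale _ _ _ _ _ q_ne_zero

/-- By Φ T_{i+1} = T_i Φ the rule at i+1 before the rotation becomes the rule at i after it. The
power of q is the same on both sides because the exchange does not involve the index 1. -/
theorem exchangeRule_rot (f : Fin μ.card → Box μ) (w : Fin μ.card → ℕ)
    (i j : Fin (μ.card - 1)) (hij : i.1 + 1 = j.1) (ih : ExchangeRule f w j) :
    ExchangeRule (f ∘ next) (rotw w) i := by
  have hn : 0 < μ.card := by have := i.2; omega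
  have hi1 := i.2
  have hj1 := j.2
  have e1 : next (lo i) = lo j := Fin.ext (by simp only [next_val, lo]; split_ifs <;> omega)
  have e2 : next (hi i) = hi j := Fin.ext (by simp only [next_val, hi]; split_ifs <;> omega)
  have w1 : rotw w (lo i) = w (lo j) := by
    rw [rotw, e1, if_pos (by simp only [lo]; omega)]
  have w2 : rotw w (hi i) = w (hi j) := by
    rw [rotw, e2, if_pos (by simp only [hi]; omega)]
  have e3 : ∀ k, next (adjSwap i k) = adjSwap j (next k) := by
    intro k
    apply Fin.ext
    have := k.2
    have v1 := adjSwap_val i k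
    have v2 := next_val (adjSwap i k)
    have v3 := next_val k
    have v4 := adjSwap_val j (next k)
    split_ifs at v1 v2 v3 v4 <;> omega
  have e4 : (f ∘ next) ∘ adjSwap i = (f ∘ adjSwap j) ∘ next := by
    funext k
    exact congrArg f (e3 k)
  have e5 : rotw w ∘ adjSwap i = rotw (w ∘ adjSwap j) := by
    funext k
    have := k.2
    have e6 : (adjSwap i k).1 + 1 < μ.card ↔ k.1 + 1 < μ.card := by
      rw [adjSwap_val]
      split_ifs <;> omega
    simp only [Function.comp, rotw, e3, e6]
  intro h
  have e6 : adjSwap j ⟨0, hn⟩ = ⟨0, hn⟩ := adjSwap_of_ne j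
    (by simp only [lo, ne_eq, Fin.ext_iff]; omega) (by simp only [hi, ne_eq, Fin.ext_iff]; omega)
  rw [e4, e5, Fhat_rot hn, Fhat_rot hn, ih, V.Phi_phi hn i j hij, Function.comp, e6]
  · rw [smul_smul_comm_of_tower]
    congr 2
    unfold wt
    rw [w1, w2, Function.comp, e1, Function.comp, e2]
  · rw [w1, w2, Function.comp, e1, Function.comp, e2] at h
    exact h.imp_right fun h => ⟨h.1, h.2.1.of_rot, h.2.2⟩

/-- Two rotations carry the indices 1, 2 to n-1, n, and Φ² T_1 = T_{n-1} Φ². Both weights gain a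
factor q, which the intertwiner does not see, and the two powers of q merely change order. -/
theorem exchangeRule_rot_rot (f : Fin μ.card → Box μ) (w : Fin μ.card → ℕ)
    (z i : Fin (μ.card - 1)) (hz : z.1 = 0) (hi' : i.1 + 1 = μ.card - 1)
    (ih : ExchangeRule f w z) : ExchangeRule ((f ∘ next) ∘ next) (rotw (rotw w)) i := by
  have hn : 0 < μ.card := by have := i.2; omega
  have e1 : next (next (lo i)) = lo z := Fin.ext (by
    simp only [next_val, lo]; split_ifs <;> omega)
  have e2 : next (next (hi i)) = hi z := Fin.ext (by
    simp only [next_val, hi]; split_ifs <;> omega)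
  have w1 : rotw (rotw w) (lo i) = w (lo z) + 1 := by
    rw [rotw, if_pos (by simp only [lo]; omega), rotw, e1,
      if_neg (by simp only [next_val, lo]; split_ifs <;> omega)]
  have w2 : rotw (rotw w) (hi i) = w (hi z) + 1 := by
    rw [rotw, if_neg (by simp only [hi]; omega), rotw, e2,
      if_pos (by simp only [next_val, hi]; split_ifs <;> omega)]
  have e3 : ∀ k, next (next (adjSwap i k)) = adjSwap z (next (next k)) := by
    intro k
    apply Fin.ext
    have := k.2
    simp only [adjSwap_val, next_val]
    split_ifs <;> omega
  have e4 : ((f ∘ next) ∘ next) ∘ adjSwap i = ((f ∘ adjSwap z) ∘ next) ∘ next := by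
    funext k
    exact congrArg f (e3 k)
  have e5 : rotw (rotw w) ∘ adjSwap i = rotw (rotw (w ∘ adjSwap z)) := by
    funext k
    have := k.2
    simp only [Function.comp, rotw, e3, adjSwap_val, next_val]
    split_ifs <;> omega
  intro h
  have e6 : ∀ w : Fin μ.card → ℕ, rotw w ⟨0, hn⟩ = w (hi z) := by
    intro w
    have : next ⟨0, hn⟩ = hi z := Fin.ext (by simp only [next_val, hi]; split_ifs <;> omega)
    rw [rotw, if_pos (by simp only; omega), this]
  have e7 : (⟨0, hn⟩ : Fin μ.card) = lo z := Fin.ext hz.symm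
  rw [e4, e5, Fhat_rot hn, Fhat_rot hn, Fhat_rot hn, Fhat_rot hn, e6, e6, ih, e7,
    map_smul (V.Phi hn) (q ^ (w ∘ adjSwap z) (lo z)), map_smul (V.Phi hn) (q ^ w (lo z)),
    V.Phi_Phi_phi hn z i hz hi', Function.comp_apply, Function.comp_apply, adjSwap_lo, adjSwap_hi,
    smul_comm (q ^ w (lo z))]
  · have x1 : wt ((f ∘ next) ∘ next) (rotw (rotw w)) (lo i) = q * wt f w (lo z) := by
      rw [wt, wt, w1, Function.comp_apply, Function.comp_apply, e1]
      ring
    have x2 : wt ((f ∘ next) ∘ next) (rotw (rotw w)) (hi i) = q * wt f w (hi z) := by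
      rw [wt, wt, w2, Function.comp_apply, Function.comp_apply, e2]
      ring
    rw [x1, x2, Daha.phi_scale, smul_smul_comm_of_tower (Daha.phi i _ _),
      smul_smul_comm_of_tower (Daha.phi i _ _)]
  · rw [w1, w2] at h
    simp only [Function.comp, e1, e2] at h
    exact h.imp (by omega) fun h => ⟨by omega, h.2.1.of_rot.of_rot, h.2.2⟩

theorem wt_swap (f : Fin μ.card → Box μ) (w : Fin μ.card → ℕ) (i : Fin (μ.card - 1))
    (j : Fin μ.card) : wt (f ∘ adjSwap i) (w ∘ adjSwap i) j = wt f w (adjSwap i j) := rfl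

theorem wt_ne_of_w_ne {f : Fin μ.card → Box μ} {w : Fin μ.card → ℕ} {j k : Fin μ.card}
    (h : w j ≠ w k) : wt f w j ≠ wt f w k := fun e => h (qt_monomial_injective e).1

theorem comp_adjSwap_comm {n : ℕ} {α : Type*} (f : Fin n → α) (i k : Fin (n - 1))
    (h : i.1 + 1 < k.1 ∨ k.1 + 1 < i.1) :
    (f ∘ adjSwap i) ∘ adjSwap k = (f ∘ adjSwap k) ∘ adjSwap i := by
  have : adjSwap i * adjSwap k = adjSwap k * adjSwap i :=
    h.elim (adjSwap_comm i k) fun h => (adjSwap_comm k i h).symm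
  funext j
  exact congrArg f (Equiv.ext_iff.1 this j)

theorem comp_adjSwap_braid {n : ℕ} {α : Type*} (f : Fin n → α) (i k : Fin (n - 1))
    (h : i.1 + 1 = k.1 ∨ k.1 + 1 = i.1) :
    ((f ∘ adjSwap i) ∘ adjSwap k) ∘ adjSwap i = ((f ∘ adjSwap k) ∘ adjSwap i) ∘ adjSwap k := by
  have : adjSwap i * adjSwap k * adjSwap i = adjSwap k * adjSwap i * adjSwap k :=
    h.elim (adjSwap_braid i k) fun h => (adjSwap_braid k i h).symm
  funext j
  exact congrArg f (Equiv.ext_iff.1 this j)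

/-- The exchange rule for exponents whose last positive entry is at `k`, at a distant place `i`. -/
theorem exchangeRule_far (f : Fin μ.card → Box μ) (w : Fin μ.card → ℕ) (i k : Fin (μ.card - 1))
    (hik : i.1 + 1 < k.1 ∨ k.1 + 1 < i.1) (h0 : w (lo k) = 0) (h1 : 0 < w (hi k))
    (h2 : ∀ j, hi k < j → w j = 0) (ih : ExchangeRule f w i) :
    ExchangeRule (f ∘ adjSwap k) (w ∘ adjSwap k) i := by
  have hn : 0 < μ.card := by have := i.2; omega
  have D := Daha.isDahaFamily hn
  have a1 : adjSwap k (lo i) = lo i := adjSwap_of_ne k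
    (by simp only [lo, ne_eq, Fin.ext_iff]; omega) (by simp only [lo, hi, ne_eq, Fin.ext_iff]; omega)
  have a2 : adjSwap k (hi i) = hi i := adjSwap_of_ne k
    (by simp only [lo, hi, ne_eq, Fin.ext_iff]; omega) (by simp only [hi, ne_eq, Fin.ext_iff]; omega)
  have a3 : adjSwap i (lo k) = lo k := adjSwap_of_ne i
    (by simp only [lo, ne_eq, Fin.ext_iff]; omega) (by simp only [lo, hi, ne_eq, Fin.ext_iff]; omega)
  have a4 : adjSwap i (hi k) = hi k := adjSwap_of_ne i
    (by simp only [lo, hi, ne_eq, Fin.ext_iff]; omega) (by simp only [hi, ne_eq, Fin.ext_iff]; omega)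
  intro h
  simp only [Function.comp_apply, a1, a2] at h
  rw [comp_adjSwap_comm f k i hik.symm, comp_adjSwap_comm w k i hik.symm, wt_swap, wt_swap, a1, a2,
    Fhat_swap_last f w k h0 h1 h2, Fhat_swap_last (f ∘ adjSwap i) (w ∘ adjSwap i) k, wt_swap,
    wt_swap, a3, a4, ih, smul_smul, smul_smul]
  · congr 1
    exact hik.elim (fun h => (D.intertwiner_comm i k h _ _ _ _).symm)
      fun h => D.intertwiner_comm k i h _ _ _ _
  · exact h.imp_right fun h => ⟨h.1, (valid_swap_iff k (by omega)).1 h.2.1, h.2.2⟩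
  · rw [Function.comp, a3, h0]
  · rw [Function.comp, a4]; exact h1
  · intro j hj
    rw [Function.comp]
    apply h2
    rw [Fin.lt_def, adjSwap_val] at *
    simp only [hi] at *
    split_ifs <;> omega

theorem yang_baxter_smul (i k : Fin (μ.card - 1)) (h : i.1 + 1 = k.1 ∨ k.1 + 1 = i.1) {a b c : QT}
    (hab : a ≠ b) (hac : a ≠ c) (hbc : b ≠ c) (v : V μ) :
    (Daha.phi i b c : Daha μ.card) • (Daha.phi k a c : Daha μ.card) •
      (Daha.phi i a b : Daha μ.card) • v =
    (Daha.phi k a b : Daha μ.card) • (Daha.phi i a c : Daha μ.card) •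
      (Daha.phi k b c : Daha μ.card) • v := by
  have hn : 0 < μ.card := by have := i.2; omega
  have D := Daha.isDahaFamily hn
  simp only [← mul_smul]
  congr 1
  rw [← mul_assoc, ← mul_assoc]
  rcases h with h | h
  · exact D.yang_baxter i k h hab hac hbc
  · exact intertwiner_yang_baxter hab hac hbc (mul_self_of_smul_inv (D.smul_inv i) (D.mul_inv i))
      (mul_self_of_smul_inv (D.smul_inv k) (D.mul_inv k)) (D.braid_inv k i h).symm

end VVMac
end

noncomputable section
namespace VVMac
variable {μ : YoungDiagram}

/-! ### The braid cases and the induction for the exchange rule. -/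

theorem wt_lo_ne_hi {f : Fin μ.card → Box μ} {w : Fin μ.card → ℕ} (i : Fin (μ.card - 1))
    (h : w (lo i) < w (hi i) ∨ (w (lo i) = w (hi i) ∧ Valid f w ∧
      -1 ≤ content (f (lo i)) - content (f (hi i)))) : wt f w (lo i) ≠ wt f w (hi i) := by
  rcases h with h | ⟨_, ⟨τ, rfl, rfl⟩, _⟩
  · exact wt_ne_of_w_ne h.ne
  · exact τ.weight_lo_ne_hi i

/-- The exchange rule for exponents whose last positive entry is at `k`, at the place before it. -/
theorem exchangeRule_before (h : Fin μ.card → Box μ) (w : Fin μ.card → ℕ) (i k : Fin (μ.card - 1))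
    (hik : i.1 + 1 = k.1) (h0 : w (lo i) = 0) (h1 : 0 < w (lo k)) (h2 : 0 < w (hi k))
    (h3 : ∀ j, hi k < j → w j = 0) (ih1 : ExchangeRule h w i) (ih2 : ExchangeRule h w k)
    (ih3 : ExchangeRule (h ∘ adjSwap k) (w ∘ adjSwap k) i) :
    ExchangeRule ((h ∘ adjSwap i) ∘ adjSwap k) ((w ∘ adjSwap i) ∘ adjSwap k) i := by
  have ek : lo k = hi i := Fin.ext hik.symm
  have a1 : adjSwap k (lo i) = lo i := adjSwap_of_ne k
    (by simp only [lo, ne_eq, Fin.ext_iff]; omega) (by simp only [lo, hi, ne_eq, Fin.ext_iff]; omega)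
  have a2 : adjSwap i (hi k) = hi k := adjSwap_of_ne i
    (by simp only [lo, hi, ne_eq, Fin.ext_iff]; omega) (by simp only [hi, ne_eq, Fin.ext_iff]; omega)
  have a3 : adjSwap k (hi i) = hi k := by rw [← ek, adjSwap_lo]
  have a4 : adjSwap k (hi k) = hi i := by rw [adjSwap_hi, ek]
  rw [ek] at h1
  have hz : ∀ j, hi k < j → adjSwap i j = j ∧ adjSwap k j = j := fun j hj => by
    rw [Fin.lt_def] at hj
    simp only [hi] at hj
    exact ⟨adjSwap_of_ne i (by simp only [lo, ne_eq, Fin.ext_iff]; omega)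
      (by simp only [hi, ne_eq, Fin.ext_iff]; omega), adjSwap_of_ne k
      (by simp only [lo, ne_eq, Fin.ext_iff]; omega) (by simp only [hi, ne_eq, Fin.ext_iff]; omega)⟩
  have hab : wt h w (hi i) ≠ wt h w (lo i) := wt_ne_of_w_ne (by omega)
  have hac : wt h w (hi k) ≠ wt h w (lo i) := wt_ne_of_w_ne (by omega)
  intro hyp
  simp only [Function.comp_apply, a1, a3, a2, adjSwap_lo] at hyp
  have hyp' : w (lo k) < w (hi k) ∨ (w (lo k) = w (hi k) ∧ Valid h w ∧
      -1 ≤ content (h (lo k)) - content (h (hi k))) := by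
    rw [ek]
    refine hyp.imp_right fun hh => ⟨hh.1, ?_, hh.2.2⟩
    rw [valid_swap_iff, valid_swap_iff] at hh
    · exact hh.2.1
    · omega
    · rw [ek]
      simp only [Function.comp_apply, adjSwap_hi, a2]
      omega
  have hbc := wt_lo_ne_hi k hyp'
  rw [ek] at hbc
  -- At i, i+1, i+2 the exponents w are (0, x, y). The rule concerns (x, y, 0) and its exchange (y,
  -- x, 0), which arise from (0, x, y) by two and by three intertwiners; Yang–Baxter compares them.
  have F1 : Fhat ((h ∘ adjSwap i) ∘ adjSwap k) ((w ∘ adjSwap i) ∘ adjSwap k) =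
      (Daha.phi k (wt h w (lo i)) (wt h w (hi k)) : Daha μ.card) •
        (Daha.phi i (wt h w (lo i)) (wt h w (hi i)) : Daha μ.card) • Fhat h w := by
    rw [Fhat_swap_last, ih1 (Or.inl (by omega)), wt_swap, wt_swap, ek, adjSwap_hi, a2]
    · rw [ek, Function.comp, adjSwap_hi, h0]
    · rw [Function.comp, a2]; exact h2
    · intro j hj
      rw [Function.comp, (hz j hj).1, h3 j hj]
  have F2 : Fhat (((h ∘ adjSwap k) ∘ adjSwap i) ∘ adjSwap k)
      (((w ∘ adjSwap k) ∘ adjSwap i) ∘ adjSwap k) =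
      (Daha.phi k (wt h w (lo i)) (wt h w (hi i)) : Daha μ.card) •
        (Daha.phi i (wt h w (lo i)) (wt h w (hi k)) : Daha μ.card) •
          (Daha.phi k (wt h w (hi i)) (wt h w (hi k)) : Daha μ.card) • Fhat h w := by
    rw [Fhat_swap_last, ih3, ih2 hyp', wt_swap, wt_swap, wt_swap, wt_swap, wt_swap, wt_swap, ek,
      adjSwap_hi, a2, a1, a3, a4]
    · left
      simp only [Function.comp_apply, a1, a3]
      omega
    · rw [ek]
      simp only [Function.comp_apply, adjSwap_hi, a1, h0]
    · simp only [Function.comp_apply, a2, a4]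
      exact h1
    · intro j hj
      simp only [Function.comp_apply]
      rw [(hz j hj).1, (hz j hj).2, h3 j hj]
  rw [comp_adjSwap_braid h i k (Or.inl hik), comp_adjSwap_braid w i k (Or.inl hik), F2, F1,
    wt_swap, wt_swap, wt_swap, wt_swap, a1, a3, a2, adjSwap_lo,
    yang_baxter_smul i k (Or.inl hik) hab.symm hac.symm hbc]

/-- The exchange rule for exponents whose last positive entry is at `k`, at the place after it. -/
theorem exchangeRule_after (h : Fin μ.card → Box μ) (w : Fin μ.card → ℕ) (i k : Fin (μ.card - 1))
    (hik : k.1 + 1 = i.1) (h0 : w (lo k) = 0) (h1 : w (hi k) = 0) (h2 : 0 < w (hi i))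
    (h3 : ∀ j, hi i < j → w j = 0) (ih : ExchangeRule h w k) :
    ExchangeRule ((h ∘ adjSwap i) ∘ adjSwap k) ((w ∘ adjSwap i) ∘ adjSwap k) i := by
  have ek : lo i = hi k := Fin.ext hik.symm
  have a1 : adjSwap i (lo k) = lo k := adjSwap_of_ne i
    (by simp only [lo, ne_eq, Fin.ext_iff]; omega) (by simp only [lo, hi, ne_eq, Fin.ext_iff]; omega)
  have a2 : adjSwap k (hi i) = hi i := adjSwap_of_ne k
    (by simp only [lo, hi, ne_eq, Fin.ext_iff]; omega) (by simp only [hi, ne_eq, Fin.ext_iff]; omega)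
  have a3 : adjSwap i (hi k) = hi i := by rw [← ek, adjSwap_lo]
  have a4 : adjSwap i (hi i) = hi k := by rw [adjSwap_hi, ek]
  have hz : ∀ j, hi i < j → adjSwap i j = j ∧ adjSwap k j = j := fun j hj => by
    rw [Fin.lt_def] at hj
    simp only [hi] at hj
    exact ⟨adjSwap_of_ne i (by simp only [lo, ne_eq, Fin.ext_iff]; omega)
      (by simp only [hi, ne_eq, Fin.ext_iff]; omega), adjSwap_of_ne k
      (by simp only [lo, ne_eq, Fin.ext_iff]; omega) (by simp only [hi, ne_eq, Fin.ext_iff]; omega)⟩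
  have hac : wt h w (lo k) ≠ wt h w (hi i) := wt_ne_of_w_ne (by omega)
  have hbc : wt h w (hi k) ≠ wt h w (hi i) := wt_ne_of_w_ne (by omega)
  intro hyp
  simp only [Function.comp_apply, a1, a2, a4, ek, adjSwap_hi] at hyp
  have hyp' : w (lo k) < w (hi k) ∨ (w (lo k) = w (hi k) ∧ Valid h w ∧
      -1 ≤ content (h (lo k)) - content (h (hi k))) := by
    refine hyp.imp_right fun hh => ⟨hh.1, ?_, hh.2.2⟩
    rw [valid_swap_iff, valid_swap_iff] at hh
    · exact hh.2.1
    · rw [ek]; omega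
    · simp only [Function.comp_apply, a1, a3]
      omega
  have hab := wt_lo_ne_hi k hyp'
  -- At k, k+1, k+2 the exponents w have the form (x, x', y) with x = x' = 0, and the rule concerns
  -- (y, x, x'). Yang–Baxter carries the exchange of the two zeros past y.
  have F1 : Fhat ((h ∘ adjSwap i) ∘ adjSwap k) ((w ∘ adjSwap i) ∘ adjSwap k) =
      (Daha.phi k (wt h w (lo k)) (wt h w (hi i)) : Daha μ.card) •
        (Daha.phi i (wt h w (hi k)) (wt h w (hi i)) : Daha μ.card) • Fhat h w := by
    rw [Fhat_swap_last, Fhat_swap_last h w i, wt_swap, wt_swap, a1, a3, ek]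
    · rw [ek, h1]
    · exact h2
    · exact h3
    · rw [Function.comp, a1, h0]
    · rw [Function.comp, a3]; exact h2
    · intro j hj
      rw [Function.comp]
      by_cases hj' : j = hi i
      · rw [hj', a4, h1]
      · have hj2 : hi i < j := by
          have : j.1 ≠ i.1 + 1 := fun e => hj' (Fin.ext e)
          rw [Fin.lt_def] at hj ⊢
          simp only [hi] at hj ⊢
          omega
        rw [(hz j hj2).1, h3 j hj2]
  have F2 : Fhat (((h ∘ adjSwap k) ∘ adjSwap i) ∘ adjSwap k)
      (((w ∘ adjSwap k) ∘ adjSwap i) ∘ adjSwap k) =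
      (Daha.phi k (wt h w (hi k)) (wt h w (hi i)) : Daha μ.card) •
        (Daha.phi i (wt h w (lo k)) (wt h w (hi i)) : Daha μ.card) •
          (Daha.phi k (wt h w (lo k)) (wt h w (hi k)) : Daha μ.card) • Fhat h w := by
    rw [Fhat_swap_last, Fhat_swap_last (h ∘ adjSwap k) (w ∘ adjSwap k) i, ih hyp', wt_swap, wt_swap,
      wt_swap, wt_swap, wt_swap, wt_swap, a1, a3, a2, ek, adjSwap_hi, adjSwap_lo]
    · rw [ek, Function.comp, adjSwap_hi, h0]
    · rw [Function.comp, a2]; exact h2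
    · intro j hj
      rw [Function.comp, (hz j hj).2, h3 j hj]
    · simp only [Function.comp_apply, a1, adjSwap_lo, h1]
    · simp only [Function.comp_apply, a2, a3]
      exact h2
    · intro j hj
      simp only [Function.comp_apply]
      by_cases hj' : j = hi i
      · rw [hj', a4, adjSwap_hi, h0]
      · have hj2 : hi i < j := by
          have : j.1 ≠ i.1 + 1 := fun e => hj' (Fin.ext e)
          rw [Fin.lt_def] at hj ⊢
          simp only [hi] at hj ⊢
          omega
        rw [(hz j hj2).1, (hz j hj2).2, h3 j hj2]
  rw [comp_adjSwap_braid h i k (Or.inr hik), comp_adjSwap_braid w i k (Or.inr hik), F2, F1,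
    wt_swap, wt_swap, wt_swap, wt_swap, a2, a4, ek, adjSwap_hi, a1,
    yang_baxter_smul k i (Or.inl hik) hab hac hbc]

/-- If not all exponents vanish but the last one does, some exchange moves the last positive
exponent to the right. -/
theorem exists_swap_last {n : ℕ} {α : Type*} (f : Fin n → α) (w : Fin n → ℕ) (hn : 0 < n)
    (h : w ⟨n - 1, by omega⟩ = 0) (h' : ¬ ∀ j, w j = 0) :
    ∃ (f' : Fin n → α) (w' : Fin n → ℕ) (k : Fin (n - 1)), f' ∘ adjSwap k = f ∧
      w' ∘ adjSwap k = w ∧ w' (lo k) = 0 ∧ 0 < w' (hi k) ∧ ∀ j, hi k < j → w' j = 0 := by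
  push Not at h'
  obtain ⟨j, hj, hmax⟩ := (Finset.univ.filter fun j => w j ≠ 0).exists_max_image id
    (by obtain ⟨j, hj⟩ := h'; exact ⟨j, by simpa using hj⟩)
  simp only [Finset.mem_filter, Finset.mem_univ, true_and, id] at hj hmax
  have hj' : j.1 < n - 1 := by
    by_contra hc
    have : j = ⟨n - 1, by omega⟩ := Fin.ext (by simp only; omega)
    exact hj (this ▸ h)
  let k : Fin (n - 1) := ⟨j.1, hj'⟩
  have hk : lo k = j := rfl
  have hz : ∀ l, lo k < l → w l = 0 := fun l hl => by
    by_contra hc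
    exact absurd (hmax l hc) (by rw [← hk]; exact hl.not_ge)
  refine ⟨f ∘ adjSwap k, w ∘ adjSwap k, k, comp_adjSwap_comp_adjSwap f k,
    comp_adjSwap_comp_adjSwap w k, ?_, ?_, ?_⟩
  · rw [Function.comp, adjSwap_lo]
    exact hz _ (lo_lt_hi k)
  · rw [Function.comp, adjSwap_hi, hk]
    exact Nat.pos_of_ne_zero hj
  · intro l hl
    rw [Function.comp, adjSwap_of_ne k ((lo_lt_hi k).trans hl).ne' hl.ne']
    exact hz l ((lo_lt_hi k).trans hl)

/-- The vector is traced back through the last step of its recursion, and the exchange at i is moved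
past that step by induction. The step is a rotation if the index n has positive exponent; otherwise
it moves the last positive exponent from k+1 to k, and i is compared with k. -/
theorem exchangeRule (f : Fin μ.card → Box μ) (w : Fin μ.card → ℕ) (i : Fin (μ.card - 1)) :
    ExchangeRule f w i := by
  induction hm : expMeasure w using WellFoundedLT.induction generalizing f w i with
  | ind m ih =>
  subst hm
  have hn : 0 < μ.card := by have := i.2; omega
  by_cases hw : ∀ j, w j = 0
  · exact exchangeRule_of_eq_zero f w i hw
  by_cases hl : w ⟨μ.card - 1, by omega⟩ = 0
  · obtain ⟨f, w, k, rfl, rfl, h0, h1, h2⟩ := exists_swap_last f w hn hl hw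
    have hlt : expMeasure w < expMeasure (w ∘ adjSwap k) := by
      have := expMeasure_swap_lt (w ∘ adjSwap k) k (by
        simp only [Function.comp_apply, adjSwap_lo, adjSwap_hi]; omega)
      rwa [comp_adjSwap_comp_adjSwap] at this
    by_cases hfar : i.1 + 1 < k.1 ∨ k.1 + 1 < i.1
    · exact exchangeRule_far f w i k hfar h0 h1 h2 (ih _ hlt f w i rfl)
    have a0 : i.1 = k.1 ∨ i.1 + 1 = k.1 ∨ k.1 + 1 = i.1 := by omega
    rcases a0 with hik | hik | hik
    · obtain rfl : i = k := Fin.ext hik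
      -- Excluded by the hypothesis of the rule: the exponent at i is positive and the one at i+1 is
      -- zero.
      intro h
      simp only [Function.comp_apply, adjSwap_lo, adjSwap_hi] at h
      omega
    · by_cases hi0 : w (lo i) = 0
      -- With exponent zero at i, the exchange at i is itself a step of the recursion.
      · have ek : lo k = hi i := Fin.ext hik.symm
        have a1 : adjSwap k (lo i) = lo i := adjSwap_of_ne k
          (by simp only [lo, ne_eq, Fin.ext_iff]; omega)
          (by simp only [lo, hi, ne_eq, Fin.ext_iff]; omega)
        intro _
        refine Fhat_swap_last _ _ i ?_ ?_ ?_
        · rw [Function.comp, a1, hi0]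
        · rw [← ek, Function.comp, adjSwap_lo]; exact h1
        · intro j hj
          rw [Function.comp]
          by_cases hj' : j = hi k
          · rw [hj', adjSwap_hi, h0]
          · have hj2 : hi k < j := by
              have : j.1 ≠ k.1 + 1 := fun e => hj' (Fin.ext e)
              rw [Fin.lt_def] at hj ⊢
              simp only [hi] at hj ⊢
              omega
            rw [adjSwap_of_ne k ((lo_lt_hi k).trans hj2).ne' hj2.ne', h2 j hj2]
      · obtain ⟨h, rfl⟩ : ∃ h, h ∘ adjSwap i = f := ⟨_, comp_adjSwap_comp_adjSwap f i⟩
        obtain ⟨w, rfl⟩ : ∃ w', w' ∘ adjSwap i = w := ⟨_, comp_adjSwap_comp_adjSwap w i⟩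
        have ek : lo k = hi i := Fin.ext hik.symm
        have a2 : adjSwap i (hi k) = hi k := adjSwap_of_ne i
          (by simp only [lo, hi, ne_eq, Fin.ext_iff]; omega)
          (by simp only [hi, ne_eq, Fin.ext_iff]; omega)
        have a1 : adjSwap k (lo i) = lo i := adjSwap_of_ne k
          (by simp only [lo, ne_eq, Fin.ext_iff]; omega)
          (by simp only [lo, hi, ne_eq, Fin.ext_iff]; omega)
        rw [ek, Function.comp, adjSwap_hi] at h0
        rw [Function.comp, a2] at h1
        rw [Function.comp, adjSwap_lo, ← ek] at hi0
        have h2' : ∀ j, hi k < j → w j = 0 := by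
          intro j hj
          have := h2 j hj
          rw [Fin.lt_def] at hj
          simp only [hi] at hj
          rwa [Function.comp, adjSwap_of_ne i (by simp only [lo, ne_eq, Fin.ext_iff]; omega)
            (by simp only [hi, ne_eq, Fin.ext_iff]; omega)] at this
        have s1 := expMeasure_snd_swap w i
        have s2 := expMeasure_snd_swap (w ∘ adjSwap i) k
        have s3 := expMeasure_snd_swap w k
        rw [ek, Function.comp_apply, Function.comp_apply, adjSwap_hi, a2] at s2
        rw [← ek] at s1
        have hsum : ∀ (w : Fin μ.card → ℕ) (i : Fin (μ.card - 1)), ∑ j, (w ∘ adjSwap i) j = ∑ j, w j := fun w i =>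
          Equiv.sum_comp (adjSwap i) w
        have hw2 := ih (expMeasure w) (expMeasure_lt_of_snd_lt (by rw [hsum, hsum]) (by omega))
        exact exchangeRule_before h w i k hik h0 (by omega) h1 h2' (hw2 h w i rfl)
          (hw2 h w k rfl) (ih _ (expMeasure_lt_of_snd_lt (by rw [hsum, hsum, hsum]) (by omega))
            (h ∘ adjSwap k) (w ∘ adjSwap k) i rfl)
    · obtain ⟨h, rfl⟩ : ∃ h, h ∘ adjSwap i = f := ⟨_, comp_adjSwap_comp_adjSwap f i⟩
      obtain ⟨w, rfl⟩ : ∃ w', w' ∘ adjSwap i = w := ⟨_, comp_adjSwap_comp_adjSwap w i⟩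
      have ek : lo i = hi k := Fin.ext hik.symm
      have a1 : adjSwap i (lo k) = lo k := adjSwap_of_ne i
        (by simp only [lo, ne_eq, Fin.ext_iff]; omega)
        (by simp only [lo, hi, ne_eq, Fin.ext_iff]; omega)
      rw [Function.comp, a1] at h0
      rw [← ek, Function.comp, adjSwap_lo] at h1
      have h3 : w (hi k) = 0 := by
        have := h2 (hi i) (by rw [Fin.lt_def]; simp only [hi]; omega)
        rwa [Function.comp, adjSwap_hi, ek] at this
      have h2' : ∀ j, hi i < j → w j = 0 := by
        intro j hj
        have := h2 j (by rw [Fin.lt_def] at hj ⊢; simp only [hi] at hj ⊢; omega)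
        rwa [Function.comp, adjSwap_of_ne i ((lo_lt_hi i).trans hj).ne' hj.ne'] at this
      have hlt' : expMeasure w < expMeasure (w ∘ adjSwap i) := by
        have := expMeasure_swap_lt (w ∘ adjSwap i) i (by
          rw [Function.comp_apply, Function.comp_apply, adjSwap_lo, adjSwap_hi, ek]
          omega)
        rwa [comp_adjSwap_comp_adjSwap] at this
      exact exchangeRule_after h w i k hik h0 h3 h1 h2' (ih _ (hlt'.trans hlt) h w k rfl)
  · by_cases hlast : i.1 + 1 < μ.card - 1
    · obtain ⟨f, w, rfl, rfl⟩ := exists_rot hn f w (Nat.pos_of_ne_zero hl)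
      exact exchangeRule_rot f w i ⟨i.1 + 1, hlast⟩ rfl (ih _ (expMeasure_rotw hn w) _ _ _ rfl)
    have hlast' : i.1 + 1 = μ.card - 1 := by have := i.2; omega
    have e : hi i = ⟨μ.card - 1, by omega⟩ := Fin.ext hlast'
    -- At the last place: if the exponent at n-1 is zero the exchange is a step of the recursion,
    -- and otherwise two rotations can be undone.
    by_cases hi0 : w (lo i) = 0
    · intro _
      refine Fhat_swap_last f w i hi0 (by rw [e]; exact Nat.pos_of_ne_zero hl) fun j hj => ?_
      have := j.2
      rw [Fin.lt_def] at hj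
      simp only [hi] at hj
      omega
    · obtain ⟨f, w, rfl, rfl⟩ := exists_rot hn f w (Nat.pos_of_ne_zero hl)
      have e2 : next (lo i) = ⟨μ.card - 1, by omega⟩ := Fin.ext (by
        simp only [next_val, lo]; split_ifs <;> omega)
      rw [rotw, if_pos (by simp only [lo]; omega), e2] at hi0
      obtain ⟨f, w, rfl, rfl⟩ := exists_rot hn f w (Nat.pos_of_ne_zero hi0)
      exact exchangeRule_rot_rot f w ⟨0, by omega⟩ i rfl hlast'
        (ih _ ((expMeasure_rotw hn w).trans (expMeasure_rotw hn _)) _ _ _ rfl)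

/-- Along the recursion an intertwiner exchanges two eigenvalues, and a rotation shifts them
cyclically with a factor q at the index n. -/
theorem theta_smul_Fhat (f : Fin μ.card → Box μ) (w : Fin μ.card → ℕ) (j : Fin μ.card) :
    (Daha.θ j : Daha μ.card) • Fhat f w = wt f w j • Fhat f w := by
  induction hm : expMeasure w using WellFoundedLT.induction generalizing f w j with
  | ind m ih =>
  subst hm
  have hn : 0 < μ.card := by have := j.2; omega
  have D := Daha.isDahaFamily hn
  by_cases hw : ∀ j, w j = 0
  · by_cases hv : Valid f w
    · obtain ⟨τ, rfl, rfl⟩ := hv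
      have hz : τ.lastPos = 0 := by
        refine Nat.eq_zero_of_not_pos fun h => ?_
        have h1 : τ.lastPos - 1 < μ.card := by have := τ.lastPos_le; omega
        have := τ.w_pos ⟨τ.lastPos - 1, h1⟩ (by simp only; omega)
        rw [hw] at this
        exact lt_irrefl _ this
      rw [Fhat_eq τ rfl rfl, nonsymF_of_lastPos_eq_zero τ hz, V.theta_smul_vec, wt, hw, pow_zero,
        one_mul, PSYT.c]
    · rw [Fhat_eq_zero hv, smul_zero, smul_zero]
  by_cases hl : w ⟨μ.card - 1, by omega⟩ = 0
  · obtain ⟨f, w, k, rfl, rfl, h0, h1, h2⟩ := exists_swap_last f w hn hl hw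
    have hlt : expMeasure w < expMeasure (w ∘ adjSwap k) := by
      have := expMeasure_swap_lt (w ∘ adjSwap k) k (by
        simp only [Function.comp_apply, adjSwap_lo, adjSwap_hi]; omega)
      rwa [comp_adjSwap_comp_adjSwap] at this
    have ih' := fun j => ih _ hlt f w j rfl
    have h3 := D.theta_intertwiner k (wt_ne_of_w_ne (f := f) (w := w) (by omega)) (ih' (lo k))
      (ih' (hi k))
    rw [Fhat_swap_last f w k h0 h1 h2, wt_swap]
    by_cases hj : j = lo k
    · rw [hj, adjSwap_lo]; exact h3.1
    by_cases hj' : j = hi k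
    · rw [hj', adjSwap_hi]; exact h3.2
    have h4 : Commute (Daha.θ j : Daha μ.card) (Daha.phi k (wt f w (lo k)) (wt f w (hi k))) :=
      commute_intertwiner (D.commute_inv (D.theta_far k j hj hj')).symm _ _
    rw [adjSwap_of_ne k hj hj', smul_smul, h4.eq, mul_smul, ih', smul_smul_comm_of_tower]
  · obtain ⟨f, w, rfl, rfl⟩ := exists_rot hn f w (Nat.pos_of_ne_zero hl)
    have ih' := fun j => ih _ (expMeasure_rotw hn w) f w j rfl
    rw [Fhat_rot hn]
    by_cases hj : j.1 + 1 < μ.card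
    · let i : Fin (μ.card - 1) := ⟨j.1, by omega⟩
      have e : next j = hi i := Fin.ext (by rw [next_val, if_pos hj]; rfl)
      have e2 : wt (f ∘ next) (rotw w) j = wt f w (hi i) := by
        rw [wt, wt, rotw, if_pos hj, Function.comp, e]
      change (Daha.θ (lo i) : Daha μ.card) • _ = _
      rw [smul_smul_comm_of_tower, V.theta_Phi, ih', e2, map_smul, smul_comm]
    · have e0 : j = ⟨μ.card - 1, by omega⟩ := Fin.ext (by have := j.2; simp only; omega)
      have e : next j = ⟨0, hn⟩ := Fin.ext (by rw [next_val, if_neg hj])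
      have e2 : wt (f ∘ next) (rotw w) j = q * wt f w ⟨0, hn⟩ := by
        rw [wt, wt, rotw, if_neg hj, Function.comp, e, pow_succ]
        ring
      rw [e2, e0, smul_smul_comm_of_tower, V.theta_last_Phi, ih', map_smul, smul_smul, smul_smul,
        smul_smul]
      congr 1
      ring

theorem theta_smul_nonsymF (τ : PSYT μ) (j : Fin μ.card) :
    (Daha.θ j : Daha μ.card) • nonsymF τ = τ.weight j • nonsymF τ := by
  have := theta_smul_Fhat τ.box τ.w j
  rwa [Fhat_eq τ rfl rfl] at this

theorem PSYT.IsSwap.nonsymF_eq {i : Fin (μ.card - 1)} {τ σ : PSYT μ} (hs : PSYT.IsSwap i τ σ)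
    (h : τ.w (lo i) < τ.w (hi i) ∨ (τ.w (lo i) = τ.w (hi i) ∧ 1 < τ.c (lo i) - τ.c (hi i))) :
    nonsymF σ = (Daha.phi i (τ.weight (lo i)) (τ.weight (hi i)) : Daha μ.card) • nonsymF τ := by
  have := exchangeRule τ.box τ.w i (h.imp_right fun h => ⟨h.1, ⟨τ, rfl, rfl⟩, by
    have h2 := h.2
    unfold PSYT.c at h2
    omega⟩)
  have e1 : σ.box = τ.box ∘ adjSwap i := funext hs.box_eq
  have e2 : σ.w = τ.w ∘ adjSwap i := funext hs.w_eq
  rwa [Fhat_eq τ rfl rfl, Fhat_eq σ e1 e2] at this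

/-- Exchanging row neighbours gives no tableau, so the exchange rule reads φ F = 0 with b = ta,
which is T_i F = F. -/
theorem T_smul_nonsymF_of_row (τ : PSYT μ) (i : Fin (μ.card - 1)) (hw : τ.w (lo i) = τ.w (hi i))
    (hr : RowLT (τ.box (lo i)) (τ.box (hi i))) (hc : τ.c (hi i) = τ.c (lo i) + 1) :
    (Daha.T i : Daha μ.card) • nonsymF τ = nonsymF τ := by
  have hn : 0 < μ.card := by have := i.2; omega
  have D := Daha.isDahaFamily hn
  have e := exchangeRule τ.box τ.w i (Or.inr ⟨hw, ⟨τ, rfl, rfl⟩, by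
    unfold PSYT.c at hc
    omega⟩)
  have e1 : wt τ.box τ.w (hi i) = t * wt τ.box τ.w (lo i) := by
    have hc' : content (τ.box (hi i)) = content (τ.box (lo i)) + 1 := hc
    rw [wt, wt, hc', hw, zpow_add_one₀ t_ne_zero]
    ring
  rw [Fhat_eq_zero (not_valid_swap_of_adjacent τ i hw (Or.inl hr)), Fhat_eq τ rfl rfl, e1] at e
  exact (intertwiner_smul_eq_zero_iff_row t_ne_zero t_ne_one
    (mul_ne_zero (pow_ne_zero _ q_ne_zero) (zpow_ne_zero _ t_ne_zero))
    (D.mul_inv i) (D.inv_mul i) _).1 e.symm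

end VVMac
end

noncomputable section
namespace VVMac
variable {μ : YoungDiagram}

/-! ## The order of the boxes and inversions -/

theorem Before.trans {T : RYT μ} {x y z : Box μ} (h : Before T x y) (h' : Before T y z) :
    Before T x z := by
  unfold Before ColumnBefore at *
  omega

theorem Before.irrefl {T : RYT μ} (x : Box μ) : ¬ Before T x x := by
  unfold Before ColumnBefore
  omega

theorem Before.asymm {T : RYT μ} {x y : Box μ} (h : Before T x y) : ¬ Before T y x :=
  fun h' => Before.irrefl x (h.trans h')

theorem Before.total {T : RYT μ} {x y : Box μ} (hxy : x ≠ y) : Before T x y ∨ Before T y x := by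
  have h1 : ¬ (x.1.1 = y.1.1 ∧ x.1.2 = y.1.2) := fun h1 =>
    hxy (Subtype.ext (Prod.ext h1.1 h1.2))
  unfold Before ColumnBefore
  omega

theorem mem_Inv {τ : PSYT μ} {p : Box μ × Box μ} :
    p ∈ Inv τ ↔ Before τ.exps p.1 p.2 ∧ (τ.label p.2).1 < (τ.label p.1).1 := by
  classical
  rw [Inv, Finset.mem_filter, IsInv, stdLabel_lt_iff]
  exact and_iff_right (Finset.mem_univ _)

namespace PSYT

variable {τ σ : PSYT μ} {i : Fin (μ.card - 1)}

theorem exps_val_box (τ : PSYT μ) (j : Fin μ.card) : τ.exps.val (τ.box j) = τ.w j := rfl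

/-- The boxes of the indices `i` and `i + 1` form an inversion pair. -/
def IsDescent (τ : PSYT μ) (i : Fin (μ.card - 1)) : Prop :=
  Before τ.exps (τ.box (hi i)) (τ.box (lo i))

theorem not_sameColumn (hT : τ.exps.IsRSSYT) (hw : τ.w (lo i) = τ.w (hi i)) :
    ¬ ((τ.box (lo i)).1.2 = (τ.box (hi i)).1.2 ∧ (τ.box (hi i)).1.1 = (τ.box (lo i)).1.1 + 1) :=
  fun h => (hT (τ.box (lo i)) (τ.box (hi i)) ⟨h.1, by omega⟩).ne hw.symm

/-- Ties are broken by columns: with equal exponents the box of i+1 comes first only if it lies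
strictly to the left of the box of i, hence strictly below it. -/
theorem IsDescent.up (hT : τ.exps.IsRSSYT) (h : τ.IsDescent i) :
    τ.w (lo i) < τ.w (hi i) ∨ (τ.w (lo i) = τ.w (hi i) ∧ 1 < τ.c (lo i) - τ.c (hi i)) := by
  rcases h with h | ⟨h, h'⟩
  · exact Or.inl h
  · have hw : τ.w (lo i) = τ.w (hi i) := h.symm
    have h1 := not_sameColumn hT hw
    have h2 := τ.adjacent_or_incomparable i hw
    unfold ColumnBefore at h'
    refine Or.inr ⟨hw, ?_⟩
    unfold c content
    omega

theorem IsDescent.exists_swap (hT : τ.exps.IsRSSYT) (h : τ.IsDescent i) : ∃ σ, IsSwap i τ σ := by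
  rcases τ.exists_swap_or_adjacent i with hs | ⟨_, h'⟩
  · exact hs
  · have := h.up hT
    omega

theorem IsSwap.isDescent_iff (hs : IsSwap i τ σ) : σ.IsDescent i ↔ ¬ τ.IsDescent i := by
  have hne : τ.box (lo i) ≠ τ.box (hi i) := fun e => lo_ne_hi i (τ.box_injective e)
  rw [IsDescent, IsDescent, hs.exps_eq, hs.box_eq, hs.box_eq, adjSwap_lo, adjSwap_hi]
  exact ⟨Before.asymm, fun h => (Before.total hne).resolve_right h⟩

/-- Only for the boxes of i and i+1 does the exchange alter the relative order of the indices. -/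
theorem IsSwap.inv_eq (hs : IsSwap i τ σ) (h : τ.IsDescent i) :
    (τ.box (hi i), τ.box (lo i)) ∉ Inv σ ∧
      ∀ p, p ∈ Inv τ ↔ p = (τ.box (hi i), τ.box (lo i)) ∨ p ∈ Inv σ := by
  have e1 : (σ.label (τ.box (hi i))).1 = lo i := by rw [hs, label_box, adjSwap_hi]
  have e2 : (σ.label (τ.box (lo i))).1 = hi i := by rw [hs, label_box, adjSwap_lo]
  refine ⟨fun hm => ?_, fun p => ?_⟩
  · have := (mem_Inv.1 hm).2
    rw [e1, e2] at this
    exact absurd this (lo_lt_hi i).not_gt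
  · rw [mem_Inv, mem_Inv, hs.exps_eq]
    constructor
    · rintro ⟨h1, h2⟩
      by_cases hp : (τ.label p.2).1 = lo i ∧ (τ.label p.1).1 = hi i
      · left
        exact Prod.ext (by rw [← hp.2, box_label]) (by rw [← hp.1, box_label])
      · right
        refine ⟨h1, ?_⟩
        rw [hs, hs]
        exact adjSwap_lt_adjSwap i h2 hp
    · rintro (rfl | ⟨h1, h2⟩)
      · refine ⟨h, ?_⟩
        rw [label_box, label_box]
        exact lo_lt_hi i
      · refine ⟨h1, ?_⟩
        rw [hs.symm, hs.symm]
        refine adjSwap_lt_adjSwap i h2 ?_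
        rintro ⟨h3, h4⟩
        rw [← box_eq_iff, hs.box_eq, adjSwap_lo] at h3
        rw [← box_eq_iff, hs.box_eq, adjSwap_hi] at h4
        rw [← h3, ← h4] at h1
        exact h.asymm h1

theorem IsDescent.inv_nonempty (h : τ.IsDescent i) : (Inv τ).Nonempty :=
  ⟨(τ.box (hi i), τ.box (lo i)), mem_Inv.2 ⟨h, by rw [label_box, label_box]; exact lo_lt_hi i⟩⟩

/-- Without descents the boxes of 1, 2, …, n follow each other in the order `Before`, which leaves
no inversion. -/
theorem exists_isDescent (h : (Inv τ).Nonempty) : ∃ i, τ.IsDescent i := by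
  by_contra! hd
  have step : ∀ i : Fin (μ.card - 1), Before τ.exps (τ.box (lo i)) (τ.box (hi i)) := fun i =>
    (Before.total fun e => lo_ne_hi _ (τ.box_injective e)).resolve_right (hd i)
  have key : ∀ (d : ℕ) (j k : Fin μ.card), k.1 = j.1 + d + 1 →
      Before τ.exps (τ.box j) (τ.box k) := by
    intro d
    induction d with
    | zero =>
      intro j k hjk
      have hk := k.2
      obtain ⟨i, rfl, rfl⟩ : ∃ i, lo i = j ∧ hi i = k :=
        ⟨⟨j.1, by omega⟩, rfl, Fin.ext hjk.symm⟩
      exact step i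
    | succ d ih =>
      intro j k hjk
      have hk := k.2
      obtain ⟨i, hi1, rfl⟩ : ∃ i : Fin (μ.card - 1), i.1 = j.1 + d + 1 ∧ hi i = k :=
        ⟨⟨j.1 + d + 1, by omega⟩, rfl, Fin.ext hjk.symm⟩
      exact (ih j (lo i) hi1).trans (step i)
  obtain ⟨p, hp⟩ := h
  obtain ⟨h1, h2⟩ := mem_Inv.1 hp
  have := key ((τ.label p.1).1.1 - (τ.label p.2).1.1 - 1) (τ.label p.2).1 (τ.label p.1).1
    (by rw [Fin.lt_def] at h2; omega)
  rw [box_label, box_label] at this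
  exact h1.asymm this

/-- Without inversions, the labels are those of `S(T)`. -/
theorem label_eq_of_inv_eq_empty (h : Inv τ = ∅) (x : Box μ) :
    (τ.label x).1.1 + 1 = stdLabel τ.exps x := by
  classical
  have key : ∀ y, Before τ.exps y x ↔ (τ.label y).1 < (τ.label x).1 := by
    have h1 : ∀ y z, Before τ.exps y z → (τ.label y).1 < (τ.label z).1 := by
      intro y z hyz
      refine lt_of_le_of_ne ?_ fun e => ?_
      · by_contra! hc
        have : (y, z) ∈ Inv τ := mem_Inv.2 ⟨hyz, hc⟩
        simp [h] at this
      · rw [τ.bij.1 e] at hyz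
        exact Before.irrefl _ hyz
    intro y
    refine ⟨h1 y x, fun hlt => ?_⟩
    have hne : y ≠ x := by rintro rfl; exact lt_irrefl _ hlt
    exact (Before.total hne).resolve_right fun hc => hlt.not_gt (h1 x y hc)
  have h2 : (Finset.univ.filter fun y => Before τ.exps y x).card = (τ.label x).1.1 := by
    simp only [key]
    rw [← Finset.card_image_of_injective _ τ.bij.1]
    have : (Finset.univ.filter fun y => (τ.label y).1 < (τ.label x).1).image
        (fun y => (τ.label y).1) = Finset.Iio (τ.label x).1 := by
      ext j
      simp only [Finset.mem_image, Finset.mem_filter, Finset.mem_univ, true_and, Finset.mem_Iio]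
      refine ⟨?_, fun hj => ⟨τ.box j, by rwa [label_box], τ.label_box j⟩⟩
      rintro ⟨y, hy, rfl⟩
      exact hy
    rw [this, Fin.card_Iio]
  rw [← h2, stdLabel]

end PSYT

/-! ### The top tableau of PSYT(λ;T). -/

section

variable (T : RYT μ)

theorem stdLabel_sub_one_lt (x : Box μ) : stdLabel T x - 1 < μ.card := by
  classical
  have h1 : (Finset.univ.filter fun y => Before T y x).card < Fintype.card (Box μ) :=
    Finset.card_lt_univ_of_notMem (x := x) (by simpa using Before.irrefl x)
  have h2 : Fintype.card (Box μ) = μ.card := Fintype.card_coe μ.cells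
  have h3 : stdLabel T x = (Finset.univ.filter fun y => Before T y x).card + 1 := by
    rw [stdLabel]
  omega

/-- The periodic tableau with exponents `T` whose indices are those of `S(T)`. -/
def stdTop : PSYTOver T where
  val :=
    have key : ∀ x y, Before T x y →
        LabelLT ((⟨stdLabel T x - 1, stdLabel_sub_one_lt T x⟩ : Fin μ.card), T.val x)
          ((⟨stdLabel T y - 1, stdLabel_sub_one_lt T y⟩ : Fin μ.card), T.val y) := by
      intro x y h
      have h1 := (stdLabel_lt_iff T x y).2 h
      have h2 : 0 < stdLabel T x := Nat.succ_pos _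
      rcases h with h | h
      · exact Or.inl h
      · exact Or.inr ⟨h.1, by rw [Fin.lt_def]; simp only; omega⟩
    { label := fun x => (⟨stdLabel T x - 1, stdLabel_sub_one_lt T x⟩, T.val x)
      bij := by
        rw [Fintype.bijective_iff_injective_and_card]
        refine ⟨fun x y h => ?_, by rw [Fintype.card_fin]; exact Fintype.card_coe μ.cells⟩
        have h1 : 0 < stdLabel T x := Nat.succ_pos _
        have h2 : 0 < stdLabel T y := Nat.succ_pos _
        have h3 : stdLabel T x - 1 = stdLabel T y - 1 := congrArg Fin.val h
        by_contra hne
        rcases Before.total (T := T) hne with h | h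
        · have := (stdLabel_lt_iff T _ _).2 h
          omega
        · have := (stdLabel_lt_iff T _ _).2 h
          omega
      row_lt := fun x y h => key x y (by
        have := T.row_weak x y h
        unfold RowLT at h
        unfold Before ColumnBefore
        omega)
      col_lt := fun x y h => key x y (by
        have := T.col_weak x y h
        unfold ColLT at h
        unfold Before ColumnBefore
        omega) }
  property := rfl

theorem inv_stdTop : Inv (stdTop T).1 = ∅ := by
  rw [Finset.eq_empty_iff_forall_notMem]
  intro p hp
  obtain ⟨h1, h2⟩ := mem_Inv.1 hp
  have h3 := (stdLabel_lt_iff T _ _).2 h1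
  have h4 : stdLabel T p.2 - 1 < stdLabel T p.1 - 1 := h2
  omega

variable {T}

theorem eq_stdTop {τ : PSYTOver T} (h : Inv τ.1 = ∅) : τ = stdTop T := by
  obtain ⟨τ, rfl⟩ := τ
  apply Subtype.ext
  apply PSYT.ext_label
  funext x
  refine Prod.ext (Fin.ext ?_) rfl
  have h1 : (τ.label x).1.1 + 1 = stdLabel τ.exps x := PSYT.label_eq_of_inv_eq_empty h x
  change (τ.label x).1.1 = stdLabel τ.exps x - 1
  omega

/-- Every tableau with exponents `T` is reached from the top one by undoing exchanges. -/
theorem PSYTOver.induction_top (hT : T.IsRSSYT) {P : PSYTOver T → Prop} (h0 : P (stdTop T))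
    (hs : ∀ (i : Fin (μ.card - 1)) (τ σ : PSYTOver T), PSYT.IsSwap i τ.1 σ.1 → τ.1.IsDescent i →
      P σ → P τ) (τ : PSYTOver T) : P τ := by
  induction hm : (Inv τ.1).card using Nat.strong_induction_on generalizing τ with
  | _ m ih =>
  subst hm
  rcases (Inv τ.1).eq_empty_or_nonempty with h | h
  · rwa [eq_stdTop h]
  · obtain ⟨i, hi⟩ := PSYT.exists_isDescent h
    obtain ⟨σ, hσ⟩ := hi.exists_swap (by rw [τ.2]; exact hT)
    obtain ⟨h1, h2⟩ := hσ.inv_eq hi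
    refine hs i τ ⟨σ, hσ.exps_eq.trans τ.2⟩ hσ hi (ih _ ?_ _ rfl)
    refine Finset.card_lt_card (Finset.ssubset_iff_of_subset (fun p hp => (h2 p).2 (Or.inr hp))
      |>.2 ⟨_, (h2 _).2 (Or.inl rfl), h1⟩)

theorem PSYT.Cover.degree_le {τ σ : PSYT μ} (h : PSYT.Cover τ σ) : τ.degree ≤ σ.degree := by
  cases h with
  | psi =>
    refine Finset.sum_le_sum fun x _ => ?_
    change _ ≤ (PSYT.rotate (τ.label x)).2
    unfold PSYT.rotate
    split_ifs <;> simp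
  | swap_exp i _ _ h _ => exact (Finset.sum_congr rfl fun x _ => by rw [h]).le
  | swap_content i _ _ h _ => exact (Finset.sum_congr rfl fun x _ => by rw [h]).le

theorem PSYT.degree_lt_degree_Psi (hn : 0 < μ.card) (τ : PSYT μ) : τ.degree < τ.Psi.degree := by
  refine Finset.sum_lt_sum (fun x _ => ?_) ⟨τ.box ⟨0, hn⟩, Finset.mem_univ _, ?_⟩
  · change _ ≤ (PSYT.rotate (τ.label x)).2
    unfold PSYT.rotate
    split_ifs <;> simp
  · change _ < (PSYT.rotate (τ.label _)).2
    rw [PSYT.label_box_eq, PSYT.rotate, if_pos rfl]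
    exact Nat.lt_succ_self _

theorem PSYT.degree_le_of_le {τ σ : PSYT μ} (h : PSYT.le τ σ) : τ.degree ≤ σ.degree := by
  induction h with
  | refl => exact le_rfl
  | tail _ h ih => exact ih.trans h.degree_le

/-- Removing inversions leads upwards to `stdTop T`. Conversely, consider the first cover of a chain
leaving it within the same exponents: it is not Ψ, which raises the degree while no cover lowers it,
and not an exchange, which would require a descent. -/
theorem isTop_iff (hT : T.IsRSSYT) (τ : PSYTOver T) : IsTop τ ↔ τ = stdTop T := by
  constructor
  · intro h
    -- For the empty diagram Ψ does not raise the degree.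
    rcases Nat.eq_zero_or_pos μ.card with hn | hn
    · refine eq_stdTop (Finset.eq_empty_iff_forall_notMem.2 fun p _ => ?_)
      have := (τ.1.label p.1).1.2
      omega
    have hdeg : τ.1.degree = (stdTop T).1.degree := by
      have e : τ.1.exps = (stdTop T).1.exps := τ.2.trans (stdTop T).2.symm
      exact Finset.sum_congr rfl fun x _ => congrArg (fun R : RYT μ => R.val x) e
    have hnd : ∀ i, ¬ (stdTop T).1.IsDescent i := fun i hi => by
      have := hi.inv_nonempty
      rw [inv_stdTop] at this
      exact Finset.not_nonempty_empty this
    rcases Relation.ReflTransGen.cases_head (h (stdTop T)) with e | ⟨ρ, h1, h2⟩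
    · exact Subtype.ext e.symm
    · exfalso
      have hρ := PSYT.degree_le_of_le h2
      generalize hs : (stdTop T).1 = s at *
      cases h1 with
      | psi =>
        have := PSYT.degree_lt_degree_Psi hn s
        omega
      | swap_exp i _ _ h1 h3 => exact hnd i (Or.inl h3)
      | swap_content i _ _ h1 h3 h4 =>
        -- Without a descent at i the exchanged tableau has one, so the upward inequality holds in
        -- the opposite direction.
        have h5 := (h1.isDescent_iff.2 (hnd i)).up (by
          rw [h1.exps_eq, ← hs, (stdTop T).2]
          exact hT)
        rw [h1.w_eq, h1.w_eq, h1.c_eq, h1.c_eq, adjSwap_lo, adjSwap_hi] at h5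
        omega
  · rintro rfl σ
    induction σ using PSYTOver.induction_top hT with
    | h0 => exact Relation.ReflTransGen.refl
    | hs i τ σ hs hd ih =>
      refine Relation.ReflTransGen.head ?_ ih
      rcases hd.up (by rw [τ.2]; exact hT) with h | h
      · exact PSYT.Cover.swap_exp i _ _ hs h
      · exact PSYT.Cover.swap_content i _ _ hs h.1 h.2

end

/-! ## The symmetric sum -/

/-- The factor of an inversion pair. -/
def invFactor (T : RYT μ) (p : Box μ × Box μ) : QT :=
  (q ^ T.val p.1 * t ^ (content p.1 + 1) - q ^ T.val p.2 * t ^ content p.2) /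
    (q ^ T.val p.1 * t ^ content p.1 - q ^ T.val p.2 * t ^ content p.2)

/-- The coefficient of `F_τ`. -/
def symCoeff (T : RYT μ) (τ : PSYTOver T) : QT := ∏ p ∈ Inv τ.1, invFactor T p

/-- The symmetric sum. -/
def symSum (T : RYT μ) : V μ := ∑ τ : PSYTOver T, symCoeff T τ • nonsymF τ.1

theorem symCoeff_stdTop (T : RYT μ) : symCoeff T (stdTop T) = 1 := by
  rw [symCoeff, inv_stdTop, Finset.prod_empty]

variable {T : RYT μ}

/-- The one additional inversion of τ is (box of i+1, box of i), whose factor is the quotient shown.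
-/
theorem symCoeff_eq {i : Fin (μ.card - 1)} {τ σ : PSYTOver T} (hs : PSYT.IsSwap i τ.1 σ.1)
    (h : τ.1.IsDescent i) : symCoeff T τ = symCoeff T σ *
      ((t * τ.1.weight (hi i) - τ.1.weight (lo i)) /
        (τ.1.weight (hi i) - τ.1.weight (lo i))) := by
  classical
  obtain ⟨h1, h2⟩ := hs.inv_eq h
  have e : Inv τ.1 = insert (τ.1.box (hi i), τ.1.box (lo i)) (Inv σ.1) := by
    ext p
    rw [h2, Finset.mem_insert]
  have e2 : ∀ j, T.val (τ.1.box j) = τ.1.w j := fun j => by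
    rw [← PSYT.exps_val_box, τ.2]
  rw [symCoeff, symCoeff, e, Finset.prod_insert h1, mul_comm, invFactor, e2, e2,
    zpow_add_one₀ t_ne_zero]
  unfold PSYT.weight PSYT.c
  congr 3
  ring

theorem T_smul_pair (hT : T.IsRSSYT) {i : Fin (μ.card - 1)} {τ σ : PSYTOver T}
    (hs : PSYT.IsSwap i τ.1 σ.1) (h : τ.1.IsDescent i) :
    (Daha.T i : Daha μ.card) • (symCoeff T τ • nonsymF τ.1 + symCoeff T σ • nonsymF σ.1) =
      symCoeff T τ • nonsymF τ.1 + symCoeff T σ • nonsymF σ.1 := by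
  have hn : 0 < μ.card := by have := i.2; omega
  have D := Daha.isDahaFamily hn
  rw [symCoeff_eq hs h, hs.nonsymF_eq (h.up (by rw [τ.2]; exact hT))]
  exact smul_add_intertwiner_smul (τ.1.weight_lo_ne_hi i) (D.smul_inv i) (D.mul_inv i) _ _

/-- The tableaux fall into pairs {τ, s_i(τ)}, whose joint contribution is fixed by T_i, and single
tableaux with i, i+1 adjacent. Strict columns leave only row neighbours among the latter, and there
T_i F_τ = F_τ. -/
theorem T_smul_symSum (hT : T.IsRSSYT) (i : Fin (μ.card - 1)) :
    (Daha.T i : Daha μ.card) • symSum T = symSum T := by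
  classical
  let g : PSYTOver T → PSYTOver T := fun τ =>
    if h : ∃ σ, PSYT.IsSwap i τ.1 σ then ⟨h.choose, h.choose_spec.exps_eq.trans τ.2⟩ else τ
  have hg : ∀ τ σ : PSYTOver T, PSYT.IsSwap i τ.1 σ.1 → g τ = σ := by
    intro τ σ hs
    have h : ∃ σ, PSYT.IsSwap i τ.1 σ := ⟨σ.1, hs⟩
    simp only [g, dif_pos h]
    exact Subtype.ext (h.choose_spec.unique hs)
  have hg' : ∀ τ, (PSYT.IsSwap i τ.1 (g τ).1) ∨
      (g τ = τ ∧ (Daha.T i : Daha μ.card) • nonsymF τ.1 = nonsymF τ.1) := by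
    intro τ
    by_cases h : ∃ σ, PSYT.IsSwap i τ.1 σ
    · left
      simp only [g, dif_pos h]
      exact h.choose_spec
    · right
      refine ⟨by simp only [g, dif_neg h], ?_⟩
      obtain ⟨hw, ha⟩ := (τ.1.exists_swap_or_adjacent i).resolve_left h
      have hns := PSYT.not_sameColumn (τ := τ.1) (i := i) (by rw [τ.2]; exact hT) hw
      have hc : ∀ j, τ.1.c j = (τ.1.box j).1.2 - (τ.1.box j).1.1 := fun j => rfl
      have h1 := hc (lo i)
      have h2 := hc (hi i)
      rcases ha with ha | ha
      · exact T_smul_nonsymF_of_row τ.1 i hw ⟨ha.1, by omega⟩ ha.2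
      · omega
  rw [← sub_eq_zero, symSum, Finset.smul_sum, ← Finset.sum_sub_distrib]
  refine Finset.sum_involution (fun τ _ => g τ) ?_ ?_ (fun _ _ => Finset.mem_univ _) ?_
  · intro τ _
    rcases hg' τ with h | ⟨h, h'⟩
    · rw [sub_add_sub_comm, ← smul_add, sub_eq_zero]
      by_cases hd : τ.1.IsDescent i
      · exact T_smul_pair hT h hd
      · have := T_smul_pair hT h.symm (h.isDescent_iff.2 hd)
        rwa [add_comm] at this
    · rw [h, smul_smul_comm_of_tower, h', sub_self, add_zero]
  · intro τ _ hne he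
    rcases hg' τ with h | ⟨h, h'⟩
    · exact h.ne (congrArg Subtype.val he)
    · rw [smul_smul_comm_of_tower, h', sub_self] at hne
      exact hne rfl
  · intro τ _
    rcases hg' τ with h | ⟨h, h'⟩
    · exact hg _ _ h.symm
    · simp only [h]

/-! ## The idempotent on `V_λ` -/

/-- The action of `ε` on `V_λ`. -/
def V.eps (μ : YoungDiagram) : Module.End QT (V μ) :=
  Algebra.lsmul QT QT (V μ) (affToDaha μ.card (heckeToAff μ.card (epsilon μ.card)))

/-- Every T_σ acts as the identity on such v. The scalar is in fact 1, but nonvanishing is enough.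
-/
theorem V.eps_smul_of_invariant : ∃ k : QT, k ≠ 0 ∧ ∀ v : V μ,
    (∀ i, (Daha.T i : Daha μ.card) • v = v) → V.eps μ v = k • v := by
  refine ⟨(tFactorial μ.card)⁻¹ * ∑ σ : Equiv.Perm (Fin μ.card),
    t ^ ((μ.card.choose 2 : ℤ) - (permLength σ : ℤ)),
    mul_ne_zero (inv_ne_zero (tFactorial_ne_zero _))
      (sum_zpow_t_ne_zero _ Finset.univ_nonempty _), fun v hv => ?_⟩
  have h1 : ∀ l : List (Fin (μ.card - 1)),
      affToDaha μ.card (heckeToAff μ.card (l.map Hecke.T).prod) • v = v := by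
    intro l
    induction l with
    | nil => rw [List.map_nil, List.prod_nil, map_one, map_one, one_smul]
    | cons i l ih =>
      rw [List.map_cons, List.prod_cons, map_mul, map_mul, mul_smul, ih, heckeToAff_T,
        affToDaha_T, hv]
  change affToDaha μ.card (heckeToAff μ.card (epsilon μ.card)) • v = _
  rw [epsilon, map_smul, map_smul, map_sum, map_sum, smul_assoc, Finset.sum_smul, mul_smul,
    Finset.sum_smul]
  congr 1
  refine Finset.sum_congr rfl fun σ _ => ?_
  rw [map_smul, map_smul, smul_assoc, Hecke.Tperm, h1]

theorem V.eps_T (i : Fin (μ.card - 1)) (v : V μ) :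
    V.eps μ ((Daha.T i : Daha μ.card) • v) = V.eps μ v := by
  change affToDaha μ.card (heckeToAff μ.card (epsilon μ.card)) • (Daha.T i : Daha μ.card) • v =
    affToDaha μ.card (heckeToAff μ.card (epsilon μ.card)) • v
  rw [← affToDaha_T, ← heckeToAff_T, smul_smul, ← map_mul, ← map_mul, epsilon_mul_T]

/-- From F_σ = φ F_τ and ε T_i = ε follows ε F_σ = ((ta-b)/(a-b)) ε F_τ. If ta = b, the exponents
would agree and the content of i+1 would exceed that of i by one, which contradicts the descent. -/
theorem V.eps_nonsymF_mem (hT : T.IsRSSYT) (τ : PSYTOver T) :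
    V.eps μ (nonsymF τ.1) ∈ Submodule.span QT {V.eps μ (nonsymF (stdTop T).1)} := by
  induction τ using PSYTOver.induction_top hT with
  | h0 => exact Submodule.mem_span_singleton_self _
  | hs i τ σ hs hd ih =>
    have hu := hd.up (by rw [τ.2]; exact hT)
    rw [hs.nonsymF_eq hu, Daha.phi_smul, map_add, V.eps_T, map_smul (V.eps μ) (_ : QT),
      ← one_smul QT (V.eps μ (nonsymF τ.1)), smul_smul, ← add_smul, mul_one] at ih
    refine (Submodule.smul_mem_iff _ ?_).1 ih
    have h1 := sub_ne_zero.2 (τ.1.weight_lo_ne_hi i)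
    intro h0
    field_simp at h0
    have h2 : t * τ.1.weight (lo i) = τ.1.weight (hi i) := by linear_combination h0
    have h3 : q ^ τ.1.w (lo i) * t ^ (τ.1.c (lo i) + 1) = q ^ τ.1.w (hi i) * t ^ τ.1.c (hi i) := by
      rw [zpow_add_one₀ t_ne_zero]
      unfold PSYT.weight at h2
      linear_combination h2
    have h4 := qt_monomial_injective h3
    omega

theorem epsU_le (hT : T.IsRSSYT) :
    epsU T ≤ Submodule.span QT {V.eps μ (nonsymF (stdTop T).1)} := by
  rw [epsU, U, Submodule.map_span_le]
  rintro _ ⟨τ, rfl⟩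
  exact V.eps_nonsymF_mem hT τ

theorem symSum_mem (hT : T.IsRSSYT) : symSum T ∈ epsU T := by
  obtain ⟨k, hk, h⟩ := V.eps_smul_of_invariant (μ := μ)
  refine ⟨k⁻¹ • symSum T, Submodule.smul_mem _ _ (Submodule.sum_mem _ fun τ _ =>
    Submodule.smul_mem _ _ (Submodule.subset_span ⟨τ, rfl⟩)), ?_⟩
  change V.eps μ (k⁻¹ • symSum T) = _
  rw [map_smul, h _ (T_smul_symSum hT), smul_smul, inv_mul_cancel₀ hk, one_smul]

/-! ## Uniqueness -/

/-- Joint eigenvectors with different characters are independent. -/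
theorem smul_eq_zero_of_sum_eq_zero {ι J K M : Type*} [Field K] [AddCommGroup M] [Module K M]
    (θ : J → Module.End K M) (χ : ι → J → K) (hχ : Function.Injective χ) (v : ι → M)
    (h : ∀ i j, θ j (v i) = χ i j • v i) (s : Finset ι) (k : ι → K)
    (h0 : ∑ i ∈ s, k i • v i = 0) : ∀ i ∈ s, k i • v i = 0 := by
  classical
  induction s using Finset.induction_on generalizing k with
  | empty => simp
  | insert a s ha ih =>
    have h1 : ∀ i ∈ s, k i • v i = 0 := by
      intro i hi
      have hne : χ i ≠ χ a := fun e => ha (hχ e ▸ hi)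
      obtain ⟨j, hj⟩ := Function.ne_iff.1 hne
      have h2 := congrArg (fun x => θ j x - χ a j • x) h0
      simp only [map_sum, map_smul, h, Finset.smul_sum, ← Finset.sum_sub_distrib, map_zero,
        smul_zero, sub_zero] at h2
      rw [Finset.sum_insert ha, smul_comm, sub_self, zero_add] at h2
      have h3 := ih (fun i => (χ i j - χ a j) * k i) (by
        rw [← h2]
        refine Finset.sum_congr rfl fun l _ => ?_
        rw [mul_smul, sub_smul, smul_comm (χ l j)]) i hi
      rw [mul_smul] at h3
      exact (smul_eq_zero.1 h3).resolve_left (sub_ne_zero.2 hj)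
    rw [Finset.sum_insert ha, Finset.sum_eq_zero h1, add_zero] at h0
    intro i hi
    rcases Finset.mem_insert.1 hi with rfl | hi
    · exact h0
    · exact h1 i hi

/-- On a diagonal the lower box is reached by going down, where T strictly decreases, and then
right, where T does not increase. -/
theorem eq_of_val_eq_of_content_eq (hT : T.IsRSSYT) {x y : Box μ} (h : T.val x = T.val y)
    (hc : content x = content y) : x = y := by
  have key : ∀ x y : Box μ, content x = content y → x.1.1 < y.1.1 → T.val y < T.val x := by
    intro x y hc hlt
    unfold content at hc
    have hc' : x.1.2 < y.1.2 := by omega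
    have hz : (y.1.1, x.1.2) ∈ μ.cells :=
      μ.isLowerSet (Prod.mk_le_mk.2 ⟨le_rfl, hc'.le⟩) y.2
    have h1 := hT x ⟨_, hz⟩ ⟨rfl, hlt⟩
    have h2 := T.row_weak ⟨_, hz⟩ y ⟨rfl, hc'⟩
    omega
  rcases lt_trichotomy x.1.1 y.1.1 with h1 | h1 | h1
  · have := key x y hc h1
    omega
  · unfold content at hc
    exact Subtype.ext (Prod.ext h1 (by omega))
  · have := key y x hc.symm h1
    omega

theorem weight_injective (hT : T.IsRSSYT) :
    Function.Injective fun τ : PSYTOver T => τ.1.weight := by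
  intro τ σ h
  have h1 : ∀ j, τ.1.w j = σ.1.w j ∧ τ.1.c j = σ.1.c j := fun j =>
    qt_monomial_injective (congrFun h j)
  have e : ∀ (τ : PSYTOver T) j, T.val (τ.1.box j) = τ.1.w j := fun τ j => by
    rw [← PSYT.exps_val_box, τ.2]
  refine Subtype.ext (PSYT.ext_box (funext fun j => ?_) (funext fun j => (h1 j).1))
  exact eq_of_val_eq_of_content_eq hT (by rw [e, e]; exact (h1 j).1) (h1 j).2

/-- Stated for the vectors k_τ F_τ and not for the coefficients, since F_τ ≠ 0 is not known here. -/
theorem smul_nonsymF_eq_zero (hT : T.IsRSSYT) (k : PSYTOver T → QT)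
    (h : ∑ τ, k τ • nonsymF τ.1 = 0) (τ : PSYTOver T) : k τ • nonsymF τ.1 = 0 :=
  smul_eq_zero_of_sum_eq_zero
    (fun j => Algebra.lsmul QT QT (V μ) (Daha.θ j : Daha μ.card))
    (fun τ : PSYTOver T => τ.1.weight) (weight_injective hT) (fun τ => nonsymF τ.1)
    (fun τ j => theta_smul_nonsymF τ.1 j) Finset.univ k h τ (Finset.mem_univ _)

theorem symSum_eq (T : RYT μ) : symSum T = nonsymF (stdTop T).1 +
    ∑ y ∈ Finset.univ.erase (stdTop T), symCoeff T y • nonsymF y.1 := by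
  rw [symSum, ← Finset.add_sum_erase _ _ (Finset.mem_univ (stdTop T)), symCoeff_stdTop, one_smul]

theorem isSymMacdonald_iff (hT : T.IsRSSYT) (P : V μ) : IsSymMacdonald T P ↔ P = symSum T := by
  constructor
  · rintro ⟨hP, top, htop, κ, hκ⟩
    obtain rfl := (isTop_iff hT top).1 htop
    obtain ⟨a, ha⟩ := Submodule.mem_span_singleton.1 (epsU_le hT hP)
    obtain ⟨b, hb⟩ := Submodule.mem_span_singleton.1 (epsU_le hT (symSum_mem hT))
    -- If F_Top vanishes then ε(U_T) = 0 and both elements are zero.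
    by_cases h0 : nonsymF (stdTop T).1 = 0
    · rw [h0, map_zero, smul_zero] at ha hb
      rw [← ha, ← hb]
    have key : ∀ k : PSYTOver T → QT, ∑ τ, k τ • nonsymF τ.1 = 0 → k (stdTop T) = 0 :=
      fun k hk => (smul_eq_zero.1 (smul_nonsymF_eq_zero hT k hk _)).resolve_right h0
    have hb0 : b ≠ 0 := by
      rintro rfl
      rw [zero_smul] at hb
      have := key (symCoeff T) hb.symm
      rw [symCoeff_stdTop] at this
      exact one_ne_zero this
    have hPS : P = (a / b) • symSum T := by
      rw [← ha, ← hb, smul_smul, div_mul_cancel₀ _ hb0]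
    have hP2 : P = ∑ τ, Function.update κ (stdTop T) 1 τ • nonsymF τ.1 := by
      rw [← Finset.add_sum_erase _ _ (Finset.mem_univ (stdTop T)), Function.update_self, one_smul,
        hκ]
      congr 1
      refine Finset.sum_congr rfl fun y hy => ?_
      rw [Function.update_of_ne (Finset.ne_of_mem_erase hy)]
    -- P and the symmetric sum are proportional with ratio a / b; comparing their coefficients 1 at
    -- the top gives a / b = 1.
    have h1 := key (fun τ => Function.update κ (stdTop T) 1 τ - a / b * symCoeff T τ) (by
      simp only [sub_smul, mul_smul, Finset.sum_sub_distrib, ← Finset.smul_sum]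
      rw [← hP2, hPS, symSum, sub_self])
    simp only [Function.update_self, symCoeff_stdTop, mul_one] at h1
    rw [hPS, ← sub_eq_zero.1 h1, one_smul]
  · rintro rfl
    exact ⟨symSum_mem hT, stdTop T, (isTop_iff hT _).2 rfl, symCoeff T, symSum_eq T⟩

end VVMac
end
theorem mainTheorem7 (μ : YoungDiagram) (T : VVMac.RYT μ) (hT : T.IsRSSYT) (P : VVMac.V μ) :
    VVMac.IsSymMacdonald T P ↔
      P = ∑ τ : VVMac.PSYTOver T,
        (∏ p ∈ VVMac.Inv τ.1,
          (VVMac.q ^ T.val p.1 * VVMac.t ^ (VVMac.content p.1 + 1) -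
              VVMac.q ^ T.val p.2 * VVMac.t ^ VVMac.content p.2) /
            (VVMac.q ^ T.val p.1 * VVMac.t ^ VVMac.content p.1 -
              VVMac.q ^ T.val p.2 * VVMac.t ^ VVMac.content p.2)) •
          VVMac.nonsymF τ.1 :=
  VVMac.isSymMacdonald_iff hT P
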